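/- Let $n\in\mathbb N$ and let $\mathcal H$ be a complex separable Hilbert space. Let $\mathcal S_n(\mathcal H)$ be the set of closed, densely defined linear operators $T:\mathscr D(T)\subset\mathcal H\to\mathcal H$ that are symmetric, simple ($\bigcap_{\Im\lambda\ne0}\operatorname{Rng}(T-\lambda I)=\{0\}$) and satisfy $\dim\operatorname{Rng}(T-iI)^\perp=\dim\operatorname{Rng}(T+iI)^\perp=n$. A *model* for $T$ is a map $\Gamma:\mathbb C\setminus\mathbb R\to\mathcal B(\mathbb C^n,\mathcal H)$ such that $\lambda\mapsto\Gamma(\overline\lambda)$ is analytic, each $\Gamma(\lambda)$ is invertible from $\mathbb C^n$ onto $\operatorname{Rng}(T-\lambda I)^\perp$, $K_\lambda(z):=\Gamma(z)^*\Gamma(\lambda)$ is invertible whenever $z,\lambda$ lie in the same open half-plane, and the ranges of the $\Gamma(\lambda)$ span a dense subspace of $\mathcal H$. For a model $\Gamma$ the Livsic function of $T$ is, for $\Im z>0$, $$V(z)=\tfrac{z-i}{z+i}\,\Phi(z)^{-1}\Psi(z),\qquad \Phi(z)=K_i(z)K_i(i)^{-1/2},\quad \Psi(z)=K_{-i}(z)K_{-i}(-i)^{-1/2}.$$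 Put $\Omega(z)=(I+iV(z))(I-iV(z))^{-1}$ for $\Im z>0$, $\Omega(z)=-\Omega(\overline z)^*$ for $\Im z<0$, and $$K^V_\lambda(z)=\frac{\Omega(z)+\Omega(\lambda)^*}{\pi i(\overline\lambda-z)}\qquad(\lambda,z\in\mathbb C\setminus\mathbb R),$$ the removable singularity at $z=\overline\lambda$ being filled in by continuity. A *positive matrix-valued measure* $\mu$ on $\mathbb R$ assigns to every bounded Borel set $E$ a positive semidefinite matrix $\mu(E)\in M_{n\times n}(\mathbb C)$, and is countably additive on disjoint sequences of Borel sets with bounded union. $L^2_{\mathbb C^n}(\mu)$ is the space of (classes of) measurable $f:\mathbb R\to\mathbb C^n$ with $\int\langle d\mu(t)f(t),f(t)\rangle<\infty$, integrals being formed with the density of $\mu$ with respect to its trace measure. $M_\mu$ is multiplication by the independent variable $x$ on $L^2_{\mathbb C^n}(\mu)$ with domain $$\mathscr D(M_\mu)=\Big\{f\in L^2_{\mathbb C^n}(\mu):\ xf\in L^2_{\mathbb C^n}(\mu),\ \int d\mu(t)f(t)=0\Big\}.$$ **Corollary.** Every $T\in\mathcal S_n(\mathcal H)$ has a model, and for every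 model $\Gamma$ of $T$, with Livsic function $V$, there is a positive matrix-valued measure $\mu$ on $\mathbb R$ such that 1. $\displaystyle\int\frac{d\langle\mu(t)a,a\rangle}{1+t^2}<\infty$ for all $a\in\mathbb C^n$; 2. $\displaystyle K^V_\lambda(z)=\frac1{\pi^2}\int\frac{d\mu(t)}{(t-\overline\lambda)(t-z)}$ for all $\lambda,z\in\mathbb C\setminus\mathbb R$; 3. $K^V$ is a positive definite kernel, and the Cauchy transform $f\mapsto\dfrac1{\pi i}\displaystyle\int\frac{d\mu(t)f(t)}{t-z}$ is a unitary map of $L^2_{\mathbb C^n}(\mu)$ onto the reproducing kernel Hilbert space $\mathscr H(V)$ with kernel $K^V$; 4. $T$ is unitarily equivalent to $M_\mu$. -/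

import Mathlib

open MeasureTheory
open scoped ENNReal ComplexOrder ComplexConjugate

noncomputable section

/-! ## Positive matrix-valued measures on the line -/

/-- A positive `n × n` matrix-valued Borel measure on `ℝ`: a positive semidefinite matrix `μ(S)`
for each bounded Borel set `S`, countably additive on disjoint sequences with bounded union.
(The measure need not be finite, so `μ(S)` is a matrix for bounded `S` only; the value on every
other set is the junk value `0`.) -/
structure MatrixMeasure (n : ℕ) where
  toFun : Set ℝ → Matrix (Fin n) (Fin n) ℂ
  posSemidef' : ∀ S, MeasurableSet S → Bornology.IsBounded S → (toFun S).PosSemidef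
  eq_zero' : ∀ S, ¬ (MeasurableSet S ∧ Bornology.IsBounded S) → toFun S = 0
  hasSum_iUnion' : ∀ S : ℕ → Set ℝ, (∀ i, MeasurableSet (S i)) →
    Bornology.IsBounded (⋃ i, S i) → Pairwise (Function.onFun Disjoint S) →
    HasSum (fun i => toFun (S i)) (toFun (⋃ i, S i))

namespace MatrixMeasure

variable {n : ℕ} (μ : MatrixMeasure n)

/-- The matrix `μ(S)` as an operator on `ℂⁿ`. -/
def op (S : Set ℝ) : EuclideanSpace ℂ (Fin n) →L[ℂ] EuclideanSpace ℂ (Fin n) :=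
  Matrix.toEuclideanCLM (n := Fin n) (𝕜 := ℂ) (μ.toFun S)

/-- The real number `⟨μ(S) a, a⟩`. -/
def quad (a : EuclideanSpace ℂ (Fin n)) (S : Set ℝ) : ℝ := (inner ℂ a (μ.op S a)).re

lemma op_isPositive (S : Set ℝ) : (μ.op S).IsPositive := by
  have h : (μ.toFun S).PosSemidef := by
    by_cases hS : MeasurableSet S ∧ Bornology.IsBounded S
    · exact μ.posSemidef' S hS.1 hS.2
    · rw [μ.eq_zero' S hS]; exact Matrix.PosSemidef.zero
  rw [← ContinuousLinearMap.isPositive_toLinearMap_iff]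
  have := Matrix.isPositive_toEuclideanLin_iff.2 h
  rwa [← Matrix.coe_toEuclideanCLM_eq_toEuclideanLin] at this

lemma quad_nonneg (a : EuclideanSpace ℂ (Fin n)) (S : Set ℝ) : 0 ≤ μ.quad a S :=
  (μ.op_isPositive S).re_inner_nonneg_right a

lemma inner_op_self (a : EuclideanSpace ℂ (Fin n)) (S : Set ℝ) :
    inner ℂ a (μ.op S a) = (μ.quad a S : ℂ) := by
  have h := (ContinuousLinearMap.isPositive_iff_complex _).1 (μ.op_isPositive S) a
  have h2 : inner ℂ a (μ.op S a) = inner ℂ (μ.op S a) a :=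
    ((μ.op_isPositive S).isSymmetric a a).symm
  rw [quad, h2]
  exact h.1.symm

lemma hasSum_quad (a : EuclideanSpace ℂ (Fin n)) (S : ℕ → Set ℝ)
    (hS : ∀ i, MeasurableSet (S i)) (hb : Bornology.IsBounded (⋃ i, S i))
    (hd : Pairwise (Function.onFun Disjoint S)) :
    HasSum (fun i => μ.quad a (S i)) (μ.quad a (⋃ i, S i)) := by
  let L : Matrix (Fin n) (Fin n) ℂ →ₗ[ℝ] ℝ :=
    { toFun := fun M => (inner ℂ a (Matrix.toEuclideanCLM (n := Fin n) (𝕜 := ℂ) M a)).re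
      map_add' := fun M N => by simp
      map_smul' := fun c M => by
        have : c • M = (c : ℂ) • M := by ext; simp
        rw [this, map_smul, smul_apply, inner_smul_right]
        simp }
  have hL : Continuous L := L.continuous_of_finiteDimensional
  exact (μ.hasSum_iUnion' S hS hb hd).map L.toAddMonoidHom hL

lemma quad_empty (a : EuclideanSpace ℂ (Fin n)) : μ.quad a ∅ = 0 := by
  have h := μ.hasSum_quad a (fun _ => ∅) (fun _ => MeasurableSet.empty) (by simp)
    (fun i j _ => by simp [Function.onFun])
  have := h.summable.tendsto_atTop_zero
  simpa using tendsto_nhds_unique tendsto_const_nhds this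

/-- The scalar positive Borel measure `S ↦ ⟨μ(S) a, a⟩` on `ℝ`, extended from bounded Borel sets
to all Borel sets by countable additivity over the intervals `(k, k + 1]`. -/
def scalarMeasure (a : EuclideanSpace ℂ (Fin n)) : Measure ℝ :=
  Measure.ofMeasurable
    (fun S _ => ∑' k : ℤ, ENNReal.ofReal (μ.quad a (S ∩ Set.Ioc (k : ℝ) (k + 1))))
    (by simp [quad_empty])
    (by
      intro f hf hd
      rw [ENNReal.tsum_comm]
      refine tsum_congr fun k => ?_
      rw [Set.iUnion_inter]
      have hh := μ.hasSum_quad a (fun i => f i ∩ Set.Ioc (k : ℝ) (k + 1))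
        (fun i => (hf i).inter measurableSet_Ioc)
        ((Metric.isBounded_Ioc (k : ℝ) (k + 1)).subset
          (Set.iUnion_subset fun i => Set.inter_subset_right))
        (fun i j hij => (hd hij).mono Set.inter_subset_left Set.inter_subset_left)
      rw [← hh.tsum_eq, ENNReal.ofReal_tsum_of_nonneg (fun i => μ.quad_nonneg a _) hh.summable])

lemma scalarMeasure_apply (a : EuclideanSpace ℂ (Fin n)) {S : Set ℝ} (hS : MeasurableSet S)
    (hb : Bornology.IsBounded S) : μ.scalarMeasure a S = ENNReal.ofReal (μ.quad a S) := by
  rw [scalarMeasure, Measure.ofMeasurable_apply S hS]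
  let e : ℕ ≃ ℤ := Equiv.intEquivNat.symm
  rw [← e.tsum_eq]
  have hU : (⋃ i : ℕ, S ∩ Set.Ioc ((e i : ℤ) : ℝ) ((e i : ℤ) + 1)) = S := by
    rw [← Set.inter_iUnion]
    have : (⋃ i : ℕ, Set.Ioc ((e i : ℤ) : ℝ) ((e i : ℤ) + 1)) = Set.univ := by
      rw [e.surjective.iUnion_comp (fun k : ℤ => Set.Ioc (k : ℝ) (k + 1))]
      exact iUnion_Ioc_intCast ℝ
    rw [this, Set.inter_univ]
  have hdis : Pairwise (Function.onFun Disjoint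
      (fun k : ℤ => Set.Ioc (k : ℝ) (k + 1))) := by
    exact Set.pairwise_disjoint_Ioc_intCast ℝ
  have hh := μ.hasSum_quad a (fun i : ℕ => S ∩ Set.Ioc ((e i : ℤ) : ℝ) ((e i : ℤ) + 1))
    (fun i => hS.inter measurableSet_Ioc) (by rw [hU]; exact hb)
    (fun i j hij => (hdis (e.injective.ne hij)).mono Set.inter_subset_right Set.inter_subset_right)
  rw [hU] at hh
  rw [← hh.tsum_eq, ENNReal.ofReal_tsum_of_nonneg (fun i => μ.quad_nonneg a _) hh.summable]

instance (a : EuclideanSpace ℂ (Fin n)) : IsLocallyFiniteMeasure (μ.scalarMeasure a) := by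
  refine ⟨fun x => ⟨Metric.ball x 1, Metric.ball_mem_nhds x one_pos, ?_⟩⟩
  rw [μ.scalarMeasure_apply a measurableSet_ball Metric.isBounded_ball]
  exact ENNReal.ofReal_lt_top

/-- The trace measure `S ↦ tr μ(S)`, a locally finite positive Borel measure on `ℝ`. -/
def traceMeasure : Measure ℝ :=
  ∑ j : Fin n, μ.scalarMeasure (EuclideanSpace.single j 1)

instance : IsLocallyFiniteMeasure μ.traceMeasure := by
  refine ⟨fun x => ⟨Metric.ball x 1, Metric.ball_mem_nhds x one_pos, ?_⟩⟩
  rw [traceMeasure, Measure.finsetSum_apply, ENNReal.sum_lt_top]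
  intro j _
  rw [μ.scalarMeasure_apply _ measurableSet_ball Metric.isBounded_ball]
  exact ENNReal.ofReal_lt_top

lemma op_eq_zero_of_traceMeasure {S : Set ℝ} (hS : MeasurableSet S) (hb : Bornology.IsBounded S)
    (h : μ.traceMeasure S = 0) : μ.op S = 0 := by
  have hq : ∀ j, μ.quad (EuclideanSpace.single j 1) S = 0 := by
    intro j
    rw [traceMeasure, Measure.finsetSum_apply, Finset.sum_eq_zero_iff] at h
    have := h j (Finset.mem_univ j)
    rw [μ.scalarMeasure_apply _ hS hb, ENNReal.ofReal_eq_zero] at this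
    exact le_antisymm this (μ.quad_nonneg _ _)
  have hd : ∀ j, μ.toFun S j j = 0 := by
    intro j
    have h1 := μ.inner_op_self (EuclideanSpace.single j 1) S
    rw [hq j, op] at h1
    simpa [EuclideanSpace.inner_single_left, Matrix.ofLp_toEuclideanCLM] using h1
  have : μ.toFun S = 0 := by
    rw [← (μ.posSemidef' S hS hb).trace_eq_zero_iff, Matrix.trace]
    exact Finset.sum_eq_zero fun j _ => hd j
  rw [op, this, map_zero]

lemma scalarMeasure_absolutelyContinuous (a : EuclideanSpace ℂ (Fin n)) :
    μ.scalarMeasure a ≪ μ.traceMeasure := by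
  refine Measure.AbsolutelyContinuous.mk fun S hS h => ?_
  rw [scalarMeasure, Measure.ofMeasurable_apply S hS, ENNReal.tsum_eq_zero]
  intro k
  have := μ.op_eq_zero_of_traceMeasure (hS.inter measurableSet_Ioc)
    ((Metric.isBounded_Ioc (k : ℝ) (k + 1)).subset Set.inter_subset_right)
    (measure_mono_null Set.inter_subset_left h)
  simp [quad, this]

/-- Polarization: the `(j, k)` entry of a Hermitian matrix with quadratic form `f`. -/
def polCoeff (f : EuclideanSpace ℂ (Fin n) → ℝ) (j k : Fin n) : ℂ :=
  (1 / 4 : ℂ) * (f (EuclideanSpace.single j 1 + EuclideanSpace.single k 1)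
      - f (EuclideanSpace.single j 1 - EuclideanSpace.single k 1)
      - Complex.I * f (EuclideanSpace.single j 1 + Complex.I • EuclideanSpace.single k 1)
      + Complex.I * f (EuclideanSpace.single j 1 - Complex.I • EuclideanSpace.single k 1))

/-- The operator on `ℂⁿ` whose quadratic form is `f`, if there is one. -/
def pol (f : EuclideanSpace ℂ (Fin n) → ℝ) :
    EuclideanSpace ℂ (Fin n) →L[ℂ] EuclideanSpace ℂ (Fin n) :=
  ∑ j, ∑ k, polCoeff f j k • Matrix.toEuclideanCLM (n := Fin n) (𝕜 := ℂ) (Matrix.single j k 1)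

lemma op_eq_pol (S : Set ℝ) : μ.op S = pol fun a => μ.quad a S := by
  have key : ∀ j k, μ.toFun S j k = polCoeff (fun a => μ.quad a S) j k := by
    intro j k
    have h1 : μ.toFun S j k
        = inner ℂ (EuclideanSpace.single j (1 : ℂ)) (μ.op S (EuclideanSpace.single k 1)) := by
      simp [op, EuclideanSpace.inner_single_left, Matrix.ofLp_toEuclideanCLM]
    have h2 := inner_map_polarization' (μ.op S : EuclideanSpace ℂ (Fin n) →ₗ[ℂ] _)
      (EuclideanSpace.single j (1 : ℂ)) (EuclideanSpace.single k (1 : ℂ))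
    have hs := (μ.op_isPositive S).isSymmetric
    have h3 : ∀ a, inner ℂ ((μ.op S : EuclideanSpace ℂ (Fin n) →ₗ[ℂ] _) a) a
        = (μ.quad a S : ℂ) := fun a => by rw [hs a a]; exact μ.inner_op_self a S
    rw [h3, h3, h3, h3, hs] at h2
    rw [h1, polCoeff]
    refine Eq.trans h2 ?_
    ring
  rw [pol, op]
  conv_lhs => rw [Matrix.matrix_eq_sum_single (μ.toFun S)]
  rw [map_sum]
  refine Finset.sum_congr rfl fun j _ => ?_
  rw [map_sum]
  refine Finset.sum_congr rfl fun k _ => ?_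
  rw [← key, ← map_smul, Matrix.smul_single, smul_eq_mul, mul_one]

lemma integrable_polCoeff {r : EuclideanSpace ℂ (Fin n) → ℝ → ℝ} {ν : Measure ℝ}
    (hr : ∀ a, Integrable (r a) ν) (j k : Fin n) :
    Integrable (fun t => polCoeff (fun a => r a t) j k) ν ∧
      ∫ t, polCoeff (fun a => r a t) j k ∂ν = polCoeff (fun a => ∫ t, r a t ∂ν) j k := by
  have hc : ∀ a, Integrable (fun t => (r a t : ℂ)) ν := fun a => (hr a).ofReal
  have hi : ∀ a, ∫ t, (r a t : ℂ) ∂ν = ((∫ t, r a t ∂ν : ℝ) : ℂ) :=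
    fun a => integral_complex_ofReal
  have gen : ∀ {f g p q : ℝ → ℂ}, Integrable f ν → Integrable g ν → Integrable p ν →
      Integrable q ν →
      Integrable (fun t => (1 / 4 : ℂ) * (f t - g t - Complex.I * p t + Complex.I * q t)) ν ∧
      ∫ t, (1 / 4 : ℂ) * (f t - g t - Complex.I * p t + Complex.I * q t) ∂ν
        = (1 / 4 : ℂ) * ((∫ t, f t ∂ν) - (∫ t, g t ∂ν) - Complex.I * (∫ t, p t ∂ν)
          + Complex.I * ∫ t, q t ∂ν) := by
    intro f g p q hf hg hp hq
    have h1 : Integrable (fun t => f t - g t) ν := hf.sub hg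
    have h2 : Integrable (fun t => Complex.I * p t) ν := hp.const_mul _
    have h3 : Integrable (fun t => Complex.I * q t) ν := hq.const_mul _
    have h4 : Integrable (fun t => f t - g t - Complex.I * p t) ν := h1.sub h2
    refine ⟨(h4.add h3).const_mul _, ?_⟩
    rw [integral_const_mul, integral_add h4 h3, integral_sub h1 h2, integral_sub hf hg,
      integral_const_mul, integral_const_mul]
  have h := gen (hc (EuclideanSpace.single j 1 + EuclideanSpace.single k 1))
    (hc (EuclideanSpace.single j 1 - EuclideanSpace.single k 1))
    (hc (EuclideanSpace.single j 1 + Complex.I • EuclideanSpace.single k 1))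
    (hc (EuclideanSpace.single j 1 - Complex.I • EuclideanSpace.single k 1))
  refine ⟨h.1, ?_⟩
  unfold polCoeff
  rw [h.2, hi, hi, hi, hi]

lemma integrable_sum_smul {F : Type*} [NormedAddCommGroup F] [NormedSpace ℂ F] [CompleteSpace F]
    {c : Fin n → Fin n → ℝ → ℂ} {ν : Measure ℝ} (hc : ∀ j k, Integrable (c j k) ν)
    (B : Fin n → Fin n → F) :
    Integrable (fun t => ∑ j, ∑ k, c j k t • B j k) ν ∧
      ∫ t, (∑ j, ∑ k, c j k t • B j k) ∂ν = ∑ j, ∑ k, (∫ t, c j k t ∂ν) • B j k := by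
  have hj : ∀ j k, Integrable (fun t => c j k t • B j k) ν := fun j k => (hc j k).smul_const _
  refine ⟨integrable_finsetSum _ fun j _ => integrable_finsetSum _ fun k _ => hj j k, ?_⟩
  rw [integral_finsetSum _ fun j _ => integrable_finsetSum _ fun k _ => hj j k]
  refine Finset.sum_congr rfl fun j _ => ?_
  rw [integral_finsetSum _ fun k _ => hj j k]
  exact Finset.sum_congr rfl fun k _ => integral_smul_const _ _

lemma integrable_pol {r : EuclideanSpace ℂ (Fin n) → ℝ → ℝ} {ν : Measure ℝ}
    (hr : ∀ a, Integrable (r a) ν) :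
    Integrable (fun t => pol fun a => r a t) ν ∧
      ∫ t, (pol fun a => r a t) ∂ν = pol fun a => ∫ t, r a t ∂ν := by
  have h := integrable_sum_smul (fun j k => (integrable_polCoeff hr j k).1)
    (fun j k => Matrix.toEuclideanCLM (n := Fin n) (𝕜 := ℂ) (Matrix.single j k 1))
  refine ⟨h.1, h.2.trans ?_⟩
  simp only [(integrable_polCoeff hr _ _).2]
  rfl

lemma stronglyMeasurable_pol {r : EuclideanSpace ℂ (Fin n) → ℝ → ℝ}
    (hr : ∀ a, Measurable (r a)) : StronglyMeasurable (fun t => pol fun a => r a t) := by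
  unfold pol polCoeff
  refine Finset.stronglyMeasurable_fun_sum _ fun j _ =>
    Finset.stronglyMeasurable_fun_sum _ fun k _ => StronglyMeasurable.smul_const ?_ _
  refine Measurable.stronglyMeasurable ?_
  have hc : ∀ a, Measurable (fun t => (r a t : ℂ)) := fun a => Complex.measurable_ofReal.comp (hr a)
  fun_prop

/-- **Radon–Nikodym theorem**: a positive matrix measure has a positive semidefinite density with
respect to its trace measure. -/
theorem exists_density : ∃ D : ℝ → EuclideanSpace ℂ (Fin n) →L[ℂ] EuclideanSpace ℂ (Fin n),
    StronglyMeasurable D ∧ (∀ t, (D t).IsPositive) ∧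
    ∀ S, MeasurableSet S → Bornology.IsBounded S →
      IntegrableOn D S μ.traceMeasure ∧ ∫ t in S, D t ∂μ.traceMeasure = μ.op S := by
  set τ := μ.traceMeasure with hτ
  let r : EuclideanSpace ℂ (Fin n) → ℝ → ℝ := fun a t => ((μ.scalarMeasure a).rnDeriv τ t).toReal
  have hrm : ∀ a, Measurable (r a) := fun a => (Measure.measurable_rnDeriv _ _).ennreal_toReal
  have hwd : ∀ a, τ.withDensity ((μ.scalarMeasure a).rnDeriv τ) = μ.scalarMeasure a := fun a =>
    Measure.withDensity_rnDeriv_eq _ _ (μ.scalarMeasure_absolutelyContinuous a)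
  have hri : ∀ a S, MeasurableSet S → Bornology.IsBounded S →
      IntegrableOn (r a) S τ ∧ ∫ t in S, r a t ∂τ = μ.quad a S := by
    intro a S hS hb
    have h1 : ∫⁻ t in S, (μ.scalarMeasure a).rnDeriv τ t ∂τ = ENNReal.ofReal (μ.quad a S) := by
      rw [← withDensity_apply _ hS, hwd, μ.scalarMeasure_apply a hS hb]
    have hne : ∫⁻ t in S, (μ.scalarMeasure a).rnDeriv τ t ∂τ ≠ ∞ := by
      rw [h1]; exact ENNReal.ofReal_ne_top
    refine ⟨integrable_toReal_of_lintegral_ne_top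
      (Measure.measurable_rnDeriv _ _).aemeasurable hne, ?_⟩
    rw [integral_toReal (Measure.measurable_rnDeriv _ _).aemeasurable
      (ae_lt_top (Measure.measurable_rnDeriv _ _) hne), h1,
      ENNReal.toReal_ofReal (μ.quad_nonneg a S)]
  let D₀ : ℝ → EuclideanSpace ℂ (Fin n) →L[ℂ] EuclideanSpace ℂ (Fin n) :=
    fun t => pol fun a => r a t
  have hD₀m : StronglyMeasurable D₀ := stronglyMeasurable_pol hrm
  have hD₀ : ∀ S, MeasurableSet S → Bornology.IsBounded S →
      IntegrableOn D₀ S τ ∧ ∫ t in S, D₀ t ∂τ = μ.op S := by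
    intro S hS hb
    have h := integrable_pol (fun a => (hri a S hS hb).1)
    refine ⟨h.1, h.2.trans ?_⟩
    rw [op_eq_pol]
    congr 1
    funext a
    exact (hri a S hS hb).2
  have hae : ∀ a, ∀ᵐ t ∂τ, inner ℂ a (D₀ t a) = (r a t : ℂ) := by
    intro a
    have hU : (⋃ k : ℤ, Set.Ioc (k : ℝ) (k + 1)) = Set.univ := iUnion_Ioc_intCast ℝ
    rw [← Measure.restrict_univ (μ := τ), ← hU, ae_restrict_iUnion_iff]
    intro k
    have hB := Metric.isBounded_Ioc (k : ℝ) (k + 1)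
    let L : (EuclideanSpace ℂ (Fin n) →L[ℂ] EuclideanSpace ℂ (Fin n)) →L[ℂ] ℂ :=
      (innerSL ℂ a).comp (ContinuousLinearMap.apply ℂ _ a)
    refine Integrable.ae_eq_of_forall_setIntegral_eq _ _
      (L.integrable_comp (hD₀ _ measurableSet_Ioc hB).1)
      (hri a _ measurableSet_Ioc hB).1.ofReal ?_
    intro S hS _
    rw [Measure.restrict_restrict hS]
    have hb : Bornology.IsBounded (S ∩ Set.Ioc (k : ℝ) (k + 1)) := hB.subset Set.inter_subset_right
    have hm := hS.inter (measurableSet_Ioc (a := (k : ℝ)) (b := k + 1))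
    have hL := L.integral_comp_comm (hD₀ _ hm hb).1
    rw [(hD₀ _ hm hb).2] at hL
    rw [integral_complex_ofReal, (hri a _ hm hb).2]
    exact hL.trans (μ.inner_op_self a _)
  have hpos : ∀ᵐ t ∂τ, (D₀ t).IsPositive := by
    have h := ae_all_iff.2 fun m : ℕ => hae (TopologicalSpace.denseSeq _ m)
    filter_upwards [h] with t ht
    have hcl : IsClosed {a : EuclideanSpace ℂ (Fin n) | 0 ≤ inner ℂ a (D₀ t a)} :=
      isClosed_Ici.preimage (f := fun a : EuclideanSpace ℂ (Fin n) => inner ℂ a (D₀ t a))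
        (by fun_prop)
    have hall : ∀ a, 0 ≤ inner ℂ a (D₀ t a) := by
      intro a
      have : closure (Set.range (TopologicalSpace.denseSeq (EuclideanSpace ℂ (Fin n)))) ⊆
          {a : EuclideanSpace ℂ (Fin n) | 0 ≤ inner ℂ a (D₀ t a)} := by
        refine hcl.closure_subset_iff.2 ?_
        rintro _ ⟨m, rfl⟩
        rw [Set.mem_ofPred_eq, ht m]
        exact_mod_cast ENNReal.toReal_nonneg
      exact this (TopologicalSpace.denseRange_denseSeq _ a)
    rw [ContinuousLinearMap.isPositive_iff_complex]
    intro a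
    obtain ⟨h1, h2⟩ := Complex.nonneg_iff.1 (hall a)
    rw [← inner_conj_symm]
    refine ⟨Complex.ext ?_ ?_, ?_⟩
    · simp only [RCLike.re_to_complex, Complex.ofReal_re]
    · rw [Complex.ofReal_im, Complex.conj_im, ← h2, neg_zero]
    · rw [RCLike.re_to_complex, Complex.conj_re]; exact h1
  let N := toMeasurable τ {t | ¬ (D₀ t).IsPositive}
  have hN : τ N = 0 := by rw [measure_toMeasurable]; exact hpos
  refine ⟨Nᶜ.indicator D₀, hD₀m.indicator (measurableSet_toMeasurable _ _).compl, ?_, ?_⟩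
  · intro t
    by_cases ht : t ∈ N
    · rw [Set.indicator_of_notMem (by simpa using ht)]
      exact ContinuousLinearMap.isPositive_zero
    · rw [Set.indicator_of_mem (by simpa using ht)]
      by_contra hc
      exact ht (subset_toMeasurable _ _ hc)
  · intro S hS hb
    have he : D₀ =ᵐ[τ.restrict S] Nᶜ.indicator D₀ := by
      refine ae_restrict_of_ae ?_
      filter_upwards [measure_eq_zero_iff_ae_notMem.1 hN] with t ht
      rw [Set.indicator_of_mem (by simpa using ht)]
    exact ⟨(hD₀ S hS hb).1.congr he, by rw [← integral_congr_ae he]; exact (hD₀ S hS hb).2⟩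

/-- The density `dμ/dτ` of `μ` with respect to its trace measure `τ`. -/
def density : ℝ → EuclideanSpace ℂ (Fin n) →L[ℂ] EuclideanSpace ℂ (Fin n) :=
  μ.exists_density.choose

lemma stronglyMeasurable_density : StronglyMeasurable μ.density :=
  μ.exists_density.choose_spec.1

lemma density_isPositive (t : ℝ) : (μ.density t).IsPositive :=
  μ.exists_density.choose_spec.2.1 t

lemma setIntegral_density {S : Set ℝ} (hS : MeasurableSet S) (hb : Bornology.IsBounded S) :
    IntegrableOn μ.density S μ.traceMeasure ∧
      ∫ t in S, μ.density t ∂μ.traceMeasure = μ.op S :=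
  μ.exists_density.choose_spec.2.2 S hS hb

/-! ## The space `L²(μ)` of `ℂⁿ`-valued functions -/

lemma aestronglyMeasurable_density_apply {f : ℝ → EuclideanSpace ℂ (Fin n)}
    (hf : AEStronglyMeasurable f μ.traceMeasure) :
    AEStronglyMeasurable (fun t => μ.density t (f t)) μ.traceMeasure :=
  isBoundedBilinearMap_apply.continuous.comp_aestronglyMeasurable₂
    μ.stronglyMeasurable_density.aestronglyMeasurable hf

lemma aestronglyMeasurable_inner {f g : ℝ → EuclideanSpace ℂ (Fin n)}
    (hf : AEStronglyMeasurable f μ.traceMeasure) (hg : AEStronglyMeasurable g μ.traceMeasure) :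
    AEStronglyMeasurable (fun t => inner ℂ (f t) (μ.density t (g t))) μ.traceMeasure :=
  hf.inner (μ.aestronglyMeasurable_density_apply hg)

lemma density_re_nonneg (t : ℝ) (x : EuclideanSpace ℂ (Fin n)) :
    0 ≤ (inner ℂ x (μ.density t x)).re :=
  (μ.density_isPositive t).re_inner_nonneg_right x

lemma inner_density_symm (t : ℝ) (x y : EuclideanSpace ℂ (Fin n)) :
    inner ℂ (μ.density t x) y = inner ℂ x (μ.density t y) :=
  (μ.density_isPositive t).isSymmetric x y

/-- The measurable functions `f : ℝ → ℂⁿ` with `∫ ⟨dμ(t) f(t), f(t)⟩ < ∞`. -/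
def sqIntegrable : Submodule ℂ (ℝ → EuclideanSpace ℂ (Fin n)) where
  carrier := {f | AEStronglyMeasurable f μ.traceMeasure ∧
    Integrable (fun t => (inner ℂ (f t) (μ.density t (f t))).re) μ.traceMeasure}
  zero_mem' := ⟨aestronglyMeasurable_zero, by simp⟩
  add_mem' := by
    rintro f g ⟨hf, hf'⟩ ⟨hg, hg'⟩
    refine ⟨hf.add hg, Integrable.mono' ((hf'.const_mul 2).add (hg'.const_mul 2))
      (Complex.continuous_re.comp_aestronglyMeasurable
        (μ.aestronglyMeasurable_inner (hf.add hg) (hf.add hg))) (ae_of_all _ fun t => ?_)⟩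
    rw [Real.norm_of_nonneg (μ.density_re_nonneg t _)]
    have h := μ.density_re_nonneg t (f t - g t)
    simp only [Pi.add_apply, map_add, map_sub, inner_add_left, inner_add_right, inner_sub_left,
      inner_sub_right, Complex.add_re, Complex.sub_re] at h ⊢
    linarith
  smul_mem' := by
    rintro c f ⟨hf, hf'⟩
    refine ⟨hf.const_smul c, ?_⟩
    convert hf'.const_mul (‖c‖ ^ 2) using 2 with t
    simp only [Pi.smul_apply, map_smul, inner_smul_left, inner_smul_right]
    rw [← mul_assoc, Complex.mul_conj']
    rw [← Complex.ofReal_pow, Complex.re_ofReal_mul]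

/-- The functions of `sqIntegrable` as a type, to carry the seminorm of `L²(μ)`. -/
def L2Fun : Type := μ.sqIntegrable

instance : AddCommGroup μ.L2Fun := inferInstanceAs (AddCommGroup μ.sqIntegrable)
instance : Module ℂ μ.L2Fun := inferInstanceAs (Module ℂ μ.sqIntegrable)
instance : CoeFun μ.L2Fun (fun _ => ℝ → EuclideanSpace ℂ (Fin n)) := ⟨fun f => f.1⟩

lemma integrable_inner (f g : μ.L2Fun) :
    Integrable (fun t => inner ℂ (f t) (μ.density t (g t))) μ.traceMeasure := by
  have hq : ∀ h : μ.L2Fun,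
      Integrable (fun t => inner ℂ (h t) (μ.density t (h t))) μ.traceMeasure := by
    intro h
    have h1 := h.2.2.ofReal (𝕜 := ℂ)
    refine h1.congr (ae_of_all _ fun t => ?_)
    have h2 := (ContinuousLinearMap.isPositive_iff_complex _).1 (μ.density_isPositive t) (h t)
    rw [μ.inner_density_symm] at h2
    exact h2.1
  have h1 := hq (f + g)
  have h2 := hq (f - g)
  have h3 := hq (f + Complex.I • g)
  have h4 := hq (f - Complex.I • g)
  have h := (((h1.sub h2).sub (h3.const_mul Complex.I)).add (h4.const_mul Complex.I)).div_const 4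
  refine h.congr (ae_of_all _ fun t => ?_)
  have hp := inner_map_polarization'
    (μ.density t : EuclideanSpace ℂ (Fin n) →ₗ[ℂ] EuclideanSpace ℂ (Fin n)) (f t) (g t)
  simp only [ContinuousLinearMap.coe_coe, μ.inner_density_symm] at hp
  exact hp.symm

instance : PreInnerProductSpace.Core ℂ μ.L2Fun where
  inner f g := ∫ t, inner ℂ (f t) (μ.density t (g t)) ∂μ.traceMeasure
  conj_inner_symm f g := by
    rw [← integral_conj]
    refine integral_congr_ae (ae_of_all _ fun t => ?_)
    exact (inner_conj_symm _ _).trans (μ.inner_density_symm t _ _)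
  re_inner_nonneg f := by
    have h := integral_re (μ.integrable_inner f f)
    exact h ▸ integral_nonneg fun t => μ.density_re_nonneg t (f t)
  add_left f g h := by
    rw [← integral_add (μ.integrable_inner f h) (μ.integrable_inner g h)]
    exact integral_congr_ae (ae_of_all _ fun t => inner_add_left _ _ _)
  smul_left f g c := by
    rw [← integral_const_mul]
    exact integral_congr_ae (ae_of_all _ fun t => inner_smul_left _ _ _)

instance : SeminormedAddCommGroup μ.L2Fun :=
  InnerProductSpace.Core.toSeminormedAddCommGroup (𝕜 := ℂ)

instance : InnerProductSpace ℂ μ.L2Fun := .ofCore _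

lemma inner_def (f g : μ.L2Fun) :
    inner ℂ f g = ∫ t, inner ℂ (f t) (μ.density t (g t)) ∂μ.traceMeasure := rfl

/-- The space `L²(μ)`: square integrable functions modulo functions of norm `0`, with
`⟨f, g⟩ = ∫ ⟨f(t), dμ(t) g(t)⟩` (conjugate linear in the first argument). -/
abbrev L2 : Type := SeparationQuotient μ.L2Fun

/-- The class in `L²(μ)` of a square integrable function. -/
def toL2 : μ.L2Fun →ₗ[ℂ] μ.L2 := (SeparationQuotient.mkCLM ℂ μ.L2Fun : μ.L2Fun →ₗ[ℂ] μ.L2)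

/-- The vector integral `∫ dμ(t) f(t)`. -/
def integral (f : ℝ → EuclideanSpace ℂ (Fin n)) : EuclideanSpace ℂ (Fin n) :=
  ∫ t, μ.density t (f t) ∂μ.traceMeasure

/-! ## Multiplication by the independent variable on `L²(μ)` -/

/-- The graph of `M_μ`: all pairs `(f, x f)` with `f, x f ∈ L²(μ)` and `∫ dμ(t) f(t) = 0`. -/
def mulGraph : Submodule ℂ (μ.L2 × μ.L2) where
  carrier := {p | ∃ f g : μ.L2Fun, p = (μ.toL2 f, μ.toL2 g) ∧ (∀ t : ℝ, g t = (t : ℂ) • f t) ∧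
    Integrable (fun t => μ.density t (f t)) μ.traceMeasure ∧ μ.integral f = 0}
  zero_mem' := ⟨0, 0, by rw [map_zero]; rfl, fun t => (smul_zero _).symm,
    (integrable_zero _ _ _).congr (ae_of_all _ fun t => (map_zero (μ.density t)).symm),
    (integral_congr_ae (ae_of_all _ fun t => map_zero (μ.density t))).trans (by simp)⟩
  add_mem' := by
    rintro _ _ ⟨f, g, rfl, h, hi, h0⟩ ⟨f', g', rfl, h', hi', h0'⟩
    refine ⟨f + f', g + g', by simp, fun t => ?_, ?_, ?_⟩
    · change g t + g' t = (t : ℂ) • (f t + f' t)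
      rw [h, h', smul_add]
    · exact (hi.add hi').congr (ae_of_all _ fun t => (map_add (μ.density t) (f t) (f' t)).symm)
    · have := integral_add hi hi'
      rw [integral] at h0 h0' ⊢
      rw [h0, h0', add_zero] at this
      rw [← this]
      exact integral_congr_ae (ae_of_all _ fun t => map_add (μ.density t) (f t) (f' t))
  smul_mem' := by
    rintro c _ ⟨f, g, rfl, h, hi, h0⟩
    refine ⟨c • f, c • g, by simp, fun t => ?_, ?_, ?_⟩
    · change c • g t = (t : ℂ) • (c • f t)
      rw [h, smul_comm]
    · exact (hi.smul c).congr (ae_of_all _ fun t => (map_smul (μ.density t) c (f t)).symm)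
    · have := integral_smul c (fun t => μ.density t (f t)) (μ := μ.traceMeasure)
      rw [integral] at h0 ⊢
      rw [h0, smul_zero] at this
      rw [← this]
      exact integral_congr_ae (ae_of_all _ fun t => map_smul (μ.density t) c (f t))

/-- The operator `M_μ` of multiplication by the independent variable on `L²(μ)`, with domain
`{f ∈ L²(μ) : x f ∈ L²(μ), ∫ dμ(t) f(t) = 0}`. -/
def mulOperator : μ.L2 →ₗ.[ℂ] μ.L2 := μ.mulGraph.toLinearPMap

lemma toL2_eq_zero_iff (f : μ.L2Fun) : μ.toL2 f = 0 ↔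
    (fun t => (inner ℂ (f t) (μ.density t (f t))).re) =ᵐ[μ.traceMeasure] 0 := by
  have h1 : μ.toL2 f = 0 ↔ ‖f‖ = 0 := by
    rw [← norm_eq_zero]; exact Iff.rfl
  rw [h1, ← integral_eq_zero_iff_of_nonneg (fun t => μ.density_re_nonneg t (f t)) f.2.2,
    ← sq_eq_zero_iff, ← inner_self_eq_norm_sq (𝕜 := ℂ), inner_def,
    ← integral_re (μ.integrable_inner f f)]
  rfl

lemma mulOperator_graph : μ.mulOperator.graph = μ.mulGraph := by
  refine Submodule.toLinearPMap_graph_eq _ ?_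
  rintro _ ⟨f, g, rfl, h, -, -⟩ hf
  change μ.toL2 g = 0
  rw [toL2_eq_zero_iff]
  filter_upwards [(μ.toL2_eq_zero_iff f).1 hf] with t ht
  simp only [Pi.zero_apply] at ht ⊢
  rw [h, map_smul, inner_smul_left, inner_smul_right, Complex.conj_ofReal, Complex.re_ofReal_mul,
    Complex.re_ofReal_mul, ht, mul_zero, mul_zero]

end MatrixMeasure

/-! ## Symmetric operators -/

section Operators

variable {H : Type*} [NormedAddCommGroup H] [InnerProductSpace ℂ H]

/-- The range of `T - w I`. -/
def rangeSub (T : H →ₗ.[ℂ] H) (w : ℂ) : Submodule ℂ H :=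
  LinearMap.range (T.toFun - w • T.domain.subtype)

/-- The class `𝒮ₙ(H)`: simple, closed, symmetric, densely defined operators in `H` with deficiency
indices `(n, n)`. -/
structure IsSimpleSymmetric (n : ℕ) (T : H →ₗ.[ℂ] H) : Prop where
  dense : Dense (T.domain : Set H)
  symmetric : ∀ x y : T.domain, inner ℂ (T x) (y : H) = inner ℂ (x : H) (T y)
  simple : ⨅ w : ℂ, ⨅ _ : w.im ≠ 0, rangeSub T w = ⊥
  closed : T.IsClosed
  deficiency_upper : Module.rank ℂ (rangeSub T Complex.I)ᗮ = n
  deficiency_lower : Module.rank ℂ (rangeSub T (-Complex.I))ᗮ = n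

/-- Unitary equivalence of partially defined operators: a unitary map carries the graph of one
onto the graph of the other. -/
def UnitarilyEquivalent {H' : Type*} [NormedAddCommGroup H'] [InnerProductSpace ℂ H']
    (S : H →ₗ.[ℂ] H) (T : H' →ₗ.[ℂ] H') : Prop :=
  ∃ U : H ≃ₗᵢ[ℂ] H', ∀ x y, (x, y) ∈ S.graph ↔ (U x, U y) ∈ T.graph

variable [CompleteSpace H] {n : ℕ}

/-- The kernel `K_w(z) = Γ(z)* Γ(w)`. -/
def modelKernel (Γ : ℂ → EuclideanSpace ℂ (Fin n) →L[ℂ] H) (w z : ℂ) :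
    EuclideanSpace ℂ (Fin n) →L[ℂ] EuclideanSpace ℂ (Fin n) :=
  (ContinuousLinearMap.adjoint (Γ z)).comp (Γ w)

/-- A model for `T`: a co-analytic function `Γ : ℂ ∖ ℝ → B(ℂⁿ, H)` with `Γ(w)` invertible from `ℂⁿ`
onto `Rng(T - w I)ᗮ`, with `Γ(z)* Γ(w)` invertible for `z, w` in the same half-plane, and such that
the ranges of the `Γ(w)` span a dense subspace. (Values of `Γ` on `ℝ` are irrelevant.) -/
structure IsModel (T : H →ₗ.[ℂ] H) (Γ : ℂ → EuclideanSpace ℂ (Fin n) →L[ℂ] H) : Prop where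
  coanalytic : DifferentiableOn ℂ (fun z => Γ (conj z)) {z | z.im ≠ 0}
  injective : ∀ w : ℂ, w.im ≠ 0 → Function.Injective (Γ w)
  range_eq : ∀ w : ℂ, w.im ≠ 0 → LinearMap.range (Γ w).toLinearMap = (rangeSub T w)ᗮ
  isUnit_kernel : ∀ w z : ℂ, (0 < w.im ∧ 0 < z.im) ∨ (w.im < 0 ∧ z.im < 0) →
    IsUnit (modelKernel Γ w z)
  dense : (⨆ w : ℂ, ⨆ _ : w.im ≠ 0,
    LinearMap.range (Γ w).toLinearMap).topologicalClosure = ⊤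

/-- The Livšic characteristic function on the upper half-plane,
`V(z) = b(z) Φ(z)⁻¹ Ψ(z)` with `b(z) = (z - i) / (z + i)`, `Φ(z) = K_i(z) K_i(i)^{-1/2}` and
`Ψ(z) = K_{-i}(z) K_{-i}(-i)^{-1/2}`. -/
def livsic (Γ : ℂ → EuclideanSpace ℂ (Fin n) →L[ℂ] H) (z : ℂ) :
    EuclideanSpace ℂ (Fin n) →L[ℂ] EuclideanSpace ℂ (Fin n) :=
  ((z - Complex.I) / (z + Complex.I)) •
    (Ring.inverse (modelKernel Γ Complex.I z *
        Ring.inverse (CFC.sqrt (modelKernel Γ Complex.I Complex.I))) *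
      (modelKernel Γ (-Complex.I) z *
        Ring.inverse (CFC.sqrt (modelKernel Γ (-Complex.I) (-Complex.I)))))

end Operators

/-! ## Herglotz spaces -/

section Herglotz

variable {n : ℕ} (V : ℂ → EuclideanSpace ℂ (Fin n) →L[ℂ] EuclideanSpace ℂ (Fin n))

/-- The function `(I + i V(z)) (I - i V(z))⁻¹`. -/
def herglotzUpper (z : ℂ) : EuclideanSpace ℂ (Fin n) →L[ℂ] EuclideanSpace ℂ (Fin n) :=
  (1 + Complex.I • V z) * Ring.inverse (1 - Complex.I • V z)

/-- The Herglotz function `Ω` of `V`: `Ω(z) = (I + i V(z)) (I - i V(z))⁻¹` on the upper half-plane,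
and `Ω(z) = -Ω(z̄)*` on the lower half-plane. (This is what the first formula gives on the lower
half-plane for the continuation of `V` by `V(z) V(z̄)* = I`, with the singularities at the poles of
`V` removed.) -/
def herglotzFunction (z : ℂ) : EuclideanSpace ℂ (Fin n) →L[ℂ] EuclideanSpace ℂ (Fin n) :=
  if 0 < z.im then herglotzUpper V z
  else -ContinuousLinearMap.adjoint (herglotzUpper V (conj z))

/-- The kernel `K^V_w(z) = (Ω(z) + Ω(w)*) / (π i (w̄ - z))` on `ℂ ∖ ℝ`; at the removable
singularity `z = w̄` its value is the limit `(i / π) Ω'(z)`. -/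
def herglotzKernel (w z : ℂ) : EuclideanSpace ℂ (Fin n) →L[ℂ] EuclideanSpace ℂ (Fin n) :=
  if z = conj w then (Complex.I / Real.pi) • deriv (herglotzFunction V) z
  else (Real.pi * Complex.I * (conj w - z))⁻¹ •
    (herglotzFunction V z + ContinuousLinearMap.adjoint (herglotzFunction V w))

/-- `K^V` as an operator-valued matrix indexed by `ℂ ∖ ℝ`, with `(z, w)` entry `K^V_w(z)`. -/
def herglotzMatrix : Matrix {z : ℂ // z.im ≠ 0} {z : ℂ // z.im ≠ 0}
    (EuclideanSpace ℂ (Fin n) →L[ℂ] EuclideanSpace ℂ (Fin n)) :=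
  Matrix.of fun z w => herglotzKernel V w z

/-- The Herglotz space `ℋ(V)`: the reproducing kernel Hilbert space of `ℂⁿ`-valued functions on
`ℂ ∖ ℝ` with kernel `K^V`. -/
abbrev HerglotzSpace [Fact (herglotzMatrix V).PosSemidef] : Type :=
  RKHS.OfKernel (herglotzMatrix V)

end Herglotz

end

open MeasureTheory
open scoped ENNReal ComplexOrder ComplexConjugate

noncomputable section

/-! ## Unitary maps between Hilbert spaces -/

section Hilbert

variable {M E F : Type*} [AddCommGroup M] [Module ℂ M]
  [NormedAddCommGroup E] [InnerProductSpace ℂ E] [NormedAddCommGroup F] [InnerProductSpace ℂ F]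

/-! Formally, let `A` be a self-adjoint extension of `T` with Cayley transform `W = (A - i)(A +
i)⁻¹`, and let `U` be an isometry of `ℂⁿ` onto `Rng(T - i)ᗮ`. The field `γ(w) = (A + i)(A - w̄)⁻¹ U`
parametrizes the spaces `Rng(T - w)ᗮ`. The Weyl function `Ω`, a compression by `U` of a function of
`A`, satisfies `Ω(z) + Ω(w)* = i (w̄ - z) γ(z)* γ(w)` (`weylFunction_add_adjoint`).

Given a model `Γ`, take for `U` and `U'` its normalized values at `i` and `-i`, and let `W` extend
the Cayley transform of `T` by `W U' = -i U`. Then `Γ(z)` is `γ(z)` times an invertible matrix whose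
adjoint cancels in `Φ⁻¹ Ψ`, and the phase `-i` makes `Ω` exactly the Herglotz function of `V`
(`herglotzFunction_livsic`). Hence `K^V_w(z) = π⁻¹ γ(z)* γ(w)` (`herglotzKernel_eq`).

If `E` is the spectral measure of `A`, then `γ(z)* γ(w)` is the integral of `(1 + t²) / ((t - w̄)(t
- z))` against `U* dE U` (`inner_defectField`), which forces `μ = π (1 + t²) U* E U`
(`cayleyMeasure`). Only the bounded operator `W` is actually used: the measure is carried over from
the spectrum of `W`, where the point `1` is null because density of the domain of `T` leaves `W`
without fixed vectors (`spectralMeasure_singleton_one`).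

There are now three total families with proportional Gram matrices: the vectors `γ(w) a` in `H` (by
simplicity of `T`), the Cauchy kernels `(t - w̄)⁻¹ a` in `L²(μ)` (by injectivity of the Cauchy
transform), and the kernel functions of `ℋ(V)`. Since all three spaces are complete,
`exists_linearIsometryEquiv_of_inner_eq` supplies the unitary maps. The graphs of `T` and of `M_μ`
are cut out by the same orthogonality relations to these families (`graph_mem_iff_of_total`), so the
unitary map from `H` to `L²(μ)` carries one onto the other. -/

lemma exists_linearIsometryEquiv_of_norm_eq [CompleteSpace E] [CompleteSpace F] (e : M →ₗ[ℂ] E)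
    (f : M →ₗ[ℂ] F) (he : DenseRange e) (hf : DenseRange f) (h : ∀ x, ‖f x‖ = ‖e x‖) :
    ∃ U : E ≃ₗᵢ[ℂ] F, ∀ x, U (e x) = f x :=
  ⟨(LinearEquiv.refl ℂ M).extendOfIsometry e f he hf h, fun x =>
    LinearEquiv.extendOfIsometry_eq (LinearEquiv.refl ℂ M) e f he hf h x⟩

lemma denseRange_of_orthogonal_eq_bot [CompleteSpace E] (e : M →ₗ[ℂ] E)
    (h : ∀ y, (∀ x, inner ℂ (e x) y = 0) → y = 0) : DenseRange e := by
  have : Dense ((LinearMap.range e : Submodule ℂ E) : Set E) := by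
    rw [Submodule.dense_iff_topologicalClosure_eq_top,
      Submodule.topologicalClosure_eq_top_iff, Submodule.eq_bot_iff]
    intro y hy
    exact h y fun x => hy _ ⟨x, rfl⟩
  rwa [LinearMap.coe_range] at this

/-- Polarization for two sesquilinear forms: the diagonal values at `a + b` and `a + i b` determine
the value at `(a, b)`. It reduces Gram matrix identities to scalar spectral measures. -/
lemma inner_eq_of_inner_self_eq (p q : M →ₗ[ℂ] E) (r s : M →ₗ[ℂ] F)
    (h : ∀ a, inner ℂ (p a) (q a) = inner ℂ (r a) (s a)) (a b : M) :
    inner ℂ (p a) (q b) = inner ℂ (r a) (s b) := by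
  have h1 := h (a + b)
  have h2 := h (a + Complex.I • b)
  simp only [map_add, map_smul, inner_add_left, inner_add_right, inner_smul_left,
    inner_smul_right, h a, h b, Complex.conj_I] at h1 h2
  linear_combination (1 / 2) * h1 - (Complex.I / 2) * h2 +
    (1 / 2) * (inner ℂ (p a) (q b) - inner ℂ (p b) (q a) - inner ℂ (r a) (s b)
      + inner ℂ (r b) (s a)) * Complex.I_sq

/-- Two total families with the same Gram matrix are related by a unitary map. -/
lemma exists_linearIsometryEquiv_of_inner_eq [CompleteSpace E] [CompleteSpace F] {ι : Type*}
    (e : ι → E) (f : ι → F) (he : ∀ y, (∀ i, inner ℂ (e i) y = 0) → y = 0)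
    (hf : ∀ y, (∀ i, inner ℂ (f i) y = 0) → y = 0)
    (h : ∀ i j, inner ℂ (f i) (f j) = inner ℂ (e i) (e j)) :
    ∃ U : E ≃ₗᵢ[ℂ] F, ∀ i, U (e i) = f i := by
  -- Both families are extended linearly to finitely supported coefficient functions, so that equal
  -- Gram matrices become equal norms.
  obtain ⟨U, hU⟩ := exists_linearIsometryEquiv_of_norm_eq
    (Finsupp.linearCombination ℂ e) (Finsupp.linearCombination ℂ f)
    (denseRange_of_orthogonal_eq_bot _ fun y hy => he y fun i => by
      simpa using hy (Finsupp.single i 1))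
    (denseRange_of_orthogonal_eq_bot _ fun y hy => hf y fun i => by
      simpa using hy (Finsupp.single i 1))
    (fun x => by
      rw [← sq_eq_sq₀ (norm_nonneg _) (norm_nonneg _), ← inner_self_eq_norm_sq (𝕜 := ℂ),
        ← inner_self_eq_norm_sq (𝕜 := ℂ)]
      simp only [Finsupp.linearCombination_apply, Finsupp.sum, sum_inner, inner_sum,
        inner_smul_left, inner_smul_right, h])
  exact ⟨U, fun i => by simpa using hU (Finsupp.single i 1)⟩

end Hilbert

/-! ## The defect field of a unitary operator -/

section DefectField

variable {H : Type*} [NormedAddCommGroup H] [InnerProductSpace ℂ H] [CompleteSpace H]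
  {N : Type*} [NormedAddCommGroup N] [InnerProductSpace ℂ N] [CompleteSpace N]

/-- `(i - z) + (i + z) W`, which is `2i (A - z) (A + i)⁻¹` if `W` is the Cayley transform of `A`. -/
def cayleyPencil (W : H →L[ℂ] H) (z : ℂ) : H →L[ℂ] H :=
  (Complex.I - z) • (1 : H →L[ℂ] H) + (Complex.I + z) • W

/-- The inverse of `cayleyPencil W z`. -/
def cayleyResolvent (W : H →L[ℂ] H) (z : ℂ) : H →L[ℂ] H :=
  Ring.inverse (cayleyPencil W z)

/-- The field `w ↦ (A + i) (A - w̄)⁻¹ U`, if `W` is the Cayley transform of `A`. -/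
def defectField (W : H →L[ℂ] H) (U : N →L[ℂ] H) (w : ℂ) : N →L[ℂ] H :=
  (2 * Complex.I) • (cayleyResolvent W (conj w)).comp U

/-- The Herglotz function `1 + 2 (z - i) U* (cayleyResolvent W z) U`. -/
def weylFunction (W : H →L[ℂ] H) (U : N →L[ℂ] H) (z : ℂ) : N →L[ℂ] N :=
  1 + (2 * (z - Complex.I)) • (ContinuousLinearMap.adjoint U).comp ((cayleyResolvent W z).comp U)

/-- The real line is the perpendicular bisector of `i` and `-i`. So for nonreal `z` the point `(z -
i)/(z + i)` avoids the unit circle, which contains the spectrum of `W`. -/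
lemma norm_sub_I_ne_norm_add_I {z : ℂ} (hz : z.im ≠ 0) : ‖z - Complex.I‖ ≠ ‖z + Complex.I‖ := by
  intro h
  have h2 : Complex.normSq (z - Complex.I) = Complex.normSq (z + Complex.I) := by
    rw [Complex.normSq_eq_norm_sq, Complex.normSq_eq_norm_sq, h]
  simp only [Complex.normSq_apply, Complex.sub_re, Complex.sub_im, Complex.add_re, Complex.add_im,
    Complex.I_re, Complex.I_im] at h2
  apply hz
  linarith

variable {W : H →L[ℂ] H} (hW : W ∈ unitary (H →L[ℂ] H)) {z w : ℂ}

include hW in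
-- The pencil is `-(i + z)` times `(z - i)/(z + i) - W`, and this point is not in the spectrum of a
-- unitary operator. The exceptional `z = -i` gives the scalar `2i`.
lemma isUnit_cayleyPencil (hz : z.im ≠ 0) : IsUnit (cayleyPencil W z) := by
  by_cases h0 : Complex.I + z = 0
  · have h1 : Complex.I - z ≠ 0 := by
      intro h
      have h2 : (2 : ℂ) * Complex.I = 0 := by linear_combination h + h0
      simp at h2
    rw [cayleyPencil, h0, zero_smul, add_zero]
    exact (isUnit_one).smul (Units.mk0 _ h1)
  · have hk : (z - Complex.I) / (Complex.I + z) ∉ spectrum ℂ W := by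
      intro h
      have := spectrum.subset_circle_of_unitary hW h
      rw [mem_sphere_zero_iff_norm, norm_div, div_eq_one_iff_eq (by simpa using h0),
        add_comm Complex.I] at this
      exact norm_sub_I_ne_norm_add_I hz this
    rw [spectrum.notMem_iff] at hk
    have he : cayleyPencil W z = Units.mk0 _ (neg_ne_zero.2 h0) •
        (algebraMap ℂ (H →L[ℂ] H) ((z - Complex.I) / (Complex.I + z)) - W) := by
      rw [Units.smul_mk0, smul_sub, Algebra.algebraMap_eq_smul_one, smul_smul, cayleyPencil,
        neg_mul, mul_div_cancel₀ _ h0, neg_smul _ W, sub_neg_eq_add, neg_sub]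
    rw [he]
    exact hk.smul _

include hW in
lemma cayleyPencil_mul_resolvent (hz : z.im ≠ 0) : cayleyPencil W z * cayleyResolvent W z = 1 :=
  Ring.mul_inverse_cancel _ (isUnit_cayleyPencil hW hz)

include hW in
lemma cayleyResolvent_mul_pencil (hz : z.im ≠ 0) : cayleyResolvent W z * cayleyPencil W z = 1 :=
  Ring.inverse_mul_cancel _ (isUnit_cayleyPencil hW hz)

include hW in
-- The counterpart of `(A - z)* = A - z̄`: pulling out `W*` and using `W* W = 1` exchanges the two
-- coefficients of the pencil.
lemma star_cayleyPencil (z : ℂ) :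
    star (cayleyPencil W z) = -(star W * cayleyPencil W (conj z)) := by
  have h := Unitary.star_mul_self_of_mem hW
  simp only [cayleyPencil, star_add, star_smul, star_one, mul_add, mul_smul_comm, mul_one, h,
    RCLike.star_def, map_sub, Complex.conj_I]
  module

include hW in
lemma star_cayleyResolvent (hz : z.im ≠ 0) :
    star (cayleyResolvent W z) = -(cayleyResolvent W (conj z) * W) := by
  have hz' : (conj z).im ≠ 0 := by simpa using hz
  have h1 : star (cayleyResolvent W z) * star (cayleyPencil W z) = 1 := by
    rw [← star_mul, cayleyPencil_mul_resolvent hW hz, star_one]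
  have h2 : star (cayleyPencil W z) * -(cayleyResolvent W (conj z) * W) = 1 := by
    rw [star_cayleyPencil hW, neg_mul_neg, mul_assoc, ← mul_assoc (cayleyPencil W _),
      cayleyPencil_mul_resolvent hW hz', one_mul, Unitary.star_mul_self_of_mem hW]
  exact left_inv_eq_right_inv h1 h2

include hW in
-- The resolvent identity: in `(z - i) P(w) - (w - i) P(z)`, where `P` is the pencil, the scalar
-- part cancels and a multiple of `W` is left; multiply by the inverses of `P(z)` and `P(w)` on the
-- two sides.
lemma cayleyResolvent_identity (hz : z.im ≠ 0) (hw : w.im ≠ 0) :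
    (z - Complex.I) • cayleyResolvent W z - (w - Complex.I) • cayleyResolvent W w
      = (2 * Complex.I * (z - w)) • (cayleyResolvent W z * W * cayleyResolvent W w) := by
  have h1 : cayleyResolvent W z = cayleyResolvent W z * cayleyPencil W w * cayleyResolvent W w := by
    rw [mul_assoc, cayleyPencil_mul_resolvent hW hw, mul_one]
  have h2 : cayleyResolvent W w = cayleyResolvent W z * cayleyPencil W z * cayleyResolvent W w := by
    rw [cayleyResolvent_mul_pencil hW hz, one_mul]
  have h3 : (z - Complex.I) • cayleyPencil W w - (w - Complex.I) • cayleyPencil W z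
      = (2 * Complex.I * (z - w)) • W := by
    simp only [cayleyPencil]
    module
  calc _ = cayleyResolvent W z * ((z - Complex.I) • cayleyPencil W w
        - (w - Complex.I) • cayleyPencil W z) * cayleyResolvent W w := by
        rw [mul_sub, sub_mul, mul_smul_comm, mul_smul_comm, smul_mul_assoc, smul_mul_assoc,
          ← h1, ← h2]
    _ = _ := by rw [h3, mul_smul_comm, smul_mul_assoc]

include hW in
lemma cayleyResolvent_mul_self (hz : z.im ≠ 0) :
    (Complex.I + z) • (cayleyResolvent W z * W) = 1 - (Complex.I - z) • cayleyResolvent W z := by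
  rw [← cayleyResolvent_mul_pencil hW hz, cayleyPencil, mul_add, mul_smul_comm, mul_smul_comm,
    mul_one]
  abel

lemma differentiableAt_cayleyResolvent (hz : IsUnit (cayleyPencil W z)) :
    DifferentiableAt ℂ (cayleyResolvent W) z := by
  have h1 : DifferentiableAt ℂ (cayleyPencil W) z := by unfold cayleyPencil; fun_prop
  exact DifferentiableAt.comp z (differentiableAt_inverse hz) h1

variable (U : N →L[ℂ] H)

include hW in
lemma adjoint_defectField (hz : z.im ≠ 0) : ContinuousLinearMap.adjoint (defectField W U z)
    = (2 * Complex.I) • (ContinuousLinearMap.adjoint U).comp (cayleyResolvent W z * W) := by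
  have hz' : (conj z).im ≠ 0 := by simpa using hz
  have h := star_cayleyResolvent hW hz'
  rw [Complex.conj_conj, ContinuousLinearMap.star_eq_adjoint] at h
  rw [defectField, map_smulₛₗ, ContinuousLinearMap.adjoint_comp, h]
  simp [ContinuousLinearMap.comp_neg, Complex.conj_ofNat]

include hW in
lemma modelKernel_defectField {n : ℕ} (U : EuclideanSpace ℂ (Fin n) →L[ℂ] H)
    (hz : z.im ≠ 0) : modelKernel (defectField W U) w z
    = (-4 : ℂ) • (ContinuousLinearMap.adjoint U).comp
      ((cayleyResolvent W z * W * cayleyResolvent W (conj w)).comp U) := by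
  rw [modelKernel, adjoint_defectField hW U hz, defectField]
  simp only [ContinuousLinearMap.smul_comp, ContinuousLinearMap.comp_smul, smul_smul]
  congr 1
  linear_combination 4 * Complex.I_sq

variable {U} (hU : (ContinuousLinearMap.adjoint U).comp U = 1)

include hW hU in
-- Replacing the resolvent times `W` by the resolvent alone produces the term `2 U* U = 2`, which
-- turns the constant term `1` into `-1`; this is where `U` has to be isometric. The symmetry is the
-- one by which `herglotzFunction` is defined on the lower half-plane.
lemma adjoint_weylFunction (hz : z.im ≠ 0) : ContinuousLinearMap.adjoint (weylFunction W U z)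
    = -weylFunction W U (conj z) := by
  have hz' : (conj z).im ≠ 0 := by simpa using hz
  have h := star_cayleyResolvent hW hz
  rw [ContinuousLinearMap.star_eq_adjoint] at h
  have h2 : (2 * (conj z + Complex.I)) • (ContinuousLinearMap.adjoint U).comp
        ((cayleyResolvent W (conj z) * W).comp U)
      = (2 : ℂ) • 1 - (2 * (Complex.I - conj z)) • (ContinuousLinearMap.adjoint U).comp
        ((cayleyResolvent W (conj z)).comp U) := by
    have h3 := congrArg (fun B : H →L[ℂ] H => (2 : ℂ) •
      (ContinuousLinearMap.adjoint U).comp (B.comp U)) (cayleyResolvent_mul_self hW hz')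
    simp only [ContinuousLinearMap.smul_comp, ContinuousLinearMap.comp_smul,
      ContinuousLinearMap.sub_comp, ContinuousLinearMap.comp_sub, smul_smul] at h3
    rw [add_comm (conj z), h3, smul_sub, smul_smul, ← hU]
    rfl
  rw [weylFunction, map_add, map_smulₛₗ, ContinuousLinearMap.adjoint_comp,
    ContinuousLinearMap.adjoint_comp, ContinuousLinearMap.adjoint_adjoint, h, weylFunction,
    ← ContinuousLinearMap.star_eq_adjoint, star_one]
  simp only [ContinuousLinearMap.comp_neg, ContinuousLinearMap.neg_comp, map_mul, map_sub,
    Complex.conj_I, map_ofNat, sub_neg_eq_add, ContinuousLinearMap.comp_assoc] at h2 ⊢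
  rw [smul_neg, h2]
  module

end DefectField

/-! ### The kernel identity for the Weyl function -/

section KernelIdentity

variable {H : Type*} [NormedAddCommGroup H] [InnerProductSpace ℂ H] [CompleteSpace H]
  {n : ℕ} {W : H →L[ℂ] H} (hW : W ∈ unitary (H →L[ℂ] H)) {z w : ℂ}
  {U : EuclideanSpace ℂ (Fin n) →L[ℂ] H} (hU : (ContinuousLinearMap.adjoint U).comp U = 1)

include hW in
-- This is `cayleyResolvent_identity` at `z` and `w̄`, compressed by `U`; the constant terms cancel,
-- so `U` need not be isometric.
lemma weylFunction_sub (hz : z.im ≠ 0) (hw : w.im ≠ 0) :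
    weylFunction W U z - weylFunction W U (conj w)
      = (Complex.I * (conj w - z)) • modelKernel (defectField W U) w z := by
  have hw' : (conj w).im ≠ 0 := by simpa using hw
  have h := congrArg (fun B : H →L[ℂ] H => (2 : ℂ) •
      (ContinuousLinearMap.adjoint U).comp (B.comp U)) (cayleyResolvent_identity hW hz hw')
  simp only [ContinuousLinearMap.smul_comp, ContinuousLinearMap.comp_smul,
      ContinuousLinearMap.sub_comp, ContinuousLinearMap.comp_sub, smul_smul, smul_sub] at h
  rw [modelKernel_defectField hW U hz, weylFunction, weylFunction, add_sub_add_left_eq_sub, h,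
    smul_smul]
  congr 1
  ring

include hW hU in
-- The central identity: the numerator of the Herglotz kernel is a scalar times a Gram kernel.
-- Positivity, invertibility and the comparison with the Livšic function are all read off from it.
lemma weylFunction_add_adjoint (hz : z.im ≠ 0) (hw : w.im ≠ 0) :
    weylFunction W U z + ContinuousLinearMap.adjoint (weylFunction W U w)
      = (Complex.I * (conj w - z)) • modelKernel (defectField W U) w z := by
  rw [adjoint_weylFunction hW hU hw, ← sub_eq_add_neg, weylFunction_sub hW hz hw]

end KernelIdentity

/-! ### The Livšic function and the Herglotz kernel in terms of the defect field -/

section LivsicKernel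

variable {H : Type*} [NormedAddCommGroup H] [InnerProductSpace ℂ H] [CompleteSpace H]
  {n : ℕ} {W : H →L[ℂ] H} (hW : W ∈ unitary (H →L[ℂ] H)) {z w : ℂ}
  {U : EuclideanSpace ℂ (Fin n) →L[ℂ] H} (hU : (ContinuousLinearMap.adjoint U).comp U = 1)

/-- A nowhere vanishing quadratic form forces injectivity, and in finite dimension injectivity is
enough. -/
lemma isUnit_of_re_inner_ne_zero {B : EuclideanSpace ℂ (Fin n) →L[ℂ] EuclideanSpace ℂ (Fin n)}
    (h : ∀ a, a ≠ 0 → (inner ℂ a (B a)).re ≠ 0) : IsUnit B := by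
  have hi : Function.Injective B.toLinearMap := by
    rw [injective_iff_map_eq_zero]
    intro a ha
    by_contra h0
    have ha' : B a = 0 := ha
    exact h a h0 (by simp [ha'])
  rw [ContinuousLinearMap.isUnit_iff_bijective]
  exact ⟨hi, LinearMap.injective_iff_surjective.1 hi⟩

lemma re_inner_self_eq {E : Type*} [NormedAddCommGroup E] [InnerProductSpace ℂ E] (a : E) :
    (inner ℂ a a).re = ‖a‖ ^ 2 :=
  inner_self_eq_norm_sq (𝕜 := ℂ) a

lemma inner_modelKernel (Γ : ℂ → EuclideanSpace ℂ (Fin n) →L[ℂ] H) (w z : ℂ)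
    (a b : EuclideanSpace ℂ (Fin n)) :
    inner ℂ b (modelKernel Γ w z a) = inner ℂ (Γ z b) (Γ w a) := by
  rw [modelKernel, ContinuousLinearMap.comp_apply, ContinuousLinearMap.adjoint_inner_right]

include hW hU in
-- The diagonal `w = z` of `weylFunction_add_adjoint`, where `i (z̄ - z) = 2 Im z`.
lemma re_inner_weylFunction (hz : z.im ≠ 0) (a : EuclideanSpace ℂ (Fin n)) :
    (inner ℂ a (weylFunction W U z a)).re = z.im * ‖defectField W U z a‖ ^ 2 := by
  have h := congrArg (fun B => inner ℂ a (B a)) (weylFunction_add_adjoint hW hU hz hz)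
  simp only [add_apply, inner_add_right, smul_apply,
    inner_smul_right, inner_modelKernel, ContinuousLinearMap.adjoint_inner_right] at h
  rw [← inner_conj_symm (weylFunction W U z a) a] at h
  have h2 := congrArg Complex.re h
  rw [show Complex.I * (conj z - z) = ((2 * z.im : ℝ) : ℂ) by
    apply Complex.ext <;> simp; ring] at h2
  simp only [Complex.add_re, Complex.conj_re] at h2
  rw [Complex.re_ofReal_mul, re_inner_self_eq] at h2
  linarith

include hW hU in
lemma defectField_injective (hz : z.im ≠ 0) : Function.Injective (defectField W U z) := by
  have hz' : (conj z).im ≠ 0 := by simpa using hz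
  rw [injective_iff_map_eq_zero]
  intro a ha
  have h1 : cayleyResolvent W (conj z) (U a) = 0 := by
    simpa [defectField] using ha
  have h2 := congrArg (fun B : H →L[ℂ] H => B (U a)) (cayleyPencil_mul_resolvent hW hz')
  simp only [mul_apply_eq_comp, h1, map_zero, one_apply_eq_self] at h2
  have h3 := congrArg (fun B : EuclideanSpace ℂ (Fin n) →L[ℂ] _ => B a) hU
  simpa [← h2] using h3.symm

include hW hU in
-- The kernel itself has no definite quadratic form, but its multiple `Ω(z) + Ω(w)*` does: the real
-- part is `Im z ‖γ(z) a‖² + Im w ‖γ(w) a‖²`, and in a common half-plane both terms have the same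
-- sign.
lemma isUnit_modelKernel_defectField (h : (0 < w.im ∧ 0 < z.im) ∨ (w.im < 0 ∧ z.im < 0)) :
    IsUnit (modelKernel (defectField W U) w z) := by
  have hz : z.im ≠ 0 := by rcases h with h | h; exacts [h.2.ne', h.2.ne]
  have hw : w.im ≠ 0 := by rcases h with h | h; exacts [h.1.ne', h.1.ne]
  have hc : Complex.I * (conj w - z) ≠ 0 := by
    intro h0
    have := congrArg Complex.re h0
    simp at this
    rcases h with h | h <;> linarith [h.1, h.2]
  have h1 : IsUnit ((Complex.I * (conj w - z)) • modelKernel (defectField W U) w z) := by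
    rw [← weylFunction_add_adjoint hW hU hz hw]
    refine isUnit_of_re_inner_ne_zero fun a ha => ?_
    simp only [add_apply, inner_add_right,
      ContinuousLinearMap.adjoint_inner_right]
    rw [← inner_conj_symm (weylFunction W U w a) a]
    simp only [Complex.add_re, Complex.conj_re]
    rw [re_inner_weylFunction hW hU hz, re_inner_weylFunction hW hU hw]
    have p1 : 0 < ‖defectField W U z a‖ ^ 2 := by
      have := (map_ne_zero_iff _ (defectField_injective hW hU hz)).2 ha
      positivity
    have p2 : 0 < ‖defectField W U w a‖ ^ 2 := by
      have := (map_ne_zero_iff _ (defectField_injective hW hU hw)).2 ha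
      positivity
    rcases h with h | h
    · have := mul_pos h.2 p1; have := mul_pos h.1 p2; linarith
    · have := mul_neg_of_neg_of_pos h.2 p1; have := mul_neg_of_neg_of_pos h.1 p2; linarith
  have h2 := h1.smul (Units.mk0 _ hc)⁻¹
  rwa [← Units.smul_mk0 hc, inv_smul_smul] at h2

omit [CompleteSpace H] in
lemma defectField_I : defectField W U Complex.I = U := by
  have h : cayleyPencil W (conj Complex.I) = (2 * Complex.I) • 1 := by
    simp [cayleyPencil, two_mul]
  have h2 : cayleyResolvent W (conj Complex.I) = (2 * Complex.I)⁻¹ • 1 := by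
    have hu : IsUnit ((2 * Complex.I) • (1 : H →L[ℂ] H)) :=
      isUnit_one.smul (Units.mk0 (2 * Complex.I) (by simp))
    rw [cayleyResolvent, h]
    refine left_inv_eq_right_inv (Ring.inverse_mul_cancel _ hu) ?_
    rw [smul_mul_smul_comm, mul_inv_cancel₀ (by simp), one_smul, one_mul]
  rw [defectField, h2, ContinuousLinearMap.smul_comp, smul_smul, mul_inv_cancel₀ (by simp),
    one_smul]
  rfl

lemma weylFunction_I : weylFunction W U Complex.I = 1 := by simp [weylFunction]

include hW hU in
lemma weylFunction_add_one (hz : z.im ≠ 0) : weylFunction W U z + 1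
    = (-Complex.I * (z + Complex.I)) • (ContinuousLinearMap.adjoint (defectField W U z)).comp U := by
  have h := weylFunction_add_adjoint (w := Complex.I) hW hU hz (by simp)
  rw [weylFunction_I, ← ContinuousLinearMap.star_eq_adjoint, star_one, modelKernel,
    defectField_I] at h
  rw [h, Complex.conj_I]
  congr 1
  ring

include hW in
-- Together with `weylFunction_add_one` this writes `Ω + 1` and `Ω - 1` as scalars times `γ(z)* U`
-- and `γ(z)* U'`. Thanks to the phase in `W U' = -i U`, the scalars combine in `(Ω + 1)⁻¹ (Ω - 1)`
-- to `i (z - i)/(z + i)`, so this quotient is `i V(z)`.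
lemma weylFunction_sub_one {U' : EuclideanSpace ℂ (Fin n) →L[ℂ] H}
    (hU' : ∀ a, W (U' a) = -Complex.I • U a) (hz : z.im ≠ 0) : weylFunction W U z - 1
    = (z - Complex.I) • (ContinuousLinearMap.adjoint (defectField W U z)).comp U' := by
  rw [adjoint_defectField hW U hz, weylFunction, add_sub_cancel_left]
  ext1 a
  simp only [smul_apply, ContinuousLinearMap.comp_apply,
    mul_apply_eq_comp, hU', map_smul, smul_smul]
  congr 1
  linear_combination 2 * (z - Complex.I) * Complex.I_sq

include hW hU in
lemma isUnit_weylFunction_add_one (hz : 0 < z.im) : IsUnit (weylFunction W U z + 1) := by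
  refine isUnit_of_re_inner_ne_zero fun a ha => ?_
  rw [add_apply, inner_add_right, Complex.add_re,
    re_inner_weylFunction hW hU hz.ne', one_apply_eq_self, re_inner_self_eq]
  have : 0 < ‖a‖ ^ 2 := by positivity
  have h2 : 0 ≤ z.im * ‖defectField W U z a‖ ^ 2 := by positivity
  linarith

/-- Inversion of a Cayley transform: the two factors are `2 (Ω + 1)⁻¹ Ω` and the inverse of `2 (Ω +
1)⁻¹`, and `Ω` commutes with `Ω + 1`. -/
lemma cayley_mul_inverse {A : Type*} [Ring A] [Algebra ℂ A] {Ω V : A} (hΩ : IsUnit (Ω + 1))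
    (hV : Complex.I • V = Ring.inverse (Ω + 1) * (Ω - 1)) :
    (1 + Complex.I • V) * Ring.inverse (1 - Complex.I • V) = Ω := by
  have h0 : Ring.inverse (Ω + 1) * (Ω + 1) = 1 := Ring.inverse_mul_cancel _ hΩ
  have h1 : 1 + Complex.I • V = (2 : ℂ) • (Ring.inverse (Ω + 1) * Ω) := by
    calc 1 + Complex.I • V = Ring.inverse (Ω + 1) * (Ω + 1) + Ring.inverse (Ω + 1) * (Ω - 1) := by
          rw [hV, h0]
      _ = Ring.inverse (Ω + 1) * ((2 : ℂ) • Ω) := by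
          rw [← mul_add, two_smul]
          congr 1
          abel
      _ = _ := by rw [mul_smul_comm]
  have h2 : 1 - Complex.I • V = (2 : ℂ) • Ring.inverse (Ω + 1) := by
    calc 1 - Complex.I • V = Ring.inverse (Ω + 1) * (Ω + 1) - Ring.inverse (Ω + 1) * (Ω - 1) := by
          rw [hV, h0]
      _ = Ring.inverse (Ω + 1) * ((2 : ℂ) • 1) := by
          rw [← mul_sub, two_smul]
          congr 1
          abel
      _ = _ := by rw [mul_smul_comm, mul_one]
  have h3 : Ring.inverse ((2 : ℂ) • Ring.inverse (Ω + 1)) = (2 : ℂ)⁻¹ • (Ω + 1) := by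
    have hu : IsUnit ((2 : ℂ) • Ring.inverse (Ω + 1)) :=
      (isUnit_ringInverse.2 hΩ).smul (Units.mk0 (2 : ℂ) two_ne_zero)
    refine left_inv_eq_right_inv (Ring.inverse_mul_cancel _ hu) ?_
    rw [smul_mul_smul_comm, h0, mul_inv_cancel₀ two_ne_zero, one_smul]
  rw [h1, h2, h3, smul_mul_smul_comm, mul_inv_cancel₀ two_ne_zero, one_smul, mul_assoc,
    show Ω * (Ω + 1) = (Ω + 1) * Ω by noncomm_ring, ← mul_assoc, h0, one_mul]

/-- The normalization `Γ(w) K_w(w)^{-1/2}` of a model at a point. -/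
def normalizedModel (Γ : ℂ → EuclideanSpace ℂ (Fin n) →L[ℂ] H) (w : ℂ) :
    EuclideanSpace ℂ (Fin n) →L[ℂ] H :=
  (Γ w).comp (Ring.inverse (CFC.sqrt (modelKernel Γ w w)))

lemma livsic_eq (Γ : ℂ → EuclideanSpace ℂ (Fin n) →L[ℂ] H) (z : ℂ) :
    livsic Γ z = ((z - Complex.I) / (z + Complex.I)) •
      (Ring.inverse ((ContinuousLinearMap.adjoint (Γ z)).comp (normalizedModel Γ Complex.I)) *
        (ContinuousLinearMap.adjoint (Γ z)).comp (normalizedModel Γ (-Complex.I))) := rfl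

lemma modelKernel_nonneg (Γ : ℂ → EuclideanSpace ℂ (Fin n) →L[ℂ] H) (w : ℂ) :
    0 ≤ modelKernel Γ w w := by
  rw [ContinuousLinearMap.nonneg_iff_isPositive]
  exact ContinuousLinearMap.isPositive_adjoint_comp_self _

lemma isUnit_sqrt_modelKernel {Γ : ℂ → EuclideanSpace ℂ (Fin n) →L[ℂ] H} {w : ℂ}
    (h : IsUnit (modelKernel Γ w w)) : IsUnit (CFC.sqrt (modelKernel Γ w w)) := by
  have h1 := CFC.sqrt_mul_sqrt_self _ (modelKernel_nonneg Γ w)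
  have hc : Commute (CFC.sqrt (modelKernel Γ w w)) (CFC.sqrt (modelKernel Γ w w)) := rfl
  rw [← h1] at h
  exact (hc.isUnit_mul_iff.1 h).1

lemma adjoint_normalizedModel_comp {Γ : ℂ → EuclideanSpace ℂ (Fin n) →L[ℂ] H} {w : ℂ}
    (h : IsUnit (modelKernel Γ w w)) :
    (ContinuousLinearMap.adjoint (normalizedModel Γ w)).comp (normalizedModel Γ w) = 1 := by
  have hs := isUnit_sqrt_modelKernel h
  have h1 := CFC.sqrt_mul_sqrt_self _ (modelKernel_nonneg Γ w)
  have h2 : star (CFC.sqrt (modelKernel Γ w w)) = CFC.sqrt (modelKernel Γ w w) :=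
    (CFC.sqrt_nonneg (modelKernel Γ w w)).isSelfAdjoint
  calc _ = star (Ring.inverse (CFC.sqrt (modelKernel Γ w w))) * modelKernel Γ w w *
        Ring.inverse (CFC.sqrt (modelKernel Γ w w)) := by
        rw [normalizedModel, ContinuousLinearMap.adjoint_comp]; rfl
    _ = 1 := by
        nth_rw 2 [← h1]
        rw [← Ring.inverse_star, h2, ← mul_assoc, Ring.inverse_mul_cancel _ hs, one_mul,
          Ring.mul_inverse_cancel _ hs]

lemma range_normalizedModel {Γ : ℂ → EuclideanSpace ℂ (Fin n) →L[ℂ] H} {w : ℂ}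
    (h : IsUnit (modelKernel Γ w w)) :
    LinearMap.range (normalizedModel Γ w).toLinearMap = LinearMap.range (Γ w).toLinearMap := by
  have hs := isUnit_ringInverse.2 (isUnit_sqrt_modelKernel h)
  have hb := ((ContinuousLinearMap.isUnit_iff_bijective).1 hs).2
  refine LinearMap.range_comp_of_range_eq_top
    (f := (Ring.inverse (CFC.sqrt (modelKernel Γ w w))).toLinearMap) (Γ w).toLinearMap ?_
  exact LinearMap.range_eq_top.2 hb

omit [CompleteSpace H] in
-- Used to compare an arbitrary model with the defect field: both parametrize the same deficiency
-- space.
lemma exists_isUnit_comp_eq {A B : EuclideanSpace ℂ (Fin n) →L[ℂ] H}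
    (hA : Function.Injective A) (hB : Function.Injective B)
    (h : LinearMap.range A.toLinearMap = LinearMap.range B.toLinearMap) :
    ∃ C : EuclideanSpace ℂ (Fin n) →L[ℂ] EuclideanSpace ℂ (Fin n), IsUnit C ∧ A = B.comp C := by
  let eA := LinearEquiv.ofInjective A.toLinearMap hA
  let eB := LinearEquiv.ofInjective B.toLinearMap hB
  let e := (eA.trans (LinearEquiv.ofEq _ _ h)).trans eB.symm
  refine ⟨LinearMap.toContinuousLinearMap e.toLinearMap, ?_, ?_⟩
  · rw [ContinuousLinearMap.isUnit_iff_bijective]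
    exact e.bijective
  · ext1 a
    have : eB (e a) = LinearEquiv.ofEq _ _ h (eA a) := by simp [e]
    exact (congrArg Subtype.val this).symm

include hW in
/-- The Herglotz function of the Livšic function of a model is its Weyl function. -/
lemma herglotzFunction_livsic {Γ : ℂ → EuclideanSpace ℂ (Fin n) →L[ℂ] H}
    (hI : IsUnit (modelKernel Γ Complex.I Complex.I))
    (hWU : ∀ a, W (normalizedModel Γ (-Complex.I) a) = -Complex.I • normalizedModel Γ Complex.I a)
    (hinj : ∀ w : ℂ, w.im ≠ 0 → Function.Injective (Γ w))
    (hr : ∀ w : ℂ, w.im ≠ 0 → LinearMap.range (Γ w).toLinearMap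
      = LinearMap.range (defectField W (normalizedModel Γ Complex.I) w).toLinearMap)
    (hz : z.im ≠ 0) :
    herglotzFunction (livsic Γ) z = weylFunction W (normalizedModel Γ Complex.I) z := by
  have hU := adjoint_normalizedModel_comp hI
  set U := normalizedModel Γ Complex.I with hUdef
  have upper : ∀ z : ℂ, 0 < z.im → herglotzUpper (livsic Γ) z = weylFunction W U z := by
    intro z hz
    -- With `Γ(z) = γ(z) B`, the factor `B*` appears on the left of both `Φ(z)` and `Ψ(z)` and
    -- cancels in `Φ(z)⁻¹ Ψ(z)`. So only the normalized values at `i` and `-i` matter.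
    obtain ⟨B, hB, hΓ⟩ := exists_isUnit_comp_eq (hinj z hz.ne') (defectField_injective hW hU hz.ne')
      (hr z hz.ne')
    refine cayley_mul_inverse (isUnit_weylFunction_add_one hW hU hz) ?_
    have hB' : IsUnit (ContinuousLinearMap.adjoint B) := by
      rw [← ContinuousLinearMap.star_eq_adjoint]; exact hB.star
    have hzI : z + Complex.I ≠ 0 := by
      intro h
      have := congrArg Complex.im h
      simp at this
      linarith
    set G := ContinuousLinearMap.adjoint (defectField W U z)
    have e1 := weylFunction_add_one hW hU hz.ne'
    have e2 := weylFunction_sub_one hW hWU hz.ne'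
    have hc : -Complex.I * (z + Complex.I) ≠ 0 := by simp [hzI]
    have hP : IsUnit (G.comp U) := by
      have h1 := isUnit_weylFunction_add_one hW hU hz
      rw [e1] at h1
      have h2 := h1.smul (Units.mk0 _ hc)⁻¹
      rwa [← Units.smul_mk0 hc, inv_smul_smul] at h2
    have e3 : Ring.inverse (weylFunction W U z + 1)
        = (-Complex.I * (z + Complex.I))⁻¹ • Ring.inverse (G.comp U) := by
      refine left_inv_eq_right_inv
        (Ring.inverse_mul_cancel _ (isUnit_weylFunction_add_one hW hU hz)) ?_
      rw [e1, smul_mul_smul_comm, Ring.mul_inverse_cancel _ hP, mul_inv_cancel₀ hc, one_smul]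
    have e4 : ∀ X : EuclideanSpace ℂ (Fin n) →L[ℂ] H,
        (ContinuousLinearMap.adjoint (Γ z)).comp X
          = ContinuousLinearMap.adjoint B * G.comp X := by
      intro X
      rw [hΓ, ContinuousLinearMap.adjoint_comp]; rfl
    have e5 : Ring.inverse (ContinuousLinearMap.adjoint B * G.comp U)
        = Ring.inverse (G.comp U) * Ring.inverse (ContinuousLinearMap.adjoint B) := by
      refine left_inv_eq_right_inv (Ring.inverse_mul_cancel _ (hB'.mul hP)) ?_
      rw [mul_assoc, ← mul_assoc (G.comp U), Ring.mul_inverse_cancel _ hP, one_mul,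
        Ring.mul_inverse_cancel _ hB']
    rw [livsic_eq, e4, e4, ← hUdef, e5, mul_assoc, ← mul_assoc (Ring.inverse _) _ (G.comp _),
      Ring.inverse_mul_cancel _ hB', one_mul, e2, e3, smul_mul_smul_comm, smul_smul]
    congr 1
    rw [mul_inv, inv_neg, Complex.inv_I, neg_neg]
    ring
  unfold herglotzFunction
  split_ifs with h
  · exact upper z h
  · have h' : 0 < (conj z).im := by
      rw [Complex.conj_im]
      have := lt_of_le_of_ne (not_lt.1 h) hz
      linarith
    rw [upper _ h', adjoint_weylFunction hW hU h'.ne', neg_neg, Complex.conj_conj]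

lemma isOpen_im_ne_zero : IsOpen {z : ℂ | z.im ≠ 0} :=
  isOpen_ne_fun Complex.continuous_im continuous_const

include hW in
lemma continuousAt_modelKernel_defectField (hz : z.im ≠ 0) :
    ContinuousAt (fun z => modelKernel (defectField W U) w z) z := by
  have h : ContinuousAt (fun z => (-4 : ℂ) • (ContinuousLinearMap.adjoint U).comp
      ((cayleyResolvent W z * W * cayleyResolvent W (conj w)).comp U)) z := by
    have := (differentiableAt_cayleyResolvent (isUnit_cayleyPencil hW hz)).continuousAt
    fun_prop
  refine h.congr ?_
  filter_upwards [isOpen_im_ne_zero.mem_nhds hz] with z' hz'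
  exact (modelKernel_defectField hW U hz').symm

include hW in
-- By `weylFunction_sub` the difference quotient at `z'` is exactly `-i` times the kernel at `(z̄,
-- z')`, so the derivative exists by continuity of the kernel. It supplies the value at the
-- removable singularity.
lemma hasDerivAt_weylFunction (hz : z.im ≠ 0) : HasDerivAt (weylFunction W U)
    (-Complex.I • modelKernel (defectField W U) (conj z) z) z := by
  rw [hasDerivAt_iff_tendsto_slope]
  have h := ((continuousAt_modelKernel_defectField (U := U) (w := conj z) hW hz).const_smul
    (-Complex.I)).tendsto.mono_left (nhdsWithin_le_nhds (s := {z}ᶜ))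
  refine h.congr' ?_
  filter_upwards [nhdsWithin_le_nhds (isOpen_im_ne_zero.mem_nhds hz), self_mem_nhdsWithin]
    with z' hz' hne
  have hz'' : (conj z).im ≠ 0 := by simpa using hz
  have h2 := weylFunction_sub (U := U) hW hz' hz''
  rw [Complex.conj_conj] at h2
  have hne' : z' - z ≠ 0 := sub_ne_zero.2 hne
  rw [slope_def_module, h2, smul_smul, Pi.smul_apply]
  congr 1
  field_simp
  ring

include hW hU in
/-- The Herglotz kernel is the kernel of the defect field. -/
lemma herglotzKernel_eq {V : ℂ → EuclideanSpace ℂ (Fin n) →L[ℂ] EuclideanSpace ℂ (Fin n)}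
    (hV : ∀ z : ℂ, z.im ≠ 0 → herglotzFunction V z = weylFunction W U z)
    (hz : z.im ≠ 0) (hw : w.im ≠ 0) :
    herglotzKernel V w z = (1 / Real.pi : ℂ) • modelKernel (defectField W U) w z := by
  have hpi : (Real.pi : ℂ) ≠ 0 := by exact_mod_cast Real.pi_ne_zero
  unfold herglotzKernel
  split_ifs with h
  · have hd : deriv (herglotzFunction V) z = deriv (weylFunction W U) z := by
      refine Filter.EventuallyEq.deriv_eq ?_
      filter_upwards [isOpen_im_ne_zero.mem_nhds hz] with z' hz' using hV z' hz'
    rw [hd, (hasDerivAt_weylFunction hW hz).deriv, smul_smul, h, Complex.conj_conj]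
    congr 1
    field_simp
    linear_combination -Complex.I_sq
  · have hne : conj w - z ≠ 0 := sub_ne_zero.2 (Ne.symm h)
    rw [hV z hz, hV w hw, weylFunction_add_adjoint hW hU hz hw, smul_smul]
    congr 1
    field_simp

end LivsicKernel

/-! ## Symmetric operators and their Cayley transforms -/

section Symmetric

variable {H : Type*} [NormedAddCommGroup H] [InnerProductSpace ℂ H] {n : ℕ} {T : H →ₗ.[ℂ] H}

lemma mem_rangeSub {w : ℂ} {y : H} :
    y ∈ rangeSub T w ↔ ∃ x : T.domain, T x - w • (x : H) = y := Iff.rfl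

lemma mem_orthogonal_rangeSub {w : ℂ} {y : H} :
    y ∈ (rangeSub T w)ᗮ ↔ ∀ x : T.domain, inner ℂ (T x - w • (x : H)) y = 0 := by
  rw [Submodule.mem_orthogonal]
  exact ⟨fun h x => h _ ⟨x, rfl⟩, fun h u hu => by obtain ⟨x, rfl⟩ := mem_rangeSub.1 hu; exact h x⟩

variable (hs : ∀ x y : T.domain, inner ℂ (T x) (y : H) = inner ℂ (x : H) (T y))

include hs in
-- Symmetry makes `⟨x, T x⟩` real, so the imaginary part of `⟨x, (T - w) x⟩` is `-Im w ‖x‖²`; then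
-- Cauchy–Schwarz.
lemma abs_im_mul_norm_le (w : ℂ) (x : T.domain) :
    |w.im| * ‖(x : H)‖ ≤ ‖T x - w • (x : H)‖ := by
  have h0 : (inner ℂ (x : H) (T x)).im = 0 := by
    have h := hs x x
    rw [← inner_conj_symm (T x) (x : H)] at h
    have h1 := congrArg Complex.im h
    rw [Complex.conj_im] at h1
    linarith
  have h1 : (inner ℂ (x : H) (T x - w • (x : H))).im = -(w.im * ‖(x : H)‖ ^ 2) := by
    rw [inner_sub_right, inner_smul_right, inner_self_eq_norm_sq_to_K, Complex.sub_im, h0]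
    have : ((‖(x : H)‖ : ℂ) ^ 2) = ((‖(x : H)‖ ^ 2 : ℝ) : ℂ) := by push_cast; rfl
    rw [zero_sub, ← Complex.im_mul_ofReal w, ← this]
    rfl
  have h2 := (Complex.abs_im_le_norm _).trans (norm_inner_le_norm (𝕜 := ℂ) (x : H)
    (T x - w • (x : H)))
  rw [h1, abs_neg, abs_mul, abs_of_nonneg (sq_nonneg ‖(x : H)‖)] at h2
  rcases (norm_nonneg (x : H)).eq_or_lt with h | h
  · rw [← h, mul_zero]; exact norm_nonneg _
  · refine le_of_mul_le_mul_left ?_ h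
    linarith

include hs in
lemma norm_add_I_eq_norm_sub_I (x : T.domain) :
    ‖T x + Complex.I • (x : H)‖ = ‖T x - Complex.I • (x : H)‖ := by
  rw [← sq_eq_sq₀ (norm_nonneg _) (norm_nonneg _), ← re_inner_self_eq, ← re_inner_self_eq]
  congr 1
  simp only [inner_add_left, inner_add_right, inner_sub_left, inner_sub_right, inner_smul_left,
    inner_smul_right, hs x x, Complex.conj_I]
  ring

include hs in
-- The range is the image of the complete space `T.graph` under `(x, y) ↦ y - w x`, which is bounded
-- below by `abs_im_mul_norm_le`.
lemma isClosed_rangeSub [CompleteSpace H] (hc : T.IsClosed) {w : ℂ} (hw : w.im ≠ 0) :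
    IsClosed (rangeSub T w : Set H) := by
  have hc' : CompleteSpace T.graph := IsClosed.completeSpace_coe (hs := hc)
  let f : T.graph →ₗ[ℂ] H := (LinearMap.snd ℂ H H - w • LinearMap.fst ℂ H H).comp T.graph.subtype
  have hpos : 0 < |w.im| := abs_pos.2 hw
  -- With `y = (T - w) x`, the constant covers both `‖x‖ ≤ ‖y‖ / |Im w|` and `‖T x‖ ≤ ‖y‖ + ‖w‖
  -- ‖x‖`; the norm on the graph is their maximum.
  have hbound : ∀ p : T.graph, ‖p‖ ≤ (1 + (1 + ‖w‖) / |w.im|) * ‖f p‖ := by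
    rintro ⟨p, hp⟩
    obtain ⟨x, hx1, hx2⟩ := (LinearPMap.mem_graph_iff T).1 hp
    have hf : f ⟨p, hp⟩ = T x - w • (x : H) := by
      change p.2 - w • p.1 = _
      rw [hx1, hx2]
    have h1 := abs_im_mul_norm_le hs w x
    rw [hf]
    set y := T x - w • (x : H) with hy
    have h2 : ‖(x : H)‖ ≤ ‖y‖ / |w.im| := by rw [le_div_iff₀ hpos]; linarith
    have h3 : ‖T x‖ ≤ ‖y‖ + ‖w‖ * ‖(x : H)‖ := by
      have : T x = y + w • (x : H) := by rw [hy]; abel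
      rw [this, ← norm_smul]
      exact norm_add_le _ _
    have h4 : (1 + (1 + ‖w‖) / |w.im|) * ‖y‖ = ‖y‖ + ‖y‖ / |w.im| + ‖w‖ * (‖y‖ / |w.im|) := by
      ring
    have h5 := mul_le_mul_of_nonneg_left h2 (norm_nonneg w)
    have h6 : 0 ≤ ‖w‖ * (‖y‖ / |w.im|) := by positivity
    have h7 : 0 ≤ ‖y‖ / |w.im| := by positivity
    have h8 := norm_nonneg y
    rw [h4]
    change ‖p‖ ≤ _
    rw [Prod.norm_def, ← hx1, ← hx2]
    exact max_le (by linarith) (by linarith)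
  have hcont : Continuous f := by
    change Continuous fun p : T.graph => (p : H × H).2 - w • (p : H × H).1
    fun_prop
  have hcl := AntilipschitzWith.isClosed_range
    (AddMonoidHomClass.antilipschitz_of_bound (K := ⟨1 + (1 + ‖w‖) / |w.im|, by positivity⟩) f
      hbound) (uniformContinuous_of_continuousAt_zero f hcont.continuousAt)
  convert hcl using 1
  ext y
  constructor
  · rintro ⟨x, rfl⟩
    exact ⟨⟨(x, T x), T.mem_graph x⟩, rfl⟩
  · rintro ⟨⟨p, hp⟩, rfl⟩
    obtain ⟨x, hx1, hx2⟩ := (LinearPMap.mem_graph_iff T).1 hp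
    refine ⟨x, ?_⟩
    change T x - w • (x : H) = p.2 - w • p.1
    rw [hx1, hx2]

end Symmetric

/-! ### Unitary extensions of the Cayley transform -/

section CayleyTransform

variable {H : Type*} [NormedAddCommGroup H] [InnerProductSpace ℂ H] [CompleteSpace H] {n : ℕ}

/-- `W` is the unitary operator extending the Cayley transform of `T` which maps the deficiency
space `Rng U' = Rng (T + i)ᗮ` to `Rng U = Rng (T - i)ᗮ` by `U' a ↦ -i U a`. -/
structure IsCayleyExtension (T : H →ₗ.[ℂ] H) (U U' : EuclideanSpace ℂ (Fin n) →L[ℂ] H)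
    (W : H →L[ℂ] H) : Prop where
  isometry : (ContinuousLinearMap.adjoint U).comp U = 1
  range_lower : LinearMap.range U'.toLinearMap = (rangeSub T (-Complex.I))ᗮ
  mem_unitary : W ∈ unitary (H →L[ℂ] H)
  map_domain : ∀ x : T.domain, W (T x + Complex.I • (x : H)) = T x - Complex.I • (x : H)
  map_defect : ∀ a, W (U' a) = -Complex.I • U a

lemma norm_eq_of_adjoint_comp_self {U : EuclideanSpace ℂ (Fin n) →L[ℂ] H}
    (hU : (ContinuousLinearMap.adjoint U).comp U = 1) (a : EuclideanSpace ℂ (Fin n)) :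
    ‖U a‖ = ‖a‖ :=
  (ContinuousLinearMap.norm_map_iff_adjoint_comp_self U).2 hU a

/-- The vectors `(T + i) x + U' a` and `(T - i) x - i U a` are orthogonal sums of pieces of equal
norms. Each kind is dense: a vector orthogonal to the first summands lies in the range of `U'`,
respectively `U`, and is then killed by the second. The rest is extension by continuity. -/
lemma exists_isCayleyExtension {T : H →ₗ.[ℂ] H} {U U' : EuclideanSpace ℂ (Fin n) →L[ℂ] H}
    (hs : ∀ x y : T.domain, inner ℂ (T x) (y : H) = inner ℂ (x : H) (T y))
    (hU : (ContinuousLinearMap.adjoint U).comp U = 1)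
    (hU' : (ContinuousLinearMap.adjoint U').comp U' = 1)
    (hr : LinearMap.range U.toLinearMap = (rangeSub T Complex.I)ᗮ)
    (hr' : LinearMap.range U'.toLinearMap = (rangeSub T (-Complex.I))ᗮ) :
    ∃ W, IsCayleyExtension T U U' W := by
  let e : T.domain × EuclideanSpace ℂ (Fin n) →ₗ[ℂ] H :=
    (T.toFun + Complex.I • T.domain.subtype).coprod U'.toLinearMap
  let f : T.domain × EuclideanSpace ℂ (Fin n) →ₗ[ℂ] H :=
    (T.toFun - Complex.I • T.domain.subtype).coprod (-Complex.I • U).toLinearMap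
  have he : ∀ x a, e (x, a) = (T x + Complex.I • (x : H)) + U' a := fun x a => rfl
  have hf : ∀ x a, f (x, a) = (T x - Complex.I • (x : H)) + -Complex.I • U a := fun x a => rfl
  have o : ∀ (x : T.domain) a, inner ℂ (T x - Complex.I • (x : H)) (U a) = 0 := fun x a =>
    mem_orthogonal_rangeSub.1 (hr ▸ ⟨a, rfl⟩ : U a ∈ (rangeSub T Complex.I)ᗮ) x
  have o' : ∀ (x : T.domain) a, inner ℂ (T x + Complex.I • (x : H)) (U' a) = 0 := fun x a => by
    have h := mem_orthogonal_rangeSub.1 (hr' ▸ ⟨a, rfl⟩ : U' a ∈ (rangeSub T (-Complex.I))ᗮ) x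
    rwa [neg_smul, sub_neg_eq_add] at h
  obtain ⟨W, hW⟩ := exists_linearIsometryEquiv_of_norm_eq e f
    (denseRange_of_orthogonal_eq_bot e fun y hy => by
      have h1 : y ∈ (rangeSub T (-Complex.I))ᗮ := mem_orthogonal_rangeSub.2 fun x => by
        have := hy (x, 0)
        rwa [he, map_zero, add_zero, ← sub_neg_eq_add, ← neg_smul] at this
      rw [← hr'] at h1
      obtain ⟨a, rfl⟩ := h1
      have := hy (0, a)
      simpa [he] using this)
    (denseRange_of_orthogonal_eq_bot f fun y hy => by
      have h1 : y ∈ (rangeSub T Complex.I)ᗮ := mem_orthogonal_rangeSub.2 fun x => by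
        have := hy (x, 0)
        rwa [hf, map_zero, smul_zero, add_zero] at this
      rw [← hr] at h1
      obtain ⟨a, rfl⟩ := h1
      have := hy (0, a)
      simpa [hf, inner_smul_left] using this)
    (by
      rintro ⟨x, a⟩
      rw [he, hf, ← sq_eq_sq₀ (norm_nonneg _) (norm_nonneg _), sq, sq,
        norm_add_sq_eq_norm_sq_add_norm_sq_of_inner_eq_zero (𝕜 := ℂ) _ _ (o' x a),
        norm_add_sq_eq_norm_sq_add_norm_sq_of_inner_eq_zero (𝕜 := ℂ) _ _
          (by rw [inner_smul_right, o, mul_zero]),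
        norm_add_I_eq_norm_sub_I hs, norm_smul, norm_eq_of_adjoint_comp_self hU,
        norm_eq_of_adjoint_comp_self hU']
      simp)
  refine ⟨(Unitary.linearIsometryEquiv.symm W : H →L[ℂ] H), hU, hr',
    (Unitary.linearIsometryEquiv.symm W).2, fun x => ?_, fun a => ?_⟩
  · have := hW (x, 0)
    rwa [he, hf, map_zero, map_zero, add_zero, smul_zero, add_zero] at this
  · have := hW (0, a)
    rw [he, hf] at this
    simpa using this

namespace IsCayleyExtension

variable {T : H →ₗ.[ℂ] H} {U U' : EuclideanSpace ℂ (Fin n) →L[ℂ] H} {W : H →L[ℂ] H}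
  (h : IsCayleyExtension T U U' W)

include h

lemma inner_map_map (x y : H) : inner ℂ (W x) (W y) = inner ℂ x y := by
  rw [← ContinuousLinearMap.adjoint_inner_right, ← ContinuousLinearMap.star_eq_adjoint]
  have := congrArg (fun B : H →L[ℂ] H => B y) (Unitary.star_mul_self_of_mem h.mem_unitary)
  rw [show star W (W y) = y from this]

lemma pencil_apply (z : ℂ) (x : T.domain) :
    cayleyPencil W z (T x + Complex.I • (x : H)) = (2 * Complex.I) • (T x - z • (x : H)) := by
  simp only [cayleyPencil, add_apply, smul_apply, one_apply_eq_self, h.map_domain]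
  have h1 : ∀ u v : H, (Complex.I - z) • (u + Complex.I • v) + (Complex.I + z) • (u - Complex.I • v)
      = (2 * Complex.I) • (u - z • v) := fun u v => by module
  exact h1 _ _

/-- The defect field parametrizes the deficiency spaces. -/
lemma range_defectField {w : ℂ} (hw : w.im ≠ 0) :
    LinearMap.range (defectField W U w).toLinearMap = (rangeSub T w)ᗮ := by
  have hw' : (conj w).im ≠ 0 := by simpa using hw
  have hW := h.mem_unitary
  -- On the domain `P(w)(T + i) = 2i (T - w)`, so `P(w)*` moves the orthogonality from the range of
  -- `T - w` to that of `T + i`.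
  have key : ∀ v, v ∈ (rangeSub T w)ᗮ ↔ star (cayleyPencil W w) v ∈ (rangeSub T (-Complex.I))ᗮ := by
    intro v
    rw [mem_orthogonal_rangeSub, mem_orthogonal_rangeSub]
    refine forall_congr' fun x => ?_
    rw [ContinuousLinearMap.star_eq_adjoint, ContinuousLinearMap.adjoint_inner_right, neg_smul,
      sub_neg_eq_add, h.pencil_apply, inner_smul_left, mul_eq_zero,
      or_iff_right (by simp)]
  have h1 : ∀ u, star (cayleyPencil W w) (star (cayleyResolvent W w) u) = u := fun u => by
    have := congrArg (fun B : H →L[ℂ] H => B u)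
      (congrArg star (cayleyResolvent_mul_pencil hW hw))
    rwa [star_mul, star_one] at this
  have h2 : ∀ u, star (cayleyResolvent W w) (star (cayleyPencil W w) u) = u := fun u => by
    have := congrArg (fun B : H →L[ℂ] H => B u)
      (congrArg star (cayleyPencil_mul_resolvent hW hw))
    rwa [star_mul, star_one] at this
  -- The adjoint resolvent carries a factor `W`, and `W U' = -i U` brings the lower deficiency space
  -- back to `U`.
  have h3 : ∀ a, star (cayleyResolvent W w) (U' a) = (1 / 2 : ℂ) • defectField W U w a := by
    intro a
    rw [star_cayleyResolvent hW hw, neg_apply, mul_apply_eq_comp, h.map_defect, map_smul,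
      defectField, smul_apply, smul_smul, ← neg_smul]
    congr 1
    ring
  ext v
  rw [key, ← h.range_lower]
  constructor
  · rintro ⟨a, rfl⟩
    refine ⟨(2 : ℂ) • a, ?_⟩
    have := congrArg (fun v => (2 : ℂ) • star (cayleyPencil W w) v) (h3 a)
    simp only [h1, map_smul, smul_smul] at this
    simpa using this
  · rintro ⟨a, ha⟩
    refine ⟨(1 / 2 : ℂ) • a, ?_⟩
    have ha' : U' a = star (cayleyPencil W w) v := ha
    rw [← h2 v, ← ha', h3]
    simp

/-- If `W x = x`, then `⟨x, (T + i) y⟩ = ⟨W x, W (T + i) y⟩ = ⟨x, (T - i) y⟩`, hence `x` is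
orthogonal to the dense domain. In terms of `A`, no spectral mass sits at infinity. -/
lemma eq_zero_of_map_eq (hd : Dense (T.domain : Set H)) {x : H} (hx : W x = x) : x = 0 := by
  have h1 : ∀ y : T.domain, inner ℂ x (y : H) = 0 := by
    intro y
    have := h.inner_map_map x (T y + Complex.I • (y : H))
    rw [hx, h.map_domain, inner_sub_right, inner_add_right, inner_smul_right] at this
    have h2 : (2 * Complex.I) * inner ℂ x (y : H) = 0 := by linear_combination -this
    simpa using h2
  exact hd.eq_zero_of_inner_left ℂ fun y hy => h1 ⟨y, hy⟩

omit h in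
lemma continuousAt_defectField (hW : W ∈ unitary (H →L[ℂ] H)) {w : ℂ} (hw : w.im ≠ 0) :
    ContinuousAt (defectField W U) w := by
  have hw' : (conj w).im ≠ 0 := by simpa using hw
  have h1 : ContinuousAt (fun z => cayleyResolvent W (conj z)) w :=
    ContinuousAt.comp (f := conj)
      (differentiableAt_cayleyResolvent (isUnit_cayleyPencil hW hw')).continuousAt
      Complex.continuous_conj.continuousAt
  unfold defectField
  fun_prop

/-- The defect field is total if its values span, even with one point left out. -/
lemma defectField_total (ht : ∀ y, (∀ w : ℂ, w.im ≠ 0 → ∀ a, inner ℂ (defectField W U w a) y = 0) →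
      y = 0) {w₀ : ℂ} (hw₀ : w₀.im ≠ 0) (y : H)
    (hy : ∀ w : ℂ, w.im ≠ 0 → w ≠ w₀ → ∀ a, inner ℂ (defectField W U w a) y = 0) : y = 0 := by
  refine ht y fun w hw a => ?_
  by_cases hne : w = w₀
  · subst hne
    have h1 : ContinuousAt (fun z => inner ℂ (defectField W U z a) y) w := by
      have := continuousAt_defectField (U := U) h.mem_unitary hw
      fun_prop
    refine tendsto_nhds_unique (h1.tendsto.mono_left (nhdsWithin_le_nhds (s := {w}ᶜ)))
      (tendsto_const_nhds.congr' ?_)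
    filter_upwards [nhdsWithin_le_nhds (isOpen_im_ne_zero.mem_nhds hw), self_mem_nhdsWithin]
      with z hz hzne using (hy z hz hzne a).symm
  · exact hy w hw hne a

/-- The ranges of `T - w` are closed, so a vector orthogonal to all deficiency spaces lies in every
range, and simplicity applies. -/
lemma defectField_total_of_simple
    (hs : ∀ x y : T.domain, inner ℂ (T x) (y : H) = inner ℂ (x : H) (T y)) (hc : T.IsClosed)
    (hsimple : ⨅ w : ℂ, ⨅ _ : w.im ≠ 0, rangeSub T w = ⊥) (y : H)
    (hy : ∀ w : ℂ, w.im ≠ 0 → ∀ a, inner ℂ (defectField W U w a) y = 0) : y = 0 := by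
  rw [← Submodule.mem_bot ℂ, ← hsimple]
  simp only [Submodule.mem_iInf]
  intro w hw
  have hcl : IsClosed (rangeSub T w : Set H) := isClosed_rangeSub hs hc hw
  rw [← hcl.submodule_topologicalClosure_eq, ← Submodule.orthogonal_orthogonal_eq_closure,
    ← h.range_defectField hw, Submodule.mem_orthogonal]
  rintro _ ⟨a, rfl⟩
  exact hy w hw a

end IsCayleyExtension

/-- Pick `q ∈ G` with `q.2 + i q.1 = p.2 + i p.1`. Subtracting the relations for `p` and `q` shows
that `γ w a` is orthogonal to `(w + i)(p.1 - q.1)`; the factor vanishes only at `w = -i`, so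
totality of the family without that point gives `p = q`. The criterion involves only inner products
with the family, hence is preserved by a unitary map between two such families. -/
lemma graph_mem_iff_of_total {E A : Type*} [NormedAddCommGroup E] [InnerProductSpace ℂ E]
    (G : Submodule ℂ (E × E)) (γ : ℂ → A → E)
    (h1 : ∀ p ∈ G, ∀ w : ℂ, w.im ≠ 0 → ∀ a, inner ℂ (γ w a) (p.2 - w • p.1) = 0)
    (h2 : ∀ u, (∀ a, inner ℂ (γ (-Complex.I) a) u = 0) → ∃ p ∈ G, p.2 + Complex.I • p.1 = u)
    (h3 : ∀ y, (∀ w : ℂ, w.im ≠ 0 → w ≠ -Complex.I → ∀ a, inner ℂ (γ w a) y = 0) → y = 0)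
    (p : E × E) :
    p ∈ G ↔ ∀ w : ℂ, w.im ≠ 0 → ∀ a, inner ℂ (γ w a) (p.2 - w • p.1) = 0 := by
  refine ⟨h1 p, fun hp => ?_⟩
  obtain ⟨q, hq, hpq⟩ := h2 (p.2 + Complex.I • p.1) fun a => by
    have := hp (-Complex.I) (by simp) a
    rwa [neg_smul, sub_neg_eq_add] at this
  have e1 : p.2 - q.2 = -Complex.I • (p.1 - q.1) := by
    have : p.2 = q.2 + Complex.I • q.1 - Complex.I • p.1 := by rw [hpq]; abel
    rw [this]
    module
  have e2 : p.1 - q.1 = 0 := h3 _ fun w hw hne a => by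
    have e3 : (p.2 - w • p.1) - (q.2 - w • q.1) = (-(w + Complex.I)) • (p.1 - q.1) := by
      calc _ = (p.2 - q.2) - w • (p.1 - q.1) := by module
        _ = _ := by rw [e1]; module
    have e4 := congrArg (inner ℂ (γ w a)) e3
    rw [inner_sub_right, hp w hw a, h1 q hq w hw a, sub_zero, inner_smul_right] at e4
    have hne' : -(w + Complex.I) ≠ 0 := by
      intro h0
      exact hne (by linear_combination -h0)
    exact (mul_eq_zero.1 e4.symm).resolve_left hne'
  have e5 : p = q := Prod.ext (sub_eq_zero.1 e2) (sub_eq_zero.1 (by rw [e1, e2, smul_zero]))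
  rwa [e5]

namespace IsCayleyExtension

variable {T : H →ₗ.[ℂ] H} {U U' : EuclideanSpace ℂ (Fin n) →L[ℂ] H} {W : H →L[ℂ] H}
  (h : IsCayleyExtension T U U' W)

include h

lemma mem_graph_iff (hs : ∀ x y : T.domain, inner ℂ (T x) (y : H) = inner ℂ (x : H) (T y))
    (hc : T.IsClosed)
    (ht : ∀ y, (∀ w : ℂ, w.im ≠ 0 → ∀ a, inner ℂ (defectField W U w a) y = 0) → y = 0)
    (p : H × H) : p ∈ T.graph ↔
      ∀ w : ℂ, w.im ≠ 0 → ∀ a, inner ℂ (defectField W U w a) (p.2 - w • p.1) = 0 := by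
  refine graph_mem_iff_of_total T.graph (fun w a => defectField W U w a) ?_ ?_ ?_ p
  · intro p hp w hw a
    obtain ⟨x, hx1, hx2⟩ := (LinearPMap.mem_graph_iff T).1 hp
    have : defectField W U w a ∈ (rangeSub T w)ᗮ := h.range_defectField hw ▸ ⟨a, rfl⟩
    rw [← inner_conj_symm, ← hx1, ← hx2, mem_orthogonal_rangeSub.1 this x, map_zero]
  · intro u hu
    have hI : (-Complex.I).im ≠ 0 := by simp
    have hcl : IsClosed (rangeSub T (-Complex.I) : Set H) := isClosed_rangeSub hs hc hI
    have : u ∈ rangeSub T (-Complex.I) := by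
      rw [← hcl.submodule_topologicalClosure_eq, ← Submodule.orthogonal_orthogonal_eq_closure,
        ← h.range_defectField hI, Submodule.mem_orthogonal]
      rintro _ ⟨a, rfl⟩
      exact hu a
    obtain ⟨x, hx⟩ := mem_rangeSub.1 this
    refine ⟨(x, T x), T.mem_graph x, ?_⟩
    rw [← hx, neg_smul, sub_neg_eq_add]
  · exact h.defectField_total ht (by simp)

end IsCayleyExtension

/-- Every simple symmetric operator with equal finite deficiency indices has a model. -/
theorem exists_isModel {T : H →ₗ.[ℂ] H} (hT : IsSimpleSymmetric n T) :
    ∃ Γ : ℂ → EuclideanSpace ℂ (Fin n) →L[ℂ] H, IsModel T Γ := by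
  have iso : ∀ S : Submodule ℂ H, Module.rank ℂ S = n → ∃ U : EuclideanSpace ℂ (Fin n) →L[ℂ] H,
      (ContinuousLinearMap.adjoint U).comp U = 1 ∧ LinearMap.range U.toLinearMap = S := by
    intro S hS
    have hfin : Module.Finite ℂ S := Module.rank_lt_aleph0_iff.1 (hS ▸ Cardinal.natCast_lt_aleph0)
    have hr : Module.finrank ℂ S = n := Module.finrank_eq_of_rank_eq hS
    let b := (stdOrthonormalBasis ℂ S).reindex (finCongr hr)
    let L : EuclideanSpace ℂ (Fin n) →ₗᵢ[ℂ] H := S.subtypeₗᵢ.comp b.repr.symm.toLinearIsometry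
    refine ⟨L.toContinuousLinearMap,
      (ContinuousLinearMap.norm_map_iff_adjoint_comp_self _).1 fun a => L.norm_map a, ?_⟩
    ext y
    constructor
    · rintro ⟨a, rfl⟩
      exact (b.repr.symm a).2
    · intro hy
      refine ⟨b.repr ⟨y, hy⟩, ?_⟩
      change ((b.repr.symm (b.repr ⟨y, hy⟩) : S) : H) = y
      rw [LinearIsometryEquiv.symm_apply_apply]
  obtain ⟨U, hU, hr⟩ := iso _ hT.deficiency_upper
  obtain ⟨U', hU', hr'⟩ := iso _ hT.deficiency_lower
  obtain ⟨W, hW⟩ := exists_isCayleyExtension hT.symmetric hU hU' hr hr'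
  refine ⟨defectField W U, ?_, fun w hw => defectField_injective hW.mem_unitary hU hw,
    fun w hw => hW.range_defectField hw,
    fun w z hwz => isUnit_modelKernel_defectField hW.mem_unitary hU hwz, ?_⟩
  · intro z hz
    refine DifferentiableAt.differentiableWithinAt ?_
    have := differentiableAt_cayleyResolvent (isUnit_cayleyPencil hW.mem_unitary hz)
    simp only [defectField, Complex.conj_conj]
    fun_prop
  · rw [Submodule.topologicalClosure_eq_top_iff, Submodule.eq_bot_iff]
    intro y hy
    refine hW.defectField_total_of_simple hT.symmetric hT.closed hT.simple y fun w hw a => ?_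
    exact (Submodule.mem_orthogonal _ _).1 hy _
      ((le_iSup₂_of_le w hw le_rfl : _ ≤ ⨆ w : ℂ, ⨆ _ : w.im ≠ 0,
        LinearMap.range (defectField W U w).toLinearMap) ⟨a, rfl⟩)

end CayleyTransform

/-! ## The spectral measures of a unitary operator -/

section SpectralMeasure

variable {H : Type*} [NormedAddCommGroup H] [InnerProductSpace ℂ H] [CompleteSpace H]

/-- A continuous real function as a complex one. -/
def ofRealMap {X : Type*} [TopologicalSpace X] (f : C(X, ℝ)) : C(X, ℂ) :=
  ⟨fun x => (f x : ℂ), by fun_prop⟩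

/-- With `f = |√f|²`, the form is `‖√f(W) x‖²`. -/
lemma re_inner_cfcHom_nonneg {W : H →L[ℂ] H} (hW : IsStarNormal W) (x : H)
    {f : C(spectrum ℂ W, ℝ)} (hf : ∀ u, 0 ≤ f u) :
    0 ≤ (inner ℂ x (cfcHom hW (ofRealMap f) x)).re := by
  let g : C(spectrum ℂ W, ℂ) := ofRealMap ⟨fun u => √(f u), by fun_prop⟩
  have hg : ofRealMap f = star g * g := by
    ext u
    change ((f u : ℝ) : ℂ) = conj ((√(f u) : ℝ) : ℂ) * ((√(f u) : ℝ) : ℂ)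
    rw [Complex.conj_ofReal, ← Complex.ofReal_mul, Real.mul_self_sqrt (hf u)]
  rw [hg, map_mul, map_star, mul_apply_eq_comp, ContinuousLinearMap.star_eq_adjoint,
    ContinuousLinearMap.adjoint_inner_right, re_inner_self_eq]
  positivity

/-- The positive functional `f ↦ ⟨x, f(W) x⟩`. -/
def spectralFunctional {W : H →L[ℂ] H} (hW : IsStarNormal W) (x : H) :
    CompactlySupportedContinuousMap (spectrum ℂ W) ℝ →ₚ[ℝ] ℝ :=
  PositiveLinearMap.mk₀
    { toFun := fun f => (inner ℂ x (cfcHom hW (ofRealMap f.toContinuousMap) x)).re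
      map_add' := fun f g => by
        have : ofRealMap (f + g).toContinuousMap
            = ofRealMap f.toContinuousMap + ofRealMap g.toContinuousMap := by
          ext u; simp [ofRealMap]
        rw [this, map_add, add_apply, inner_add_right, Complex.add_re]
      map_smul' := fun c f => by
        have : ofRealMap (c • f).toContinuousMap = (c : ℂ) • ofRealMap f.toContinuousMap := by
          ext u; simp [ofRealMap]
        rw [this, map_smul, smul_apply, inner_smul_right, Complex.re_ofReal_mul]
        rfl }
    (fun f hf => re_inner_cfcHom_nonneg hW x hf)

instance (W : H →L[ℂ] H) : CompactSpace (spectrum ℂ W) :=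
  isCompact_iff_compactSpace.1 (spectrum.isCompact W)

/-- The spectral measure of `W` at `x`. -/
def spectralMeasure {W : H →L[ℂ] H} (hW : IsStarNormal W) (x : H) : Measure (spectrum ℂ W) :=
  RealRMK.rieszMeasure (spectralFunctional hW x)

instance {W : H →L[ℂ] H} (hW : IsStarNormal W) (x : H) :
    IsFiniteMeasure (spectralMeasure hW x) := by
  unfold spectralMeasure
  infer_instance

/-- The Riesz measure represents the real part by construction; the imaginary part vanishes because
`f(W)` is self-adjoint for real `f`. -/
lemma inner_cfcHom_ofRealMap {W : H →L[ℂ] H} (hW : IsStarNormal W) (x : H)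
    (f : C(spectrum ℂ W, ℝ)) :
    inner ℂ x (cfcHom hW (ofRealMap f) x) = ((∫ u, f u ∂spectralMeasure hW x : ℝ) : ℂ) := by
  let f' : CompactlySupportedContinuousMap (spectrum ℂ W) ℝ :=
    ⟨f, HasCompactSupport.of_compactSpace _⟩
  have h1 : ∫ u, f u ∂spectralMeasure hW x = (inner ℂ x (cfcHom hW (ofRealMap f) x)).re :=
    RealRMK.integral_rieszMeasure (spectralFunctional hW x) f'
  have h2 : star (cfcHom hW (ofRealMap f)) = cfcHom hW (ofRealMap f) := by
    rw [← map_star]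
    congr 1
    ext u
    exact Complex.conj_ofReal _
  rw [h1]
  refine (Complex.conj_eq_iff_re.1 ?_).symm
  rw [inner_conj_symm]
  nth_rw 1 [← h2]
  rw [ContinuousLinearMap.star_eq_adjoint, ContinuousLinearMap.adjoint_inner_left]

lemma integrable_continuousMap {X E : Type*} [TopologicalSpace X] [CompactSpace X]
    [MeasurableSpace X] [BorelSpace X] [NormedAddCommGroup E] [SecondCountableTopologyEither X E]
    (ν : Measure X) [IsFiniteMeasure ν] (F : C(X, E)) : Integrable F ν :=
  Integrable.of_bound F.continuous.aestronglyMeasurable ‖F‖ (ae_of_all _ F.norm_coe_le_norm)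

lemma integral_spectralMeasure {W : H →L[ℂ] H} (hW : IsStarNormal W) (x : H)
    (F : C(spectrum ℂ W, ℂ)) :
    ∫ u, F u ∂spectralMeasure hW x = inner ℂ x (cfcHom hW F x) := by
  let f : C(spectrum ℂ W, ℝ) := ⟨fun u => (F u).re, by fun_prop⟩
  let g : C(spectrum ℂ W, ℝ) := ⟨fun u => (F u).im, by fun_prop⟩
  have hF : F = ofRealMap f + Complex.I • ofRealMap g := by
    ext u
    change F u = (F u).re + Complex.I * (F u).im
    rw [mul_comm, Complex.re_add_im]
  have hi := integrable_continuousMap (spectralMeasure hW x) F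
  conv_rhs => rw [hF]
  rw [map_add, map_smul, add_apply, smul_apply, inner_add_right, inner_smul_right,
    inner_cfcHom_ofRealMap, inner_cfcHom_ofRealMap, ← integral_re_add_im hi, mul_comm]
  rfl

/-- The mean ergodic theorem. The averages of `u ^ k` are bounded by `1` and tend to the indicator
of `{1}`, while those of `W ^ k x` tend to the projection of `x` onto the fixed vectors, which is
`0`. -/
lemma spectralMeasure_singleton_one {W : H →L[ℂ] H} (hW : W ∈ unitary (H →L[ℂ] H))
    (hN : IsStarNormal W) (h1 : ∀ y, W y = y → y = 0) (x : H) :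
    spectralMeasure hN x {u | (u : ℂ) = 1} = 0 := by
  set ν := spectralMeasure hN x with hν
  let F : ℕ → C(spectrum ℂ W, ℂ) := fun m =>
    (m : ℂ)⁻¹ • ∑ k ∈ Finset.range m, (ContinuousMap.restrict (spectrum ℂ W) (.id ℂ)) ^ k
  have hFa : ∀ m u, F m u = (m : ℂ)⁻¹ * ∑ k ∈ Finset.range m, (u : ℂ) ^ k := fun m u => by
    simp [F]
  have hu1 : ∀ u : spectrum ℂ W, ‖(u : ℂ)‖ = 1 := fun u => by
    simpa using spectrum.subset_circle_of_unitary hW u.2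
  have hb : ∀ m u, ‖F m u‖ ≤ 1 := by
    intro m u
    rw [hFa, norm_mul, norm_inv, Complex.norm_natCast]
    have : ‖∑ k ∈ Finset.range m, (u : ℂ) ^ k‖ ≤ m := by
      refine (norm_sum_le _ _).trans ?_
      simp [hu1]
    rcases Nat.eq_zero_or_pos m with rfl | hm
    · simp
    · have hm' : (0 : ℝ) < m := by exact_mod_cast hm
      rw [inv_mul_le_iff₀ hm', mul_one]
      exact this
  have hlim : ∀ u : spectrum ℂ W, Filter.Tendsto (fun m => F m u) Filter.atTop
      (nhds (Set.indicator {u : spectrum ℂ W | (u : ℂ) = 1} (fun _ => (1 : ℂ)) u)) := by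
    intro u
    by_cases hu : (u : ℂ) = 1
    · rw [Set.indicator_of_mem (by exact hu)]
      refine tendsto_const_nhds.congr' ?_
      filter_upwards [Filter.eventually_gt_atTop 0] with m hm
      have : (m : ℂ) ≠ 0 := by exact_mod_cast hm.ne'
      simp [hFa, hu, this]
    · rw [Set.indicator_of_notMem (by exact hu)]
      have hu0 : (u : ℂ) - 1 ≠ 0 := sub_ne_zero.2 hu
      -- Away from `u = 1` the geometric sum stays bounded, so its average decays like `1 / m`.
      have hle : ∀ m : ℕ, ‖F m u‖ ≤ (2 / ‖(u : ℂ) - 1‖) * (m : ℝ)⁻¹ := by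
        intro m
        rw [hFa, geom_sum_eq hu, norm_mul, norm_inv, Complex.norm_natCast, norm_div, mul_comm]
        have : ‖(u : ℂ) ^ m - 1‖ ≤ 2 := by
          refine (norm_sub_le _ _).trans ?_
          rw [norm_pow, hu1, one_pow, norm_one]
          norm_num
        gcongr
      refine squeeze_zero_norm hle ?_
      have := (tendsto_inv_atTop_nhds_zero_nat (𝕜 := ℝ)).const_mul (2 / ‖(u : ℂ) - 1‖)
      rwa [mul_zero] at this
  have hms : MeasurableSet {u : spectrum ℂ W | (u : ℂ) = 1} :=
    (isClosed_eq continuous_subtype_val continuous_const).measurableSet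
  have t1 : Filter.Tendsto (fun m => ∫ u, F m u ∂ν) Filter.atTop
      (nhds (∫ u, Set.indicator {u : spectrum ℂ W | (u : ℂ) = 1} (fun _ => (1 : ℂ)) u ∂ν)) :=
    tendsto_integral_of_dominated_convergence (fun _ => 1)
      (fun m => (F m).continuous.aestronglyMeasurable) (integrable_const _)
      (fun m => ae_of_all _ (hb m)) (ae_of_all _ hlim)
  have hFW : ∀ m, cfcHom hN (F m) x = birkhoffAverage ℂ W _root_.id m x := by
    intro m
    rw [birkhoffAverage, birkhoffSum, map_smul, map_sum, smul_apply]
    congr 1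
    rw [sum_apply]
    refine Finset.sum_congr rfl fun k _ => ?_
    rw [map_pow, cfcHom_id hN, FunLike.coe_pow_eq_iterate]
    rfl
  have hn : ‖W‖ ≤ 1 := by
    refine ContinuousLinearMap.opNorm_le_bound _ zero_le_one fun y => ?_
    rw [one_mul]
    have h2 : star W * W = 1 := Unitary.star_mul_self_of_mem hW
    exact ((ContinuousLinearMap.norm_map_iff_adjoint_comp_self W).2 h2 y).le
  have t2 := W.tendsto_birkhoffAverage_orthogonalProjection hn x
  have h0 : ((W.eqLocus (1 : H →L[ℂ] H)).orthogonalProjectionOnto x : H) = 0 :=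
    h1 _ ((W.eqLocus (1 : H →L[ℂ] H)).orthogonalProjectionOnto x).2
  rw [h0] at t2
  have t3 : Filter.Tendsto (fun m => ∫ u, F m u ∂ν) Filter.atTop (nhds 0) := by
    have h4 : ∀ m, ∫ u, F m u ∂ν = inner ℂ x (birkhoffAverage ℂ W _root_.id m x) := fun m => by
      rw [← hFW, hν, integral_spectralMeasure]
    simp only [h4]
    have h5 : Filter.Tendsto (fun m => inner ℂ x (birkhoffAverage ℂ W _root_.id m x)) Filter.atTop
        (nhds (inner ℂ x (0 : H))) := tendsto_const_nhds.inner t2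
    rwa [inner_zero_right] at h5
  have h6 := tendsto_nhds_unique t1 t3
  rw [integral_indicator_const _ hms, Complex.real_smul, mul_one] at h6
  have h7 : ν.real {u : spectrum ℂ W | (u : ℂ) = 1} = 0 := by exact_mod_cast h6
  exact (measureReal_eq_zero_iff).1 h7

/-- The spectral variable `i (1 + u) / (1 - u)` of the inverse Cayley transform. -/
def inverseCayley (u : ℂ) : ℝ := (Complex.I * (1 + u) / (1 - u)).re

lemma measurable_inverseCayley : Measurable inverseCayley := by
  unfold inverseCayley
  fun_prop

/-- On the unit circle `ū = u⁻¹`, which makes the quotient invariant under conjugation; so the real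
part in `inverseCayley` loses nothing there. -/
lemma ofReal_inverseCayley {u : ℂ} (hu : ‖u‖ = 1) (hne : u ≠ 1) :
    (inverseCayley u : ℂ) = Complex.I * (1 + u) / (1 - u) := by
  refine Complex.conj_eq_iff_re.1 ?_
  have h0 : u ≠ 0 := by rintro rfl; simp at hu
  have hc : conj u = u⁻¹ := by
    rw [Complex.inv_def, Complex.normSq_eq_norm_sq, hu]; simp
  have h1 : 1 - u ≠ 0 := sub_ne_zero.2 hne.symm
  have h2 : 1 - u⁻¹ ≠ 0 := by
    intro h
    apply hne
    have := sub_eq_zero.1 h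
    exact (inv_eq_one.1 this.symm)
  rw [map_div₀, map_mul, map_add, map_sub, map_one, hc, Complex.conj_I, div_eq_div_iff h2 h1]
  field_simp
  ring

/-- The distribution on the line of the self-adjoint operator with Cayley transform `W`. -/
def lineMeasure {W : H →L[ℂ] H} (hN : IsStarNormal W) (x : H) : Measure ℝ :=
  (spectralMeasure hN x).map fun u : spectrum ℂ W => inverseCayley u

omit [CompleteSpace H] in
lemma measurable_inverseCayley_coe {W : H →L[ℂ] H} :
    Measurable fun u : spectrum ℂ W => inverseCayley u :=
  measurable_inverseCayley.comp measurable_subtype_coe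

instance {W : H →L[ℂ] H} (hN : IsStarNormal W) (x : H) : IsFiniteMeasure (lineMeasure hN x) := by
  unfold lineMeasure
  infer_instance

lemma cayleyPencil_eq_cfcHom {W : H →L[ℂ] H} (hN : IsStarNormal W) (z : ℂ) :
    cayleyPencil W z = cfcHom hN ((Complex.I - z) • 1 +
      (Complex.I + z) • (ContinuousMap.restrict (spectrum ℂ W) (.id ℂ))) := by
  rw [map_add, map_smul, map_smul, map_one, cfcHom_id, cayleyPencil]

lemma cayleyPencil_symbol_ne_zero {z u : ℂ} (hz : z.im ≠ 0) (hu : ‖u‖ = 1) :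
    (Complex.I - z) + (Complex.I + z) * u ≠ 0 := by
  intro h
  apply norm_sub_I_ne_norm_add_I hz
  have : z - Complex.I = (z + Complex.I) * u := by linear_combination -h
  rw [this, norm_mul, hu, mul_one]

/-- The spectral representation of the kernel of a defect field. -/
lemma inner_defectField {n : ℕ} {W : H →L[ℂ] H} (hW : W ∈ unitary (H →L[ℂ] H))
    (hN : IsStarNormal W) (h1 : ∀ y, W y = y → y = 0) (U : EuclideanSpace ℂ (Fin n) →L[ℂ] H)
    (a : EuclideanSpace ℂ (Fin n)) {w z : ℂ} (hw : w.im ≠ 0) (hz : z.im ≠ 0) :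
    inner ℂ (defectField W U z a) (defectField W U w a)
      = ∫ t : ℝ, (1 + (t : ℂ) ^ 2) * (((t : ℂ) - conj w) * ((t : ℂ) - z))⁻¹
          ∂lineMeasure hN (U a) := by
  have hu1 : ∀ u : spectrum ℂ W, ‖(u : ℂ)‖ = 1 := fun u => by
    simpa using spectrum.subset_circle_of_unitary hW u.2
  let G : {z : ℂ // z.im ≠ 0} → C(spectrum ℂ W, ℂ) := fun z =>
    ⟨fun u => ((Complex.I - z) + (Complex.I + z) * u)⁻¹, by
      refine Continuous.inv₀ (by fun_prop) fun u => cayleyPencil_symbol_ne_zero z.2 (hu1 u)⟩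
  have hR : ∀ z : {z : ℂ // z.im ≠ 0}, cayleyResolvent W z = cfcHom hN (G z) := by
    intro z
    refine left_inv_eq_right_inv (cayleyResolvent_mul_pencil hW z.2) ?_
    rw [cayleyPencil_eq_cfcHom hN, ← map_mul, ← map_one (cfcHom (R := ℂ) hN)]
    congr 1
    ext u
    change ((Complex.I - z) * 1 + (Complex.I + z) * u) * _ = 1
    rw [mul_one]
    exact mul_inv_cancel₀ (cayleyPencil_symbol_ne_zero z.2 (hu1 u))
  have hw' : (conj w).im ≠ 0 := by simpa using hw
  have hz' : (conj z).im ≠ 0 := by simpa using hz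
  have e1 : ∀ (w : ℂ) (hw : (conj w).im ≠ 0), defectField W U w a
      = cfcHom hN ((2 * Complex.I) • G ⟨conj w, hw⟩) (U a) := by
    intro w hw
    rw [defectField, map_smul, ← hR]
    rfl
  rw [e1 w hw', e1 z hz', ← ContinuousLinearMap.adjoint_inner_right,
    ← ContinuousLinearMap.star_eq_adjoint, ← map_star, ← mul_apply_eq_comp, ← map_mul,
    ← integral_spectralMeasure, lineMeasure,
    integral_map measurable_inverseCayley_coe.aemeasurable
      (by
        refine Measurable.aestronglyMeasurable ?_
        fun_prop)]
  refine integral_congr_ae ?_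
  -- The point `u = 1` corresponds to `t = ∞`, and `inverseCayley` has the junk value `0` there; it
  -- is a null set.
  have hne := measure_eq_zero_iff_ae_notMem.1 (spectralMeasure_singleton_one hW hN h1 (U a))
  filter_upwards [hne] with u hu
  have hu' : (u : ℂ) ≠ 1 := hu
  have hc : conj (u : ℂ) = (u : ℂ)⁻¹ := by
    rw [Complex.inv_def, Complex.normSq_eq_norm_sq, hu1]; simp
  have h0 : (u : ℂ) ≠ 0 := by intro h; have := hu1 u; rw [h] at this; simp at this
  change conj (2 * Complex.I * ((Complex.I - conj z) + (Complex.I + conj z) * u)⁻¹) *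
    (2 * Complex.I * ((Complex.I - conj w) + (Complex.I + conj w) * u)⁻¹) = _
  rw [ofReal_inverseCayley (hu1 u) hu']
  have n1 := cayleyPencil_symbol_ne_zero hw' (hu1 u)
  have n2 := cayleyPencil_symbol_ne_zero hz (hu1 u)
  have n3 : 1 - (u : ℂ) ≠ 0 := sub_ne_zero.2 hu'.symm
  -- For `t = i (1 + u)/(1 - u)`, `t - w` is the symbol of the pencil at `w` divided by `1 - u`, and
  -- `1 + t² = -4u / (1 - u)²`; in the integrand the powers of `1 - u` cancel.
  have k : ∀ w : ℂ, Complex.I * (1 + u) / (1 - u) - w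
      = ((Complex.I - w) + (Complex.I + w) * u) / (1 - u) := by
    intro w
    field_simp
    ring
  have k2 : conj ((Complex.I - conj z) + (Complex.I + conj z) * u)
      = -((Complex.I - z) + (Complex.I + z) * u) / u := by
    simp only [map_add, map_sub, map_mul, Complex.conj_I, Complex.conj_conj, hc]
    field_simp
    ring
  have k3 : 1 + (Complex.I * (1 + u) / (1 - u)) ^ 2 = -4 * u / (1 - u) ^ 2 := by
    rw [div_pow, mul_pow, Complex.I_sq, eq_div_iff (pow_ne_zero 2 n3), add_mul,
      div_mul_cancel₀ _ (pow_ne_zero 2 n3)]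
    ring
  rw [map_mul, map_mul, map_inv₀, k2, k, k, k3, Complex.conj_I, Complex.conj_ofNat]
  generalize (Complex.I - z) + (Complex.I + z) * (u : ℂ) = P at n2 ⊢
  generalize (Complex.I - conj w) + (Complex.I + conj w) * (u : ℂ) = Q at n1 ⊢
  field_simp
  linear_combination 4 * Complex.I_sq

end SpectralMeasure

/-! ## Matrix measures from families of scalar measures -/

section KilledFamilies

variable {ι X : Type*} [MeasurableSpace X]

/-- A continuous linear relation between finite measures that holds for the integrals of bounded
continuous functions holds for measurable sets. -/
lemma apply_measureReal_eq_zero [TopologicalSpace X] [BorelSpace X] [HasOuterApproxClosed X]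
    {ν : ι → Measure X} [∀ i, IsFiniteMeasure (ν i)] (L : (ι → ℝ) →L[ℝ] ℂ)
    (h : ∀ F : BoundedContinuousFunction X ℝ, L (fun i => ∫ x, F x ∂ν i) = 0) {S : Set X}
    (hS : MeasurableSet S) : L (fun i => (ν i).real S) = 0 := by
  have closed : ∀ C : Set X, IsClosed C → L (fun i => (ν i).real C) = 0 := by
    intro C hC
    have hb : ∀ m x, ((hC.apprSeq m x : NNReal) : ℝ) ≤ 1 := fun m x =>
      HasOuterApproxClosed.apprSeq_apply_le_one hC m x
    let F : ℕ → BoundedContinuousFunction X ℝ := fun m =>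
      BoundedContinuousFunction.ofNormedAddCommGroup (fun x => ((hC.apprSeq m x : NNReal) : ℝ))
        (by fun_prop) 1 fun x => by
          rw [Real.norm_of_nonneg (NNReal.coe_nonneg _)]; exact hb m x
    -- `ι → ℝ` carries the product topology, so dominated convergence for each index separately is
    -- enough, however large `ι` is.
    have ht : Filter.Tendsto (fun m => (fun i => ∫ x, F m x ∂ν i)) Filter.atTop
        (nhds fun i => (ν i).real C) := by
      rw [tendsto_pi_nhds]
      intro i
      have h1 : ∫ x, Set.indicator C (fun _ => (1 : ℝ)) x ∂ν i = (ν i).real C := by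
        rw [integral_indicator_const _ hC.measurableSet, smul_eq_mul, mul_one]
      rw [← h1]
      refine tendsto_integral_of_dominated_convergence (fun _ => 1)
        (fun m => (F m).continuous.aestronglyMeasurable) (integrable_const _)
        (fun m => ae_of_all _ fun x => ?_) (ae_of_all _ fun x => ?_)
      · exact (Real.norm_of_nonneg (NNReal.coe_nonneg _)).le.trans (hb m x)
      · have h2 := tendsto_pi_nhds.1 (HasOuterApproxClosed.tendsto_apprSeq hC) x
        have h3 := (NNReal.continuous_coe.tendsto _).comp h2
        have h4 : ((C.indicator (fun _ => (1 : NNReal)) x : NNReal) : ℝ)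
            = C.indicator (fun _ => (1 : ℝ)) x := by
          by_cases hx : x ∈ C <;> simp [hx]
        rw [← h4]
        exact h3
    have h4 := (L.continuous.tendsto _).comp ht
    refine tendsto_nhds_unique h4 ?_
    have : (⇑L ∘ fun m => fun i => ∫ x, F m x ∂ν i) = fun _ => 0 := funext fun m => h (F m)
    rw [this]
    exact tendsto_const_nhds
  -- The closed sets form a generating π-system, and the relation passes to complements and disjoint
  -- unions because `L` is linear and continuous.
  induction S, hS using MeasurableSpace.induction_on_inter
    (borel_eq_generateFrom_isClosed (α := X) ▸ BorelSpace.measurable_eq) isPiSystem_isClosed with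
  | empty =>
    have h1 : (fun i => (ν i).real ∅) = 0 := by
      funext i
      simp
    rw [h1, map_zero]
  | basic t ht => exact closed t ht
  | compl t ht ih =>
    have h1 : (fun i => (ν i).real tᶜ) = (fun i => (ν i).real Set.univ) - fun i => (ν i).real t := by
      funext i
      exact measureReal_compl ht
    rw [h1, map_sub, ih, closed _ isClosed_univ, sub_zero]
  | iUnion f hd hm ih =>
    have h1 : HasSum (fun k => (fun i => (ν i).real (f k))) (fun i => (ν i).real (⋃ k, f k)) := by
      rw [Pi.hasSum]
      intro i
      have h2 := hasSum_integral_iUnion (μ := ν i) (f := fun _ => (1 : ℝ)) hm hd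
        (integrable_const _).integrableOn
      simpa using h2
    have h2 := h1.mapL L
    simp only [ih] at h2
    exact h2.unique hasSum_zero

/-- A continuous linear relation between finite measures extends from sets to integrals. -/
lemma apply_integral_eq_zero {ν : ι → Measure X} [∀ i, IsFiniteMeasure (ν i)]
    (L : (ι → ℝ) →L[ℝ] ℂ) (h : ∀ S, MeasurableSet S → L (fun i => (ν i).real S) = 0) {g : X → ℝ}
    (hg : Measurable g) (hi : ∀ i, Integrable g (ν i)) : L (fun i => ∫ x, g x ∂ν i) = 0 := by
  have simple : ∀ f : SimpleFunc X ℝ, L (fun i => f.integral (ν i)) = 0 := by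
    intro f
    have : (fun i => f.integral (ν i))
        = ∑ y ∈ f.range, y • fun i => (ν i).real (f ⁻¹' {y}) := by
      funext i
      rw [SimpleFunc.integral_eq, Finset.sum_apply]
      refine Finset.sum_congr rfl fun y _ => ?_
      rw [Pi.smul_apply, smul_eq_mul, smul_eq_mul, mul_comm]
    rw [this, map_sum]
    refine Finset.sum_eq_zero fun y _ => ?_
    rw [map_smul, h _ (f.measurableSet_preimage _), smul_zero]
  have ht : Filter.Tendsto (fun m => (fun i => (SimpleFunc.approxOn g hg Set.univ 0
      (Set.mem_univ _) m).integral (ν i))) Filter.atTop (nhds fun i => ∫ x, g x ∂ν i) := by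
    rw [tendsto_pi_nhds]
    exact fun i => tendsto_integral_approxOn_of_measurable_of_range_subset hg (hi i) Set.univ
      (Set.subset_univ _)
  have h4 := (L.continuous.tendsto _).comp ht
  refine tendsto_nhds_unique h4 ?_
  have : (⇑L ∘ fun m => (fun i => (SimpleFunc.approxOn g hg Set.univ 0
      (Set.mem_univ _) m).integral (ν i))) = fun _ => 0 := funext fun m => simple _
  rw [this]
  exact tendsto_const_nhds

end KilledFamilies

/-! ### Matrix measures with prescribed quadratic forms -/

namespace MatrixMeasure

variable {n : ℕ}

lemma polCoeff_eq_inner {f : EuclideanSpace ℂ (Fin n) → ℝ}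
    {B : EuclideanSpace ℂ (Fin n) →L[ℂ] EuclideanSpace ℂ (Fin n)}
    (h : ∀ a, inner ℂ a (B a) = (f a : ℂ)) (j k : Fin n) :
    polCoeff f j k = inner ℂ (EuclideanSpace.single j (1 : ℂ)) (B (EuclideanSpace.single k 1)) := by
  rw [polCoeff, ← h, ← h, ← h, ← h]
  simp only [map_add, map_sub, map_smul, inner_add_left, inner_add_right, inner_sub_left,
    inner_sub_right, inner_smul_left, inner_smul_right, Complex.conj_I]
  linear_combination (-(1 / 2 : ℂ) *
    inner ℂ (EuclideanSpace.single j (1 : ℂ)) (B (EuclideanSpace.single k 1))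
    + (1 / 2 : ℂ) * inner ℂ (EuclideanSpace.single k (1 : ℂ)) (B (EuclideanSpace.single j 1)))
      * Complex.I_sq

/-- The operator `pol f` is determined by the quadratic form. -/
lemma pol_eq {f : EuclideanSpace ℂ (Fin n) → ℝ}
    {B : EuclideanSpace ℂ (Fin n) →L[ℂ] EuclideanSpace ℂ (Fin n)}
    (h : ∀ a, inner ℂ a (B a) = (f a : ℂ)) : pol f = B := by
  obtain ⟨M, rfl⟩ : ∃ M, Matrix.toEuclideanCLM (n := Fin n) (𝕜 := ℂ) M = B :=
    ⟨(Matrix.toEuclideanCLM (n := Fin n) (𝕜 := ℂ)).symm B, StarAlgEquiv.apply_symm_apply _ _⟩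
  have key : ∀ j k, M j k = polCoeff f j k := fun j k => by
    rw [polCoeff_eq_inner h]
    simp [EuclideanSpace.inner_single_left, Matrix.ofLp_toEuclideanCLM]
  rw [pol]
  conv_rhs => rw [Matrix.matrix_eq_sum_single M]
  rw [map_sum]
  refine Finset.sum_congr rfl fun j _ => ?_
  rw [map_sum]
  refine Finset.sum_congr rfl fun k _ => ?_
  rw [← key, ← map_smul, Matrix.smul_single, smul_eq_mul, mul_one]

/-- `pol` as a continuous linear map. -/
def polL : (EuclideanSpace ℂ (Fin n) → ℝ) →L[ℝ]
    (EuclideanSpace ℂ (Fin n) →L[ℂ] EuclideanSpace ℂ (Fin n)) where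
  toFun := pol
  map_add' f g := by
    simp only [pol, polCoeff, ← Finset.sum_add_distrib, Pi.add_apply]
    refine Finset.sum_congr rfl fun j _ => Finset.sum_congr rfl fun k _ => ?_
    refine Eq.trans ?_ (add_smul _ _ _)
    congr 1
    push_cast
    ring
  map_smul' c f := by
    simp only [pol, polCoeff, Finset.smul_sum, Pi.smul_apply, RingHom.id_apply]
    refine Finset.sum_congr rfl fun j _ => Finset.sum_congr rfl fun k _ => ?_
    rw [← smul_assoc]
    congr 1
    simp only [smul_eq_mul, Complex.real_smul]
    push_cast
    ring
  cont := by
    unfold pol polCoeff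
    fun_prop

/-- The obstruction to `pol f` having the quadratic form `f`, at the vector `a`. -/
def polDefect (a : EuclideanSpace ℂ (Fin n)) : (EuclideanSpace ℂ (Fin n) → ℝ) →L[ℝ] ℂ :=
  ((innerSL ℂ a).comp (ContinuousLinearMap.apply ℂ _ a)).restrictScalars ℝ ∘L polL -
    Complex.ofRealCLM ∘L ContinuousLinearMap.proj a

lemma polDefect_apply (a : EuclideanSpace ℂ (Fin n)) (f : EuclideanSpace ℂ (Fin n) → ℝ) :
    polDefect a f = inner ℂ a (pol f a) - (f a : ℂ) := rfl

lemma polDefect_eq_zero {f : EuclideanSpace ℂ (Fin n) → ℝ}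
    {B : EuclideanSpace ℂ (Fin n) →L[ℂ] EuclideanSpace ℂ (Fin n)}
    (h : ∀ a, inner ℂ a (B a) = (f a : ℂ)) (a : EuclideanSpace ℂ (Fin n)) :
    polDefect a f = 0 := by
  rw [polDefect_apply, pol_eq h, h, sub_self]

section OfFamily

variable (ν : EuclideanSpace ℂ (Fin n) → Measure ℝ) [∀ a, IsFiniteMeasure (ν a)] (g : ℝ → ℝ)

lemma integrableOn_of_isBounded {ν : Measure ℝ} [IsFiniteMeasure ν] {g : ℝ → ℝ}
    (hg : Continuous g) {S : Set ℝ} (hb : Bornology.IsBounded S) : IntegrableOn g S ν :=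
  (hg.continuousOn.integrableOn_compact hb.isCompact_closure).mono_set subset_closure

/-- Being a quadratic form is the vanishing of the continuous linear maps `polDefect a`, so it
passes from the measures of sets to the integrals of `g` over `S`. -/
lemma inner_pol_setIntegral {ν : EuclideanSpace ℂ (Fin n) → Measure ℝ}
    [∀ a, IsFiniteMeasure (ν a)] {g : ℝ → ℝ}
    (hν : ∀ a S, MeasurableSet S → polDefect a (fun b => (ν b).real S) = 0) (hg : Continuous g)
    {S : Set ℝ} (hS : MeasurableSet S) (hb : Bornology.IsBounded S)
    (a : EuclideanSpace ℂ (Fin n)) :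
    inner ℂ a (pol (fun b => ∫ t in S, g t ∂ν b) a) = ((∫ t in S, g t ∂ν a : ℝ) : ℂ) := by
  have h := apply_integral_eq_zero (polDefect a) (hν a) (hg.measurable.indicator hS) fun b =>
    (integrable_indicator_iff hS).2 (integrableOn_of_isBounded hg hb)
  simp only [integral_indicator hS] at h
  rwa [polDefect_apply, sub_eq_zero] at h

open Classical in
/-- The positive matrix measure with `⟨μ(S) a, a⟩ = ∫_S g dν_a`. -/
def ofFamily (hν : ∀ a S, MeasurableSet S → polDefect a (fun b => (ν b).real S) = 0)
    (hg : Continuous g) (hg0 : ∀ t, 0 ≤ g t) : MatrixMeasure n where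
  toFun S := if MeasurableSet S ∧ Bornology.IsBounded S then
    (Matrix.toEuclideanCLM (n := Fin n) (𝕜 := ℂ)).symm (pol fun b => ∫ t in S, g t ∂ν b) else 0
  posSemidef' S hS hb := by
    rw [if_pos ⟨hS, hb⟩, ← Matrix.isPositive_toEuclideanLin_iff,
      ← Matrix.coe_toEuclideanCLM_eq_toEuclideanLin, StarAlgEquiv.apply_symm_apply,
      ContinuousLinearMap.isPositive_toLinearMap_iff, ContinuousLinearMap.isPositive_iff_complex]
    intro a
    have h := inner_pol_setIntegral hν hg hS hb a
    rw [← inner_conj_symm, h, Complex.conj_ofReal]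
    exact ⟨by simp, by simpa using integral_nonneg hg0⟩
  eq_zero' S hS := if_neg hS
  hasSum_iUnion' S hS hb hd := by
    have hbi : ∀ i, Bornology.IsBounded (S i) := fun i => hb.subset (Set.subset_iUnion S i)
    rw [if_pos ⟨MeasurableSet.iUnion hS, hb⟩]
    simp only [hS, hbi, and_self, if_true]
    have h1 : HasSum (fun i => (fun b => ∫ t in S i, g t ∂ν b))
        (fun b => ∫ t in ⋃ i, S i, g t ∂ν b) := by
      rw [Pi.hasSum]
      exact fun b => hasSum_integral_iUnion hS hd (integrableOn_of_isBounded hg hb)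
    have h2 : HasSum (fun i => pol fun b => ∫ t in S i, g t ∂ν b)
        (pol fun b => ∫ t in ⋃ i, S i, g t ∂ν b) := h1.mapL polL
    refine h2.map (Matrix.toEuclideanCLM (n := Fin n) (𝕜 := ℂ)).symm ?_
    exact LinearMap.continuous_of_finiteDimensional
      ((Matrix.toEuclideanCLM (n := Fin n) (𝕜 := ℂ)).symm.toAlgEquiv.toLinearMap)

variable (hν : ∀ a S, MeasurableSet S → polDefect a (fun b => (ν b).real S) = 0)
    (hg : Continuous g) (hg0 : ∀ t, 0 ≤ g t)

lemma quad_ofFamily {S : Set ℝ} (hS : MeasurableSet S) (hb : Bornology.IsBounded S)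
    (a : EuclideanSpace ℂ (Fin n)) :
    (ofFamily ν g hν hg hg0).quad a S = ∫ t in S, g t ∂ν a := by
  have : (ofFamily ν g hν hg hg0).op S = pol fun b => ∫ t in S, g t ∂ν b := by
    rw [op, ofFamily]
    simp only [if_pos (And.intro hS hb)]
    exact StarAlgEquiv.apply_symm_apply _ _
  rw [quad, this, inner_pol_setIntegral hν hg hS hb, Complex.ofReal_re]

lemma scalarMeasure_ofFamily (a : EuclideanSpace ℂ (Fin n)) :
    (ofFamily ν g hν hg hg0).scalarMeasure a
      = (ν a).withDensity fun t => ENNReal.ofReal (g t) := by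
  refine Measure.ext_of_Ioc _ _ fun x y _ => ?_
  have hb := Metric.isBounded_Ioc x y
  rw [scalarMeasure_apply _ _ measurableSet_Ioc hb, quad_ofFamily _ _ _ _ _ measurableSet_Ioc hb,
    withDensity_apply _ measurableSet_Ioc,
    ofReal_integral_eq_lintegral_ofReal (integrableOn_of_isBounded hg hb)
      (ae_of_all _ hg0)]

end OfFamily

variable (μ : MatrixMeasure n)

lemma inner_density_self (t : ℝ) (a : EuclideanSpace ℂ (Fin n)) :
    inner ℂ a (μ.density t a) = ((inner ℂ a (μ.density t a)).re : ℂ) := by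
  have h2 := (ContinuousLinearMap.isPositive_iff_complex _).1 (μ.density_isPositive t) a
  rw [μ.inner_density_symm] at h2
  exact h2.1.symm

lemma measurable_re_inner_density (a : EuclideanSpace ℂ (Fin n)) :
    Measurable fun t => (inner ℂ a (μ.density t a)).re := by
  have h1 := μ.stronglyMeasurable_density
  have h2 : StronglyMeasurable fun t => μ.density t a :=
    (ContinuousLinearMap.apply ℂ (EuclideanSpace ℂ (Fin n)) a).continuous.comp_stronglyMeasurable h1
  exact Complex.measurable_re.comp (stronglyMeasurable_const.inner h2).measurable

lemma withDensity_density (a : EuclideanSpace ℂ (Fin n)) :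
    μ.traceMeasure.withDensity (fun t => ENNReal.ofReal (inner ℂ a (μ.density t a)).re)
      = μ.scalarMeasure a := by
  refine (Measure.ext_of_Ioc _ _ fun x y _ => ?_).symm
  have hb := Metric.isBounded_Ioc x y
  obtain ⟨hi, hv⟩ := μ.setIntegral_density measurableSet_Ioc hb
  let L : (EuclideanSpace ℂ (Fin n) →L[ℂ] EuclideanSpace ℂ (Fin n)) →L[ℝ] ℝ :=
    Complex.reCLM ∘L
      ((innerSL ℂ a).comp (ContinuousLinearMap.apply ℂ _ a)).restrictScalars ℝ
  have hL := L.integral_comp_comm hi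
  rw [hv] at hL
  rw [scalarMeasure_apply _ _ measurableSet_Ioc hb, withDensity_apply _ measurableSet_Ioc]
  change _ = ∫⁻ t in Set.Ioc x y, ENNReal.ofReal (L (μ.density t)) ∂μ.traceMeasure
  rw [← ofReal_integral_eq_lintegral_ofReal (L.integrable_comp hi)
      (ae_of_all _ fun t => μ.density_re_nonneg t a)]
  exact congrArg ENNReal.ofReal hL.symm

lemma integral_scalarMeasure (a : EuclideanSpace ℂ (Fin n)) (φ : ℝ → ℂ) :
    ∫ t, φ t ∂μ.scalarMeasure a
      = ∫ t, inner ℂ a (μ.density t a) * φ t ∂μ.traceMeasure := by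
  rw [← μ.withDensity_density a, integral_withDensity_eq_integral_toReal_smul
    (μ.measurable_re_inner_density a).ennreal_ofReal (ae_of_all _ fun t => ENNReal.ofReal_lt_top)]
  refine integral_congr_ae (ae_of_all _ fun t => ?_)
  simp only
  rw [ENNReal.toReal_ofReal (μ.density_re_nonneg t a), inner_density_self, Complex.real_smul,
    Complex.ofReal_re]

lemma integrable_scalarMeasure_iff (a : EuclideanSpace ℂ (Fin n)) (φ : ℝ → ℝ) :
    Integrable φ (μ.scalarMeasure a) ↔
      Integrable (fun t => (inner ℂ a (μ.density t a)).re * φ t) μ.traceMeasure := by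
  rw [← μ.withDensity_density a, integrable_withDensity_iff_integrable_smul'
    (μ.measurable_re_inner_density a).ennreal_ofReal (ae_of_all _ fun t => ENNReal.ofReal_lt_top)]
  simp only [ENNReal.toReal_ofReal (μ.density_re_nonneg _ a), smul_eq_mul]

end MatrixMeasure

/-! ## Completeness of `L²(μ)` -/

section Regularization

variable {n : ℕ} {D : EuclideanSpace ℂ (Fin n) →L[ℂ] EuclideanSpace ℂ (Fin n)}

lemma mul_norm_le_norm_add_smul (hD : D.IsPositive) (ε : ℝ)
    (x : EuclideanSpace ℂ (Fin n)) : ε * ‖x‖ ≤ ‖(D + (ε : ℂ) • 1) x‖ := by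
  have h1 : (inner ℂ x ((D + (ε : ℂ) • 1) x)).re = (inner ℂ x (D x)).re + ε * ‖x‖ ^ 2 := by
    rw [add_apply, inner_add_right, Complex.add_re, smul_apply, one_apply_eq_self, inner_smul_right,
      Complex.re_ofReal_mul, re_inner_self_eq]
  have h2 := hD.re_inner_nonneg_right x
  have h3 : (inner ℂ x ((D + (ε : ℂ) • 1) x)).re ≤ ‖x‖ * ‖(D + (ε : ℂ) • 1) x‖ :=
    (Complex.re_le_norm _).trans (norm_inner_le_norm _ _)
  change 0 ≤ (inner ℂ x (D x)).re at h2
  rcases (norm_nonneg x).eq_or_lt with h | h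
  · rw [← h, mul_zero]; exact norm_nonneg _
  · refine le_of_mul_le_mul_left ?_ h
    nlinarith

lemma isUnit_add_smul_one (hD : D.IsPositive) {ε : ℝ} (hε : 0 < ε) :
    IsUnit (D + (ε : ℂ) • (1 : EuclideanSpace ℂ (Fin n) →L[ℂ] _)) := by
  have hi : Function.Injective (D + (ε : ℂ) • 1 : EuclideanSpace ℂ (Fin n) →L[ℂ] _).toLinearMap := by
    rw [injective_iff_map_eq_zero]
    intro x hx
    have hx' : (D + (ε : ℂ) • 1) x = 0 := hx
    have := mul_norm_le_norm_add_smul hD ε x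
    rw [hx', norm_zero] at this
    have h2 : ‖x‖ ≤ 0 := le_of_mul_le_mul_left (by rwa [mul_zero]) hε
    exact norm_le_zero_iff.1 h2
  rw [ContinuousLinearMap.isUnit_iff_bijective]
  exact ⟨hi, LinearMap.injective_iff_surjective.1 hi⟩

/-- The regularized solution of `D y = g`. -/
def regularizedInverse (D : EuclideanSpace ℂ (Fin n) →L[ℂ] EuclideanSpace ℂ (Fin n)) (m : ℕ) :
    EuclideanSpace ℂ (Fin n) →L[ℂ] EuclideanSpace ℂ (Fin n) :=
  Ring.inverse (D + (((1 : ℝ) / (m + 1) : ℝ) : ℂ) • 1)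

/-- The matrix `D` may be singular, so a solution of `D y = g` is obtained as a limit of solutions
of `(D + ε) y = g`, a form that keeps measurability in a parameter. Modulo the kernel of `D` one may
take `g = D (D k)`, and then the error is `-ε (k - ε (D + ε)⁻¹ k)`, of norm at most `2 ε ‖k‖`. -/
lemma exists_tendsto_regularizedInverse (hD : D.IsPositive) {g : EuclideanSpace ℂ (Fin n)}
    (hg : g ∈ LinearMap.range D.toLinearMap) :
    ∃ y, Filter.Tendsto (fun m => regularizedInverse D m g) Filter.atTop (nhds y) ∧ D y = g := by
  obtain ⟨h, rfl⟩ := hg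
  have hsa : ContinuousLinearMap.adjoint D = D := hD.isSelfAdjoint
  have hcl : (LinearMap.range D.toLinearMap).topologicalClosure = LinearMap.range D.toLinearMap :=
    (Submodule.closed_of_finiteDimensional _).submodule_topologicalClosure_eq
  have hmem : h ∈ (LinearMap.ker D.toLinearMap) ⊔ (LinearMap.ker D.toLinearMap)ᗮ := by
    rw [Submodule.sup_orthogonal_of_hasOrthogonalProjection]; trivial
  obtain ⟨h₀, hh₀, h₁, hh₁, rfl⟩ := Submodule.mem_sup.1 hmem
  have hr : h₁ ∈ LinearMap.range D.toLinearMap := by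
    have := D.orthogonal_ker
    rw [hsa, hcl] at this
    rw [← this]; exact hh₁
  obtain ⟨k, rfl⟩ := hr
  have hD0 : D h₀ = 0 := hh₀
  refine ⟨D k, ?_, ?_⟩
  · change Filter.Tendsto (fun m => regularizedInverse D m (D (h₀ + D k))) _ _
    rw [map_add, hD0, zero_add, tendsto_iff_norm_sub_tendsto_zero]
    have hb : ∀ m : ℕ, ‖regularizedInverse D m (D (D k)) - D k‖ ≤ 2 * ‖k‖ * ((1 : ℝ) / (m + 1)) := by
      intro m
      have hε : (0 : ℝ) < 1 / (m + 1) := Nat.one_div_pos_of_nat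
      set ε : ℝ := 1 / (m + 1) with hεdef
      set X := regularizedInverse D m with hX
      have hu := isUnit_add_smul_one hD hε
      have e1 : ∀ y, X (D y) = y - (ε : ℂ) • X y := by
        intro y
        have := congrArg (fun B : EuclideanSpace ℂ (Fin n) →L[ℂ] _ => B y)
          (Ring.inverse_mul_cancel _ hu)
        simp only [mul_apply_eq_comp, add_apply, smul_apply, one_apply_eq_self, map_add,
          map_smul] at this
        rw [eq_sub_iff_add_eq]
        exact this
      have e2 : ∀ y, ε * ‖X y‖ ≤ ‖y‖ := by
        intro y
        have := congrArg (fun B : EuclideanSpace ℂ (Fin n) →L[ℂ] _ => B y)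
          (Ring.mul_inverse_cancel _ hu)
        have h3 := mul_norm_le_norm_add_smul hD ε (X y)
        rwa [show (D + (ε : ℂ) • 1) (X y) = y from this] at h3
      rw [e1, sub_sub_cancel_left, norm_neg, norm_smul, Complex.norm_real,
        Real.norm_of_nonneg hε.le, e1]
      have h4 : ‖k - (ε : ℂ) • X k‖ ≤ 2 * ‖k‖ := by
        refine (norm_sub_le _ _).trans ?_
        rw [norm_smul, Complex.norm_real, Real.norm_of_nonneg hε.le]
        linarith [e2 k]
      rw [mul_comm]
      exact mul_le_mul_of_nonneg_right h4 hε.le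
    refine squeeze_zero (fun _ => norm_nonneg _) hb ?_
    have := (tendsto_one_div_add_atTop_nhds_zero_nat (𝕜 := ℝ)).const_mul (2 * ‖k‖)
    rwa [mul_zero] at this
  · change D (D k) = D (h₀ + D k)
    rw [map_add, hD0, zero_add]

/-- Expand `0 ≤ ⟨y, D y⟩` at `y = ‖D‖ x - D x`. It lets the seminorm density `⟨x, D x⟩` control `D
x`. -/
lemma norm_apply_sq_le (hD : D.IsPositive) (x : EuclideanSpace ℂ (Fin n)) :
    ‖D x‖ ^ 2 ≤ ‖D‖ * (inner ℂ x (D x)).re := by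
  have hsym : ∀ u v, inner ℂ (D u) v = inner ℂ u (D v) := hD.isSymmetric
  have h0 : ∀ y, 0 ≤ (inner ℂ y (D y)).re := fun y => hD.re_inner_nonneg_right y
  rcases (norm_nonneg D).eq_or_lt with h | h
  · have : D = 0 := norm_eq_zero.1 h.symm
    simp [this]
  have h1 := h0 ((‖D‖ : ℂ) • x - D x)
  have h2 : (inner ℂ (D x) (D (D x))).re ≤ ‖D‖ * ‖D x‖ ^ 2 := by
    refine (Complex.re_le_norm _).trans ((norm_inner_le_norm _ _).trans ?_)
    have := D.le_opNorm (D x)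
    nlinarith [norm_nonneg (D x)]
  have h3 : (inner ℂ ((‖D‖ : ℂ) • x - D x) (D ((‖D‖ : ℂ) • x - D x))).re
      = ‖D‖ ^ 2 * (inner ℂ x (D x)).re - 2 * ‖D‖ * ‖D x‖ ^ 2 + (inner ℂ (D x) (D (D x))).re := by
    simp only [map_sub, map_smul, inner_sub_left, inner_sub_right, inner_smul_left,
      inner_smul_right, Complex.conj_ofReal, ← hsym x (D x), Complex.sub_re,
      Complex.re_ofReal_mul, re_inner_self_eq]
    ring
  rw [h3] at h1
  refine le_of_mul_le_mul_left ?_ h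
  nlinarith

/-- Lower semicontinuity from `⟨u, D u⟩ ≥ 2 Re ⟨x, D u⟩ - ⟨x, D x⟩`; only the vectors `D (u j)` have
to converge, which is all that is available on the kernel of `D`. -/
lemma re_inner_le_liminf (hD : D.IsPositive) {u : ℕ → EuclideanSpace ℂ (Fin n)}
    {x : EuclideanSpace ℂ (Fin n)}
    (h : Filter.Tendsto (fun j => D (u j)) Filter.atTop (nhds (D x))) :
    ENNReal.ofReal (inner ℂ x (D x)).re
      ≤ Filter.liminf (fun j => ENNReal.ofReal (inner ℂ (u j) (D (u j))).re) Filter.atTop := by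
  have hsym : ∀ u v, inner ℂ (D u) v = inner ℂ u (D v) := hD.isSymmetric
  have h1 : Filter.Tendsto (fun j => ENNReal.ofReal
      (2 * (inner ℂ x (D (u j))).re - (inner ℂ x (D x)).re)) Filter.atTop
      (nhds (ENNReal.ofReal (inner ℂ x (D x)).re)) := by
    have h2 : Filter.Tendsto (fun j => inner ℂ x (D (u j))) Filter.atTop
        (nhds (inner ℂ x (D x))) := tendsto_const_nhds.inner h
    have h3 := ((Complex.continuous_re.tendsto _).comp h2).const_mul 2 |>.sub_const
      (inner ℂ x (D x)).re
    have h4 := (ENNReal.continuous_ofReal.tendsto _).comp h3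
    rw [show 2 * (inner ℂ x (D x)).re - (inner ℂ x (D x)).re = (inner ℂ x (D x)).re by ring] at h4
    exact h4
  rw [← h1.liminf_eq]
  refine Filter.liminf_le_liminf (Filter.Eventually.of_forall fun j => ENNReal.ofReal_le_ofReal ?_)
  have h5 : 0 ≤ (inner ℂ (u j - x) (D (u j - x))).re := hD.re_inner_nonneg_right _
  have h6 : (inner ℂ (u j) (D x)).re = (inner ℂ x (D (u j))).re := by
    rw [← hsym, ← inner_conj_symm, Complex.conj_re]
  simp only [map_sub, inner_sub_left, inner_sub_right, Complex.sub_re, h6] at h5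
  linarith

end Regularization

namespace MatrixMeasure

variable {n : ℕ} (μ : MatrixMeasure n)

lemma aestronglyMeasurable_regularizedInverse {g : ℝ → EuclideanSpace ℂ (Fin n)}
    (hg : AEStronglyMeasurable g μ.traceMeasure) (m : ℕ) :
    AEStronglyMeasurable (fun t => regularizedInverse (μ.density t) m (g t)) μ.traceMeasure := by
  have hD := μ.stronglyMeasurable_density
  have h1 : StronglyMeasurable fun t => regularizedInverse (μ.density t) m := by
    refine ⟨fun k => (hD.approx k).map fun A => regularizedInverse A m, fun t => ?_⟩
    have hc : ContinuousAt (fun A => regularizedInverse A m) (μ.density t) := by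
      have h2 : ContinuousAt Ring.inverse
          (μ.density t + (((1 : ℝ) / (m + 1) : ℝ) : ℂ) • 1) := by
        obtain ⟨v, hv⟩ := isUnit_add_smul_one (μ.density_isPositive t)
          (Nat.one_div_pos_of_nat (α := ℝ) (n := m))
        rw [← hv]
        exact NormedRing.inverse_continuousAt v
      exact ContinuousAt.comp (f := fun A => A + (((1 : ℝ) / (m + 1) : ℝ) : ℂ) • 1) h2
        (by fun_prop)
    exact hc.tendsto.comp (hD.tendsto_approx t)
  exact isBoundedBilinearMap_apply.continuous.comp_aestronglyMeasurable₂
    h1.aestronglyMeasurable hg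

lemma norm_sq_eq_integral (f : μ.L2Fun) :
    ‖f‖ ^ 2 = ∫ t, (inner ℂ (f t) (μ.density t (f t))).re ∂μ.traceMeasure := by
  rw [← inner_self_eq_norm_sq (𝕜 := ℂ), inner_def]
  exact (integral_re (μ.integrable_inner f f)).symm

lemma lintegral_eq_norm_sq (f : μ.L2Fun) :
    ∫⁻ t, ENNReal.ofReal (inner ℂ (f t) (μ.density t (f t))).re ∂μ.traceMeasure
      = ENNReal.ofReal (‖f‖ ^ 2) := by
  rw [norm_sq_eq_integral, ofReal_integral_eq_lintegral_ofReal f.2.2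
    (ae_of_all _ fun t => μ.density_re_nonneg t (f t))]

lemma sub_apply' (f g : μ.L2Fun) (t : ℝ) : (f - g) t = f t - g t := rfl

/-- The energy densities `q k` have integrals at most `16 ^ (-k)`, so `∑ 4 ^ k q k` is integrable
and a.e. finite. Thus `q k ≤ C 4 ^ (-k)` pointwise, and `norm_apply_sq_le` makes the increments `O(2
^ (-k))`. -/
lemma ae_cauchySeq_density {u : ℕ → μ.L2Fun}
    (hu : ∀ k, ‖u (k + 1) - u k‖ ≤ (1 / 4) ^ k) :
    ∀ᵐ t ∂μ.traceMeasure, CauchySeq fun k => μ.density t (u k t) := by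
  set q : ℕ → ℝ → ℝ := fun k t =>
    (inner ℂ ((u (k + 1) - u k) t) (μ.density t ((u (k + 1) - u k) t))).re with hq
  have hqm : ∀ k, AEMeasurable (fun t => ENNReal.ofReal (4 ^ k * q k t)) μ.traceMeasure := fun k =>
    ((u (k + 1) - u k).2.2.aestronglyMeasurable.aemeasurable.const_mul _).ennreal_ofReal
  have hsum : ∫⁻ t, ∑' k, ENNReal.ofReal (4 ^ k * q k t) ∂μ.traceMeasure ≠ ∞ := by
    rw [lintegral_tsum hqm]
    have hle : ∀ k, ∫⁻ t, ENNReal.ofReal (4 ^ k * q k t) ∂μ.traceMeasure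
        ≤ ENNReal.ofReal ((1 / 4) ^ k) := by
      intro k
      have : ∀ t, ENNReal.ofReal (4 ^ k * q k t) = ENNReal.ofReal (4 ^ k) * ENNReal.ofReal (q k t) :=
        fun t => ENNReal.ofReal_mul (by positivity)
      simp only [this]
      rw [lintegral_const_mul' _ _ ENNReal.ofReal_ne_top, lintegral_eq_norm_sq,
        ← ENNReal.ofReal_mul (by positivity)]
      refine ENNReal.ofReal_le_ofReal ?_
      have h1 : ‖u (k + 1) - u k‖ ^ 2 ≤ ((1 / 4) ^ k) ^ 2 :=
        pow_le_pow_left₀ (norm_nonneg _) (hu k) 2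
      calc _ ≤ (4 : ℝ) ^ k * ((1 / 4) ^ k) ^ 2 := by gcongr
        _ = (4 * (1 / 4) * (1 / 4)) ^ k := by rw [mul_pow, mul_pow]; ring
        _ = (1 / 4) ^ k := by norm_num
    refine ne_top_of_le_ne_top ?_ (ENNReal.tsum_le_tsum hle)
    rw [← ENNReal.ofReal_tsum_of_nonneg (fun k => by positivity)
      (summable_geometric_of_lt_one (by norm_num) (by norm_num))]
    exact ENNReal.ofReal_ne_top
  filter_upwards [ae_lt_top' (AEMeasurable.tsum hqm) hsum] with t ht
  obtain ⟨C, hC0, hC⟩ : ∃ C : ℝ, 0 ≤ C ∧ ∀ k, 4 ^ k * q k t ≤ C := by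
    refine ⟨(∑' k, ENNReal.ofReal (4 ^ k * q k t)).toReal, ENNReal.toReal_nonneg, fun k => ?_⟩
    exact (ENNReal.ofReal_le_iff_le_toReal ht.ne).1 (ENNReal.le_tsum k)
  refine cauchySeq_of_le_geometric (1 / 2) (√(‖μ.density t‖ * C)) (by norm_num) fun k => ?_
  rw [dist_eq_norm', ← map_sub, ← sub_apply']
  refine (Real.le_sqrt (norm_nonneg _) (by positivity)).2 ?_ |>.trans_eq
    (?_ : √(‖μ.density t‖ * C * ((1 / 2) ^ k) ^ 2) = _)
  · refine (norm_apply_sq_le (μ.density_isPositive t) _).trans ?_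
    rw [mul_assoc]
    refine mul_le_mul_of_nonneg_left ?_ (norm_nonneg _)
    change q k t ≤ _
    have h4 : (4 : ℝ) ^ k * (((1 / 2) ^ k) ^ 2) = 1 := by
      rw [← pow_mul, mul_comm k 2, pow_mul, ← mul_pow]; norm_num
    calc q k t = (4 ^ k * q k t) * ((1 / 2) ^ k) ^ 2 := by linear_combination (-q k t) * h4
      _ ≤ _ := mul_le_mul_of_nonneg_right (hC k) (by positivity)
  · rw [Real.sqrt_mul (by positivity), Real.sqrt_sq (by positivity)]

/-- A sequence that is Cauchy at a geometric rate converges in the space of square integrable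
functions. -/
lemma exists_tendsto_of_geometric {u : ℕ → μ.L2Fun}
    (hu : ∀ N k m : ℕ, N ≤ k → N ≤ m → dist (u k) (u m) < (1 / 4) ^ N) :
    ∃ f, Filter.Tendsto u Filter.atTop (nhds f) := by
  classical
  have hu' : ∀ k, ‖u (k + 1) - u k‖ ≤ (1 / 4) ^ k := fun k => by
    rw [← dist_eq_norm]; exact (hu k (k + 1) k (Nat.le_succ k) le_rfl).le
  have hc := μ.ae_cauchySeq_density hu'
  -- The limit is taken of `D (u k)` and not of `u k`, whose components in the kernel of the density
  -- are uncontrolled.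
  let g : ℝ → EuclideanSpace ℂ (Fin n) := fun t =>
    if h : ∃ y, Filter.Tendsto (fun k => μ.density t (u k t)) Filter.atTop (nhds y) then h.choose
    else 0
  have hg : ∀ᵐ t ∂μ.traceMeasure,
      Filter.Tendsto (fun k => μ.density t (u k t)) Filter.atTop (nhds (g t)) := by
    filter_upwards [hc] with t ht
    have h := cauchySeq_tendsto_of_complete ht
    simp only [g, dif_pos h]
    exact h.choose_spec
  have hgm : AEStronglyMeasurable g μ.traceMeasure :=
    aestronglyMeasurable_of_tendsto_ae _
      (fun k => μ.aestronglyMeasurable_density_apply (u k).2.1) hg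
  -- Among the solutions of `D f = g`, the limit of the regularized ones is chosen in order to be
  -- measurable.
  let f : ℝ → EuclideanSpace ℂ (Fin n) := fun t =>
    if h : ∃ y, Filter.Tendsto (fun m => regularizedInverse (μ.density t) m (g t)) Filter.atTop
      (nhds y) ∧ μ.density t y = g t then h.choose else 0
  have hf : ∀ᵐ t ∂μ.traceMeasure, Filter.Tendsto
      (fun m => regularizedInverse (μ.density t) m (g t)) Filter.atTop (nhds (f t)) ∧
      μ.density t (f t) = g t := by
    filter_upwards [hg] with t ht
    have hmem : g t ∈ LinearMap.range (μ.density t).toLinearMap :=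
      (Submodule.closed_of_finiteDimensional _).mem_of_tendsto ht
        (Filter.Eventually.of_forall fun k => ⟨u k t, rfl⟩)
    have h := exists_tendsto_regularizedInverse (μ.density_isPositive t) hmem
    simp only [f, dif_pos h]
    exact h.choose_spec
  have hfm : AEStronglyMeasurable f μ.traceMeasure :=
    aestronglyMeasurable_of_tendsto_ae _
      (fun m => μ.aestronglyMeasurable_regularizedInverse hgm m) (hf.mono fun t ht => ht.1)
  -- Fatou's lemma, with the pointwise bound `re_inner_le_liminf`.
  have key : ∀ k, ∫⁻ t, ENNReal.ofReal (inner ℂ (f t - u k t) (μ.density t (f t - u k t))).re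
      ∂μ.traceMeasure ≤ ENNReal.ofReal (((1 / 4) ^ k) ^ 2) := by
    intro k
    calc _ ≤ ∫⁻ t, Filter.liminf (fun j => ENNReal.ofReal
          (inner ℂ ((u j - u k) t) (μ.density t ((u j - u k) t))).re) Filter.atTop
            ∂μ.traceMeasure := by
          refine lintegral_mono_ae ?_
          filter_upwards [hf, hg] with t ht1 ht2
          refine re_inner_le_liminf (μ.density_isPositive t) (u := fun j => (u j - u k) t) ?_
          simp only [sub_apply', map_sub, ht1.2]
          exact ht2.sub_const _
      _ ≤ Filter.liminf (fun j => ∫⁻ t, ENNReal.ofReal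
          (inner ℂ ((u j - u k) t) (μ.density t ((u j - u k) t))).re ∂μ.traceMeasure)
            Filter.atTop :=
          lintegral_liminf_le' fun j =>
            (u j - u k).2.2.aestronglyMeasurable.aemeasurable.ennreal_ofReal
      _ ≤ _ := by
          refine Filter.liminf_le_of_frequently_le' (Filter.Eventually.frequently ?_)
          filter_upwards [Filter.eventually_ge_atTop k] with j hj
          rw [lintegral_eq_norm_sq]
          refine ENNReal.ofReal_le_ofReal (pow_le_pow_left₀ (norm_nonneg _) ?_ 2)
          rw [← dist_eq_norm]
          exact (hu k j k hj le_rfl).le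
  have hmem : ∀ k, (fun t => f t - u k t) ∈ μ.sqIntegrable := by
    intro k
    have hm : AEStronglyMeasurable (fun t => f t - u k t) μ.traceMeasure := hfm.sub (u k).2.1
    refine ⟨hm, Complex.continuous_re.comp_aestronglyMeasurable
      (μ.aestronglyMeasurable_inner hm hm), ?_⟩
    rw [hasFiniteIntegral_iff_ofReal (ae_of_all _ fun t => μ.density_re_nonneg t _)]
    exact (key k).trans_lt ENNReal.ofReal_lt_top
  let d : ℕ → μ.L2Fun := fun k => ⟨_, hmem k⟩
  -- Fatou yields square integrability of the differences `f - u k` only; `f` is recovered as `(f -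
  -- u 0) + u 0`.
  refine ⟨d 0 + u 0, ?_⟩
  have hd : ∀ k, d 0 + u 0 = d k + u k := fun k => by
    refine Subtype.ext (funext fun t => ?_)
    change f t - u 0 t + u 0 t = f t - u k t + u k t
    rw [sub_add_cancel, sub_add_cancel]
  rw [tendsto_iff_norm_sub_tendsto_zero]
  have hn : ∀ k, ‖u k - (d 0 + u 0)‖ ≤ (1 / 4) ^ k := fun k => by
    rw [hd k, sub_add_cancel_right, norm_neg, ← sq_le_sq₀ (norm_nonneg _) (by positivity),
      ← ENNReal.ofReal_le_ofReal_iff (by positivity), ← lintegral_eq_norm_sq]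
    exact key k
  exact squeeze_zero (fun _ => norm_nonneg _) hn
    (tendsto_pow_atTop_nhds_zero_of_lt_one (by norm_num) (by norm_num))

instance : CompleteSpace μ.L2Fun :=
  Metric.complete_of_convergent_controlled_sequences (fun N => (1 / 4) ^ N) (fun N => by positivity)
    fun _ hu => μ.exists_tendsto_of_geometric hu

end MatrixMeasure

/-! ## Injectivity of the Cauchy transform -/

section CauchyTransform

lemma ofReal_sub_ne_zero {w : ℂ} (hw : w.im ≠ 0) (t : ℝ) : (t : ℂ) - w ≠ 0 := by
  intro h
  apply hw
  rw [← sub_eq_zero.1 h, Complex.ofReal_im]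

lemma abs_im_le_norm_ofReal_sub (w : ℂ) (t : ℝ) : |w.im| ≤ ‖(t : ℂ) - w‖ := by
  have := Complex.abs_im_le_norm ((t : ℂ) - w)
  rwa [Complex.sub_im, Complex.ofReal_im, zero_sub, abs_neg] at this

lemma norm_inv_ofReal_sub_le {w : ℂ} (hw : w.im ≠ 0) (t : ℝ) :
    ‖((t : ℂ) - w)⁻¹‖ ≤ |w.im|⁻¹ := by
  rw [norm_inv]
  exact inv_anti₀ (abs_pos.2 hw) (abs_im_le_norm_ofReal_sub w t)

lemma continuous_inv_ofReal_sub {w : ℂ} (hw : w.im ≠ 0) :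
    Continuous fun t : ℝ => ((t : ℂ) - w)⁻¹ :=
  Continuous.inv₀ (by fun_prop) (ofReal_sub_ne_zero hw)

lemma integrable_inv_mul {τ : Measure ℝ} {k : ℝ → ℂ} (hk : Integrable k τ) {w : ℂ}
    (hw : w.im ≠ 0) : Integrable (fun t : ℝ => ((t : ℂ) - w)⁻¹ * k t) τ :=
  hk.bdd_mul (continuous_inv_ofReal_sub hw).aestronglyMeasurable
    (ae_of_all _ (norm_inv_ofReal_sub_le hw))

lemma continuousAt_cauchyTransform {τ : Measure ℝ} {k : ℝ → ℂ} (hk : Integrable k τ) {w : ℂ}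
    (hw : w.im ≠ 0) : ContinuousAt (fun w : ℂ => ∫ t : ℝ, ((t : ℂ) - w)⁻¹ * k t ∂τ) w := by
  have h2 : ∀ᶠ z : ℂ in nhds w, |w.im| / 2 < |z.im| :=
    (Complex.continuous_im.abs.tendsto w).eventually (lt_mem_nhds (by
      have := abs_pos.2 hw
      linarith))
  have hpos : 0 < |w.im| / 2 := by have := abs_pos.2 hw; positivity
  refine continuousAt_of_dominated (bound := fun t => (|w.im| / 2)⁻¹ * ‖k t‖) ?_ ?_
    (hk.norm.const_mul _) (ae_of_all _ fun t => ?_)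
  · filter_upwards [isOpen_im_ne_zero.mem_nhds hw] with z hz
    exact (integrable_inv_mul hk hz).aestronglyMeasurable
  · filter_upwards [isOpen_im_ne_zero.mem_nhds hw, h2] with z hz hz2
    refine ae_of_all _ fun t => ?_
    rw [norm_mul]
    refine mul_le_mul_of_nonneg_right ((norm_inv_ofReal_sub_le hz t).trans ?_) (norm_nonneg _)
    exact inv_anti₀ hpos hz2.le
  · exact ((continuousAt_const.sub continuousAt_id).inv₀ (ofReal_sub_ne_zero hw t)).mul
      continuousAt_const

/-- The extension of `t ↦ (t - w)⁻¹` to the one-point compactification of the line. -/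
def onePointInv (w : ℂ) (hw : w.im ≠ 0) : C(OnePoint ℝ, ℂ) :=
  OnePoint.continuousMapMk ⟨fun t : ℝ => ((t : ℂ) - w)⁻¹, continuous_inv_ofReal_sub hw⟩ 0 (by
    have h1 : Filter.Tendsto (fun t : ℝ => (t : ℂ) - w) (Filter.cocompact ℝ)
        (Filter.cocompact ℂ) :=
      (Homeomorph.subRight w).isClosedEmbedding.tendsto_cocompact.comp
        Complex.isometry_ofReal.isClosedEmbedding.tendsto_cocompact
    rw [Filter.coclosedCompact_eq_cocompact]
    rw [← Metric.cobounded_eq_cocompact (α := ℂ)] at h1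
    exact Filter.tendsto_inv₀_cobounded.comp h1)

lemma onePointInv_coe (w : ℂ) (hw : w.im ≠ 0) (t : ℝ) :
    onePointInv w hw (t : OnePoint ℝ) = ((t : ℂ) - w)⁻¹ := rfl

lemma onePointInv_infty (w : ℂ) (hw : w.im ≠ 0) : onePointInv w hw OnePoint.infty = 0 := rfl

lemma continuous_integral_mul {τ : Measure ℝ} {k : ℝ → ℂ} (hk : Integrable k τ) :
    Continuous fun F : C(OnePoint ℝ, ℂ) => ∫ t : ℝ, F t * k t ∂τ := by
  have hi : ∀ F : C(OnePoint ℝ, ℂ), AEStronglyMeasurable (fun t : ℝ => F t * k t) τ := fun F =>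
    ((F.continuous.comp OnePoint.continuous_coe).aestronglyMeasurable).mul hk.aestronglyMeasurable
  rw [continuous_iff_continuousAt]
  intro F₀
  refine continuousAt_of_dominated (bound := fun t => (‖F₀‖ + 1) * ‖k t‖)
    (Filter.Eventually.of_forall hi) ?_ (hk.norm.const_mul _) (ae_of_all _ fun t => ?_)
  · have h : ∀ᶠ F : C(OnePoint ℝ, ℂ) in nhds F₀, ‖F‖ < ‖F₀‖ + 1 :=
      (continuous_norm.tendsto F₀).eventually (gt_mem_nhds (by linarith))
    filter_upwards [h] with F hF
    refine ae_of_all _ fun t => ?_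
    rw [norm_mul]
    exact mul_le_mul_of_nonneg_right ((F.norm_coe_le_norm _).trans hF.le) (norm_nonneg _)
  · exact ((continuous_eval_const (t : OnePoint ℝ)).mul
      continuous_const).continuousAt

lemma integrable_continuousMap_mul {τ : Measure ℝ} {k : ℝ → ℂ} (hk : Integrable k τ)
    (F : C(OnePoint ℝ, ℂ)) : Integrable (fun t : ℝ => F t * k t) τ :=
  hk.bdd_mul (F.continuous.comp OnePoint.continuous_coe).aestronglyMeasurable
    (ae_of_all _ fun t => F.norm_coe_le_norm t)

/-- The continuous functions `F` such that the Cauchy transform of `F h` vanishes. -/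
def cauchyAnnihilator (τ : Measure ℝ) (h : ℝ → ℂ)
    (hi : ∀ w : ℂ, w.im ≠ 0 → Integrable (fun t : ℝ => ((t : ℂ) - w)⁻¹ * h t) τ) :
    Submodule ℂ C(OnePoint ℝ, ℂ) where
  carrier := {F | ∀ w : ℂ, w.im ≠ 0 → ∫ t : ℝ, F t * (((t : ℂ) - w)⁻¹ * h t) ∂τ = 0}
  zero_mem' w hw := by simp
  add_mem' {F G} hF hG w hw := by
    have := integral_add (integrable_continuousMap_mul (hi w hw) F)
      (integrable_continuousMap_mul (hi w hw) G)
    rw [hF w hw, hG w hw, add_zero] at this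
    rw [← this]
    exact integral_congr_ae (ae_of_all _ fun t => add_mul _ _ _)
  smul_mem' c F hF w hw := by
    have := integral_const_mul (μ := τ) c fun t : ℝ => F t * (((t : ℂ) - w)⁻¹ * h t)
    rw [hF w hw, mul_zero] at this
    rw [← this]
    exact integral_congr_ae (ae_of_all _ fun t => mul_assoc _ _ _)

variable {τ : Measure ℝ} {h : ℝ → ℂ}
  (hi : ∀ w : ℂ, w.im ≠ 0 → Integrable (fun t : ℝ => ((t : ℂ) - w)⁻¹ * h t) τ)

lemma isClosed_cauchyAnnihilator : IsClosed (cauchyAnnihilator τ h hi : Set C(OnePoint ℝ, ℂ)) := by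
  have : (cauchyAnnihilator τ h hi : Set C(OnePoint ℝ, ℂ)) = ⋂ w : ℂ, ⋂ _ : w.im ≠ 0,
      {F | ∫ t : ℝ, F t * (((t : ℂ) - w)⁻¹ * h t) ∂τ = 0} := by
    ext F
    simp only [Set.mem_iInter]
    exact Iff.rfl
  rw [this]
  exact isClosed_iInter fun w => isClosed_iInter fun hw =>
    isClosed_eq (continuous_integral_mul (hi w hw)) continuous_const

/-- By partial fractions the product `(t - w)⁻¹ (t - z)⁻¹` is a combination of the two factors, each
already annihilated. The case `w = z` follows by continuity of the Cauchy transform. -/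
lemma onePointInv_mul_mem {z : ℂ} (hz : z.im ≠ 0) {F : C(OnePoint ℝ, ℂ)}
    (hF : F ∈ cauchyAnnihilator τ h hi) : onePointInv z hz * F ∈ cauchyAnnihilator τ h hi := by
  have hne : ∀ w : ℂ, w.im ≠ 0 → w ≠ z →
      ∫ t : ℝ, ((t : ℂ) - w)⁻¹ * (F t * (((t : ℂ) - z)⁻¹ * h t)) ∂τ = 0 := by
    intro w hw hwz
    have e : ∀ t : ℝ, ((t : ℂ) - w)⁻¹ * (F t * (((t : ℂ) - z)⁻¹ * h t))
        = (z - w)⁻¹ * (F t * (((t : ℂ) - z)⁻¹ * h t) - F t * (((t : ℂ) - w)⁻¹ * h t)) := by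
      intro t
      have h1 := ofReal_sub_ne_zero hw t
      have h2 := ofReal_sub_ne_zero hz t
      have h3 : z - w ≠ 0 := sub_ne_zero.2 hwz.symm
      field_simp
      ring
    simp only [e]
    rw [integral_const_mul, integral_sub (integrable_continuousMap_mul (hi z hz) F)
      (integrable_continuousMap_mul (hi w hw) F), hF z hz, hF w hw, sub_zero, mul_zero]
  intro w hw
  have e2 : ∀ t : ℝ, (onePointInv z hz * F) t * (((t : ℂ) - w)⁻¹ * h t)
      = ((t : ℂ) - w)⁻¹ * (F t * (((t : ℂ) - z)⁻¹ * h t)) := by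
    intro t
    rw [ContinuousMap.mul_apply, onePointInv_coe]
    ring
  simp only [e2]
  by_cases hwz : w = z
  · subst hwz
    have hc := continuousAt_cauchyTransform (integrable_continuousMap_mul (hi w hw) F) hw
    refine tendsto_nhds_unique (hc.tendsto.mono_left (nhdsWithin_le_nhds (s := {w}ᶜ)))
      (tendsto_const_nhds.congr' ?_)
    filter_upwards [nhdsWithin_le_nhds (isOpen_im_ne_zero.mem_nhds hw), self_mem_nhdsWithin]
      with z hz hzne using (hne z hz hzne).symm
  · exact hne w hw hwz

/-- The multipliers of `cauchyAnnihilator`. -/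
def cauchyMultipliers : Subalgebra ℂ C(OnePoint ℝ, ℂ) where
  carrier := {G | ∀ F ∈ cauchyAnnihilator τ h hi, G * F ∈ cauchyAnnihilator τ h hi}
  mul_mem' {a b} ha hb F hF := by rw [mul_assoc]; exact ha _ (hb F hF)
  add_mem' {a b} ha hb F hF := by rw [add_mul]; exact add_mem (ha F hF) (hb F hF)
  algebraMap_mem' c F hF := by
    rw [Algebra.algebraMap_eq_smul_one, smul_mul_assoc, one_mul]
    exact (cauchyAnnihilator τ h hi).smul_mem c hF

/-- Stone–Weierstrass on the compactified line: the function `(t - i)⁻¹`, which vanishes only at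
infinity, separates points. It and its conjugate `(t + i)⁻¹` are multipliers of the annihilator,
which is closed and contains `1`. -/
lemma cauchyAnnihilator_eq_top
    (h0 : ∀ w : ℂ, w.im ≠ 0 → ∫ t : ℝ, ((t : ℂ) - w)⁻¹ * h t ∂τ = 0) :
    cauchyAnnihilator τ h hi = ⊤ := by
  have hI : Complex.I.im ≠ 0 := by simp
  have hI' : (-Complex.I).im ≠ 0 := by simp
  have h1 : (1 : C(OnePoint ℝ, ℂ)) ∈ cauchyAnnihilator τ h hi := fun w hw => by
    simpa using h0 w hw
  let A : StarSubalgebra ℂ C(OnePoint ℝ, ℂ) := StarAlgebra.adjoin ℂ {onePointInv Complex.I hI}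
  have hstar : star (onePointInv Complex.I hI) = onePointInv (-Complex.I) hI' := by
    ext x
    induction x using OnePoint.rec with
    | infty => simp [onePointInv_infty]
    | coe t => simp [onePointInv_coe]
  have hA : A.toSubalgebra ≤ cauchyMultipliers hi := by
    rw [StarAlgebra.adjoin_toSubalgebra, Algebra.adjoin_le_iff]
    rintro G (hG | hG)
    · rw [Set.mem_singleton_iff.1 hG]
      exact fun F hF => onePointInv_mul_mem hi hI hF
    · rw [Set.mem_star, Set.mem_singleton_iff, ← star_inj, star_star, hstar] at hG
      rw [hG]
      exact fun F hF => onePointInv_mul_mem hi hI' hF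
  have hsep : A.SeparatesPoints := by
    intro x y hxy
    refine ⟨_, ⟨onePointInv Complex.I hI, StarAlgebra.self_mem_adjoin_singleton ℂ _, rfl⟩, ?_⟩
    have hinv : ∀ t : ℝ, ((t : ℂ) - Complex.I)⁻¹ ≠ 0 := fun t =>
      inv_ne_zero (ofReal_sub_ne_zero hI t)
    induction x using OnePoint.rec with
    | infty =>
      induction y using OnePoint.rec with
      | infty => exact absurd rfl hxy
      | coe t => exact (hinv t).symm
    | coe s =>
      induction y using OnePoint.rec with
      | infty => exact hinv s
      | coe t =>
        intro he
        apply hxy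
        have h3 : ((s : ℂ) - Complex.I)⁻¹ = ((t : ℂ) - Complex.I)⁻¹ := he
        have h4 := inv_injective h3
        have h5 : (s : ℂ) = t := by linear_combination h4
        rw [Complex.ofReal_injective h5]
  have htop := ContinuousMap.starSubalgebra_topologicalClosure_eq_top_of_separatesPoints A hsep
  rw [eq_top_iff]
  intro G _
  have hG : G ∈ A.topologicalClosure := htop ▸ StarSubalgebra.mem_top
  refine closure_minimal (fun G hG => ?_) (isClosed_cauchyAnnihilator hi) hG
  have := hA hG 1 h1
  rwa [mul_one] at this

include hi in
/-- The Cauchy transform is injective. -/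
theorem ae_eq_zero_of_cauchyTransform_eq_zero
    (h0 : ∀ w : ℂ, w.im ≠ 0 → ∫ t : ℝ, ((t : ℂ) - w)⁻¹ * h t ∂τ = 0) : ∀ᵐ t ∂τ, h t = 0 := by
  have hI : Complex.I.im ≠ 0 := by simp
  -- `h` need not be integrable; the test functions, extended by `0` at infinity, are integrated
  -- against `(t - i)⁻¹ h` instead.
  have key := ae_eq_zero_of_integral_contDiff_smul_eq_zero (hi Complex.I hI).locallyIntegrable
    fun g hg hc => by
      let G : C(OnePoint ℝ, ℂ) := OnePoint.continuousMapMk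
        ⟨fun t : ℝ => (g t : ℂ), Complex.continuous_ofReal.comp hg.continuous⟩ 0 (by
          have h1 := hc.is_zero_at_infty
          have h2 := (Complex.continuous_ofReal.tendsto 0).comp h1
          rw [Complex.ofReal_zero] at h2
          rw [Filter.coclosedCompact_eq_cocompact]
          exact h2)
      have hG : G ∈ cauchyAnnihilator τ h hi := cauchyAnnihilator_eq_top hi h0 ▸ Submodule.mem_top
      have := hG Complex.I hI
      refine Eq.trans (integral_congr_ae (ae_of_all _ fun t => ?_)) this
      exact Complex.real_smul
  filter_upwards [key] with t ht
  exact (mul_eq_zero.1 ht).resolve_left (inv_ne_zero (ofReal_sub_ne_zero hI t))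

end CauchyTransform

/-! ## Cauchy kernels in `L²(μ)` -/

/-- Write `t + i = (t - w) + (w + i)` and use `|t - w| ≥ |Im w|`. Hence the growth condition on `μ`
puts every Cauchy kernel into `L²(μ)`. -/
lemma one_add_sq_le {w : ℂ} (hw : w.im ≠ 0) (t : ℝ) :
    1 + t ^ 2 ≤ ((1 + ‖w + Complex.I‖ / |w.im|) * ‖(t : ℂ) - w‖) ^ 2 := by
  have h1 : 1 + t ^ 2 = ‖(t : ℂ) + Complex.I‖ ^ 2 := by
    rw [← Complex.normSq_eq_norm_sq, Complex.normSq_apply]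
    simp
    ring
  rw [h1]
  refine pow_le_pow_left₀ (norm_nonneg _) ?_ 2
  have h2 : (t : ℂ) + Complex.I = ((t : ℂ) - w) + (w + Complex.I) := by ring
  have h3 := abs_pos.2 hw
  rw [h2, add_mul, one_mul]
  refine (norm_add_le _ _).trans (add_le_add le_rfl ?_)
  rw [div_mul_eq_mul_div, le_div_iff₀ h3]
  exact mul_le_mul_of_nonneg_left (abs_im_le_norm_ofReal_sub w t) (norm_nonneg _)

namespace MatrixMeasure

variable {n : ℕ} {μ : MatrixMeasure n}

lemma smul_mem_sqIntegrable (f : μ.L2Fun) {φ : ℝ → ℂ} (hφ : Continuous φ) {c : ℝ}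
    (hc : ∀ t, ‖φ t‖ ≤ c) : (fun t => φ t • f t) ∈ μ.sqIntegrable := by
  have hm : AEStronglyMeasurable (fun t => φ t • f t) μ.traceMeasure :=
    hφ.aestronglyMeasurable.smul f.2.1
  refine ⟨hm, Integrable.mono' (f.2.2.const_mul (c ^ 2))
    (Complex.continuous_re.comp_aestronglyMeasurable (μ.aestronglyMeasurable_inner hm hm))
    (ae_of_all _ fun t => ?_)⟩
  rw [Real.norm_of_nonneg (μ.density_re_nonneg t _), map_smul, inner_smul_left, inner_smul_right,
    ← mul_assoc, Complex.conj_mul', ← Complex.ofReal_pow, Complex.re_ofReal_mul]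
  exact mul_le_mul_of_nonneg_right (pow_le_pow_left₀ (norm_nonneg _) (hc t) 2)
    (μ.density_re_nonneg t (f t))

lemma inner_toL2 (f g : μ.L2Fun) : inner ℂ (μ.toL2 f) (μ.toL2 g) = inner ℂ f g := rfl

lemma toL2_surjective : Function.Surjective μ.toL2 := SeparationQuotient.surjective_mk

variable (hμ : ∀ a, ∫⁻ t : ℝ, ENNReal.ofReal (1 / (1 + t ^ 2)) ∂(μ.scalarMeasure a) < ∞)

include hμ in
lemma integrable_norm_inv_sq {w : ℂ} (hw : w.im ≠ 0) (a : EuclideanSpace ℂ (Fin n)) :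
    Integrable (fun t : ℝ => ‖((t : ℂ) - w)⁻¹‖ ^ 2) (μ.scalarMeasure a) := by
  have hpos : ∀ t : ℝ, 0 < 1 + t ^ 2 := fun t => by positivity
  have h1 : Integrable (fun t : ℝ => 1 / (1 + t ^ 2)) (μ.scalarMeasure a) := by
    refine ⟨(Continuous.div continuous_const (by fun_prop) fun t =>
      (hpos t).ne').aestronglyMeasurable, ?_⟩
    rw [hasFiniteIntegral_iff_ofReal (ae_of_all _ fun t => (one_div_pos.2 (hpos t)).le)]
    exact hμ a
  refine (h1.const_mul ((1 + ‖w + Complex.I‖ / |w.im|) ^ 2)).mono'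
    ((continuous_inv_ofReal_sub hw).norm.pow 2).aestronglyMeasurable (ae_of_all _ fun t => ?_)
  have h2 := norm_pos_iff.2 (ofReal_sub_ne_zero hw t)
  have h3 := one_add_sq_le hw t
  rw [Real.norm_of_nonneg (by positivity), norm_inv, inv_pow, mul_one_div, ← one_div,
    div_le_div_iff₀ (by positivity) (hpos t), one_mul, ← mul_pow]
  exact h3

/-- The function `t ↦ (t - w̄)⁻¹ a` as an element of `L²(μ)` (by convention `0` for real `w`). -/
def cauchyVec (w : ℂ) : EuclideanSpace ℂ (Fin n) →ₗ[ℂ] μ.L2Fun :=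
  if hw : w.im ≠ 0 then
    { toFun := fun a => (⟨fun t => ((t : ℂ) - conj w)⁻¹ • a, by
        have hw' : (conj w).im ≠ 0 := by rwa [Complex.conj_im, neg_ne_zero]
        have h := (μ.integrable_scalarMeasure_iff a _).1 (integrable_norm_inv_sq hμ hw' a)
        refine ⟨((continuous_inv_ofReal_sub hw').smul continuous_const).aestronglyMeasurable,
          h.congr (ae_of_all _ fun t => ?_)⟩
        dsimp only
        rw [map_smul, inner_smul_left, inner_smul_right, ← mul_assoc, Complex.conj_mul',
          ← Complex.ofReal_pow, Complex.re_ofReal_mul, mul_comm]⟩ : μ.sqIntegrable)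
      map_add' := fun a b => Subtype.ext (funext fun t => smul_add _ _ _)
      map_smul' := fun c a => Subtype.ext (funext fun t => smul_comm _ _ _) }
  else 0

lemma cauchyVec_apply {w : ℂ} (hw : w.im ≠ 0) (a : EuclideanSpace ℂ (Fin n)) (t : ℝ) :
    cauchyVec hμ w a t = ((t : ℂ) - conj w)⁻¹ • a := by
  rw [cauchyVec, dif_pos hw]
  rfl

lemma inner_cauchyVec_apply {w : ℂ} (hw : w.im ≠ 0) (a x : EuclideanSpace ℂ (Fin n)) (t : ℝ) :
    inner ℂ (cauchyVec hμ w a t) x = ((t : ℂ) - w)⁻¹ * inner ℂ a x := by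
  rw [cauchyVec_apply hμ hw, inner_smul_left, map_inv₀, map_sub, Complex.conj_ofReal,
    Complex.conj_conj]

include hμ in
lemma integrable_inv_mul_inner {w : ℂ} (hw : w.im ≠ 0) (a : EuclideanSpace ℂ (Fin n))
    (f : μ.L2Fun) :
    Integrable (fun t : ℝ => ((t : ℂ) - w)⁻¹ * inner ℂ a (μ.density t (f t))) μ.traceMeasure :=
  (μ.integrable_inner (cauchyVec hμ w a) f).congr
    (ae_of_all _ fun t => inner_cauchyVec_apply hμ hw a _ t)

include hμ in
lemma integrable_density_inv_smul {w : ℂ} (hw : w.im ≠ 0) (f : μ.L2Fun) :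
    Integrable (fun t : ℝ => μ.density t (((t : ℂ) - w)⁻¹ • f t)) μ.traceMeasure := by
  have e := EuclideanSpace.basisFun (Fin n) ℂ
  have h := integrable_finsetSum Finset.univ fun j _ =>
    (integrable_inv_mul_inner hμ hw (e j) f).smul_const (e j)
  refine h.congr (ae_of_all _ fun t => ?_)
  dsimp only
  rw [map_smul, ← e.sum_repr' (((t : ℂ) - w)⁻¹ • μ.density t (f t))]
  exact Finset.sum_congr rfl fun j _ => by rw [inner_smul_right]

/-- Pairing with a Cauchy kernel evaluates the Cauchy transform; the conjugate in `cauchyVec` makes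
the evaluation point `w` itself. -/
lemma inner_cauchyVec {w : ℂ} (hw : w.im ≠ 0) (a : EuclideanSpace ℂ (Fin n)) (f : μ.L2Fun) :
    inner ℂ (cauchyVec hμ w a) f
      = inner ℂ a (μ.integral fun t => ((t : ℂ) - w)⁻¹ • f t) := by
  rw [integral, ← integral_inner (integrable_density_inv_smul hμ hw f), inner_def]
  refine integral_congr_ae (ae_of_all _ fun t => ?_)
  dsimp only
  rw [inner_cauchyVec_apply hμ hw, map_smul, inner_smul_right]

/-- The Cauchy kernels are total in `L²(μ)`. -/
theorem eq_zero_of_inner_cauchyVec_eq_zero (y : μ.L2)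
    (h : ∀ w : ℂ, w.im ≠ 0 → ∀ a, inner ℂ (μ.toL2 (cauchyVec hμ w a)) y = 0) : y = 0 := by
  obtain ⟨f, rfl⟩ := toL2_surjective y
  have hae : ∀ a, ∀ᵐ t ∂μ.traceMeasure, inner ℂ a (μ.density t (f t)) = 0 := by
    intro a
    refine ae_eq_zero_of_cauchyTransform_eq_zero
      (fun w hw => integrable_inv_mul_inner hμ hw a f) fun w hw => ?_
    refine Eq.trans (integral_congr_ae (ae_of_all _ fun t => ?_)) (h w hw a)
    exact (inner_cauchyVec_apply hμ hw a _ t).symm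
  rw [toL2_eq_zero_iff]
  have e := EuclideanSpace.basisFun (Fin n) ℂ
  filter_upwards [ae_all_iff.2 fun j => hae (e j)] with t ht
  -- Only `D f` vanishes, not `f`; this is what it means for the class of `f` in `L²(μ)` to be zero.
  have h0 : μ.density t (f t) = 0 := by
    rw [← e.sum_repr' (μ.density t (f t))]
    exact Finset.sum_eq_zero fun j _ => by rw [ht j, zero_smul]
  rw [h0, inner_zero_right]
  rfl

lemma norm_ofReal_mul_inv_le (t : ℝ) : ‖(t : ℂ) * ((t : ℂ) - -Complex.I)⁻¹‖ ≤ 1 := by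
  have hI : (-Complex.I).im ≠ 0 := by simp
  rw [norm_mul, norm_inv]
  refine mul_inv_le_one_of_le₀ ?_ (norm_nonneg _)
  have := Complex.abs_re_le_norm ((t : ℂ) - -Complex.I)
  simpa using this

/-- The graph of `M_μ` is determined by the Cauchy kernels. -/
theorem mem_mulGraph_iff
    (h : ∀ y : μ.L2, (∀ w : ℂ, w.im ≠ 0 → w ≠ -Complex.I →
      ∀ a, inner ℂ (μ.toL2 (cauchyVec hμ w a)) y = 0) → y = 0) (p : μ.L2 × μ.L2) :
    p ∈ μ.mulGraph ↔ ∀ w : ℂ, w.im ≠ 0 →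
      ∀ a, inner ℂ (μ.toL2 (cauchyVec hμ w a)) (p.2 - w • p.1) = 0 := by
  refine graph_mem_iff_of_total μ.mulGraph (fun w a => μ.toL2 (cauchyVec hμ w a)) ?_ ?_ h p
  · rintro _ ⟨f, g, rfl, hg, -, h0⟩ w hw a
    change inner ℂ (μ.toL2 (cauchyVec hμ w a)) (μ.toL2 g - w • μ.toL2 f) = 0
    rw [← map_smul, ← map_sub, inner_toL2, inner_cauchyVec hμ hw]
    -- The Cauchy kernel cancels the factor `t - w`, so the pairing is `⟨a, ∫ dμ f⟩`, and the domain
    -- condition says that it vanishes.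
    have : (fun t : ℝ => ((t : ℂ) - w)⁻¹ • (g - w • f) t) = f := by
      funext t
      change ((t : ℂ) - w)⁻¹ • (g t - w • f t) = f t
      rw [hg, ← sub_smul, smul_smul, inv_mul_cancel₀ (ofReal_sub_ne_zero hw t), one_smul]
    rw [this, h0, inner_zero_right]
  · intro u hu
    obtain ⟨u, rfl⟩ := toL2_surjective u
    have hI : (-Complex.I).im ≠ 0 := by simp
    -- The solution of `(x + i) f = u` is `u / (t + i)`. Its membership in the domain, `∫ dμ f = 0`,
    -- is the hypothesis that `u` is orthogonal to the Cauchy kernels at `-i`.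
    let f : μ.L2Fun := (⟨_, smul_mem_sqIntegrable u (continuous_inv_ofReal_sub hI)
      (norm_inv_ofReal_sub_le hI)⟩ : μ.sqIntegrable)
    let g : μ.L2Fun := (⟨_, smul_mem_sqIntegrable u
      (Complex.continuous_ofReal.mul (continuous_inv_ofReal_sub hI))
      norm_ofReal_mul_inv_le⟩ : μ.sqIntegrable)
    refine ⟨(μ.toL2 f, μ.toL2 g), ⟨f, g, rfl, fun t => mul_smul _ _ _,
      integrable_density_inv_smul hμ hI u, ?_⟩, ?_⟩
    · refine ext_inner_left ℂ fun a => ?_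
      rw [inner_zero_right]
      exact (inner_cauchyVec hμ hI a u).symm.trans (hu a)
    · change μ.toL2 g + Complex.I • μ.toL2 f = μ.toL2 u
      rw [← map_smul, ← map_add]
      congr 1
      refine Subtype.ext (funext fun t => ?_)
      change ((t : ℂ) * ((t : ℂ) - -Complex.I)⁻¹) • u t
        + Complex.I • ((t : ℂ) - -Complex.I)⁻¹ • u t = u t
      rw [smul_smul, ← add_smul, ← add_mul, ← sub_neg_eq_add (t : ℂ) Complex.I,
        mul_inv_cancel₀ (ofReal_sub_ne_zero hI t), one_smul]

end MatrixMeasure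

/-! ## The measure of a Cayley extension -/

section CayleyMeasure

variable {n : ℕ} {H : Type*} [NormedAddCommGroup H] [InnerProductSpace ℂ H] [CompleteSpace H]
  {W : H →L[ℂ] H}

/-- For continuous `F` the integrals are the quadratic form of `U* F(W) U`, and the relation extends
to Borel sets. This is done on the spectrum of `W`, since the map to the line is merely measurable.
-/
lemma polDefect_lineMeasure (hN : IsStarNormal W) (U : EuclideanSpace ℂ (Fin n) →L[ℂ] H)
    (a : EuclideanSpace ℂ (Fin n)) {S : Set ℝ} (hS : MeasurableSet S) :
    MatrixMeasure.polDefect a (fun b => (lineMeasure hN (U b)).real S) = 0 := by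
  have h : ∀ b, (lineMeasure hN (U b)).real S
      = (spectralMeasure hN (U b)).real ((fun u : spectrum ℂ W => inverseCayley u) ⁻¹' S) :=
    fun b => map_measureReal_apply measurable_inverseCayley_coe hS
  simp only [h]
  refine apply_measureReal_eq_zero (ν := fun b => spectralMeasure hN (U b)) _ (fun F => ?_)
    (measurable_inverseCayley_coe hS)
  refine MatrixMeasure.polDefect_eq_zero (B := (ContinuousLinearMap.adjoint U).comp
    ((cfcHom hN (ofRealMap F.toContinuousMap)).comp U)) (fun b => ?_) a
  rw [ContinuousLinearMap.comp_apply, ContinuousLinearMap.adjoint_inner_right]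
  exact inner_cfcHom_ofRealMap hN (U b) F.toContinuousMap

/-- The matrix measure `π (1 + t²) U* dE(t) U`, where `E` is the spectral measure on the line of the
inverse Cayley transform of `W`. -/
def cayleyMeasure (hN : IsStarNormal W) (U : EuclideanSpace ℂ (Fin n) →L[ℂ] H) :
    MatrixMeasure n :=
  MatrixMeasure.ofFamily (fun a => lineMeasure hN (U a)) (fun t => Real.pi * (1 + t ^ 2))
    (fun a _ hS => polDefect_lineMeasure hN U a hS) (by fun_prop) (fun t => by positivity)

lemma scalarMeasure_cayleyMeasure (hN : IsStarNormal W) (U : EuclideanSpace ℂ (Fin n) →L[ℂ] H)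
    (a : EuclideanSpace ℂ (Fin n)) : (cayleyMeasure hN U).scalarMeasure a
      = (lineMeasure hN (U a)).withDensity fun t => ENNReal.ofReal (Real.pi * (1 + t ^ 2)) :=
  MatrixMeasure.scalarMeasure_ofFamily _ _ _ _ _ a

lemma lintegral_cayleyMeasure_lt_top (hN : IsStarNormal W)
    (U : EuclideanSpace ℂ (Fin n) →L[ℂ] H) (a : EuclideanSpace ℂ (Fin n)) :
    ∫⁻ t : ℝ, ENNReal.ofReal (1 / (1 + t ^ 2)) ∂((cayleyMeasure hN U).scalarMeasure a) < ∞ := by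
  rw [scalarMeasure_cayleyMeasure, lintegral_withDensity_eq_lintegral_mul _ (by fun_prop)
    (by fun_prop)]
  have h : ∀ t : ℝ, ((fun t : ℝ => ENNReal.ofReal (Real.pi * (1 + t ^ 2))) *
      fun t => ENNReal.ofReal (1 / (1 + t ^ 2))) t = ENNReal.ofReal Real.pi := by
    intro t
    have hpos : 0 < 1 + t ^ 2 := by positivity
    rw [Pi.mul_apply, ← ENNReal.ofReal_mul (by positivity), mul_assoc, mul_one_div,
      div_self hpos.ne', mul_one]
  simp only [h, lintegral_const]
  exact ENNReal.mul_lt_top ENNReal.ofReal_lt_top (measure_lt_top _ _)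

/-- On the diagonal this is `inner_defectField`, the weight `1 + t²` having been absorbed into the
measure. The remaining `π` is chosen so that the factor `1/π` of the Herglotz kernel becomes the
required `1/π²`. -/
lemma inner_cauchyVec_cayleyMeasure (hW : W ∈ unitary (H →L[ℂ] H)) (hN : IsStarNormal W)
    (h1 : ∀ y, W y = y → y = 0) (U : EuclideanSpace ℂ (Fin n) →L[ℂ] H) {w z : ℂ}
    (hw : w.im ≠ 0) (hz : z.im ≠ 0) (a b : EuclideanSpace ℂ (Fin n)) :
    inner ℂ (MatrixMeasure.cauchyVec (lintegral_cayleyMeasure_lt_top hN U) z b)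
        (MatrixMeasure.cauchyVec (lintegral_cayleyMeasure_lt_top hN U) w a)
      = Real.pi * inner ℂ (defectField W U z b) (defectField W U w a) := by
  set hμ := lintegral_cayleyMeasure_lt_top hN U
  rw [← inner_smul_right]
  -- Polarization is stated for normed spaces, hence the passage to classes by `toL2`.
  refine inner_eq_of_inner_self_eq ((cayleyMeasure hN U).toL2 ∘ₗ MatrixMeasure.cauchyVec hμ z)
    ((cayleyMeasure hN U).toL2 ∘ₗ MatrixMeasure.cauchyVec hμ w)
    (defectField W U z).toLinearMap ((Real.pi : ℂ) • (defectField W U w).toLinearMap)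
    (fun c => ?_) b a
  change inner ℂ (MatrixMeasure.cauchyVec hμ z c) (MatrixMeasure.cauchyVec hμ w c)
    = inner ℂ (defectField W U z c) ((Real.pi : ℂ) • defectField W U w c)
  rw [inner_smul_right, inner_defectField hW hN h1 U c hw hz, ← integral_const_mul]
  have e1 : inner ℂ (MatrixMeasure.cauchyVec hμ z c) (MatrixMeasure.cauchyVec hμ w c)
      = ∫ t : ℝ, ((t : ℂ) - z)⁻¹ * ((t : ℂ) - conj w)⁻¹
          ∂(cayleyMeasure hN U).scalarMeasure c := by
    rw [MatrixMeasure.integral_scalarMeasure, MatrixMeasure.inner_def]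
    refine integral_congr_ae (ae_of_all _ fun t => ?_)
    dsimp only
    rw [MatrixMeasure.inner_cauchyVec_apply hμ hz, MatrixMeasure.cauchyVec_apply hμ hw, map_smul,
      inner_smul_right]
    ring
  rw [e1, scalarMeasure_cayleyMeasure, integral_withDensity_eq_integral_toReal_smul (by fun_prop)
    (ae_of_all _ fun t => ENNReal.ofReal_lt_top)]
  refine integral_congr_ae (ae_of_all _ fun t => ?_)
  dsimp only
  rw [ENNReal.toReal_ofReal (by positivity), Complex.real_smul, mul_inv]
  push_cast
  ring

end CayleyMeasure

/-! ## The Cauchy transform as a unitary map -/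

section Realization

variable {n : ℕ} {H : Type*} [NormedAddCommGroup H] [InnerProductSpace ℂ H] [CompleteSpace H]
  {Γ : ℂ → EuclideanSpace ℂ (Fin n) →L[ℂ] H}
  {V : ℂ → EuclideanSpace ℂ (Fin n) →L[ℂ] EuclideanSpace ℂ (Fin n)}
  (hV : ∀ w z : ℂ, w.im ≠ 0 → z.im ≠ 0 →
    herglotzKernel V w z = (1 / Real.pi : ℂ) • modelKernel Γ w z)

include hV in
lemma inner_herglotzKernel {w z : ℂ} (hw : w.im ≠ 0) (hz : z.im ≠ 0)
    (a b : EuclideanSpace ℂ (Fin n)) :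
    inner ℂ b (herglotzKernel V w z a) = (1 / Real.pi : ℂ) * inner ℂ (Γ z b) (Γ w a) := by
  rw [hV w z hw hz, smul_apply, inner_smul_right, inner_modelKernel]

include hV in
lemma inner_herglotzKernel_left {w z : ℂ} (hw : w.im ≠ 0) (hz : z.im ≠ 0)
    (a b : EuclideanSpace ℂ (Fin n)) :
    inner ℂ (herglotzKernel V w z a) b = (1 / Real.pi : ℂ) * inner ℂ (Γ w a) (Γ z b) := by
  rw [← inner_conj_symm, inner_herglotzKernel hV hw hz, map_mul, inner_conj_symm, map_div₀, map_one,
    Complex.conj_ofReal]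

include hV in
-- The kernel is `1/π` times a Gram kernel, so its quadratic form is `1/π` times the squared norm of
-- a combination of vectors `Γ x a`.
lemma posSemidef_herglotzMatrix : (herglotzMatrix V).PosSemidef := by
  have htfae := (RKHS.posSemidef_tfae (K := herglotzMatrix V)).out 0 2
  refine htfae.2 ⟨?_, fun v => ?_⟩
  · refine Matrix.IsHermitian.ext fun z w => ContinuousLinearMap.ext fun a =>
      ext_inner_left ℂ fun b => ?_
    refine (ContinuousLinearMap.adjoint_inner_right (herglotzKernel V z w) b a).trans ?_
    rw [inner_herglotzKernel_left hV z.2 w.2]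
    exact (inner_herglotzKernel hV w.2 z.2 a b).symm
  · have h : (v.sum fun x a => v.sum fun x' b => inner ℂ (herglotzMatrix V x' x a) b)
        = (1 / Real.pi : ℂ) * inner ℂ (v.sum fun x a => Γ x a) (v.sum fun x a => Γ x a) := by
      simp only [Finsupp.sum, sum_inner, inner_sum, Finset.mul_sum]
      rw [Finset.sum_comm]
      exact Finset.sum_congr rfl fun x _ => Finset.sum_congr rfl fun y _ =>
        inner_herglotzKernel_left hV y.2 x.2 _ _
    rw [h, show (1 / Real.pi : ℂ) = ((1 / Real.pi : ℝ) : ℂ) by push_cast; rfl]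
    change 0 ≤ Complex.re _
    rw [Complex.re_ofReal_mul, re_inner_self_eq]
    positivity

variable {μ : MatrixMeasure n}
  (hμ : ∀ a, ∫⁻ t : ℝ, ENNReal.ofReal (1 / (1 + t ^ 2)) ∂(μ.scalarMeasure a) < ∞)
  (hg : ∀ w z : ℂ, w.im ≠ 0 → z.im ≠ 0 → ∀ a b, inner ℂ (MatrixMeasure.cauchyVec hμ z b)
    (MatrixMeasure.cauchyVec hμ w a) = Real.pi * inner ℂ (Γ z b) (Γ w a))

include hV hg in
lemma herglotzKernel_apply_eq_integral {w z : ℂ} (hw : w.im ≠ 0) (hz : z.im ≠ 0)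
    (a : EuclideanSpace ℂ (Fin n)) : herglotzKernel V w z a = (1 / (Real.pi : ℂ) ^ 2) •
      μ.integral (fun t => (((t : ℂ) - conj w) * ((t : ℂ) - z))⁻¹ • a) := by
  have hpi : (Real.pi : ℂ) ≠ 0 := by exact_mod_cast Real.pi_ne_zero
  refine ext_inner_left ℂ fun b => ?_
  have e : (fun t : ℝ => (((t : ℂ) - conj w) * ((t : ℂ) - z))⁻¹ • a)
      = fun t : ℝ => ((t : ℂ) - z)⁻¹ • MatrixMeasure.cauchyVec hμ w a t := by
    funext t
    rw [MatrixMeasure.cauchyVec_apply hμ hw, smul_smul, mul_inv, mul_comm]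
  rw [inner_herglotzKernel hV hw hz, inner_smul_right, e, ← MatrixMeasure.inner_cauchyVec hμ hz,
    hg w z hw hz]
  field_simp

include hV hg in
-- The map sends `(i/π)` times a Cauchy kernel to a kernel function; the Gram matrices agree because
-- `π · π⁻² = π⁻¹`. The formula for its values is then the reproducing property, with `1/(π i)` the
-- conjugate of `i/π`.
lemma exists_cauchyTransform_linearIsometryEquiv [Fact (herglotzMatrix V).PosSemidef] :
    ∃ C : μ.L2 ≃ₗᵢ[ℂ] HerglotzSpace V, ∀ (f : μ.L2Fun) (z : {z : ℂ // z.im ≠ 0}),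
      (C (μ.toL2 f)) z = (1 / (Real.pi * Complex.I)) •
        μ.integral (fun t => ((t : ℂ) - (z : ℂ))⁻¹ • f t) := by
  have hpi : (Real.pi : ℂ) ≠ 0 := by exact_mod_cast Real.pi_ne_zero
  have hc : conj (Complex.I / (Real.pi : ℂ)) = 1 / (Real.pi * Complex.I) := by
    rw [map_div₀, Complex.conj_I, Complex.conj_ofReal]
    field_simp
    rw [Complex.I_sq, neg_neg]
  refine Exists.elim (exists_linearIsometryEquiv_of_inner_eq
    (fun i : {z : ℂ // z.im ≠ 0} × EuclideanSpace ℂ (Fin n) =>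
      (Complex.I / (Real.pi : ℂ)) • μ.toL2 (MatrixMeasure.cauchyVec hμ i.1 i.2))
    (fun i => RKHS.kerFun (HerglotzSpace V) i.1 i.2) ?_ ?_ ?_) fun C hC => ?_
  · intro y hy
    refine MatrixMeasure.eq_zero_of_inner_cauchyVec_eq_zero hμ y fun w hw a => ?_
    have := hy (⟨w, hw⟩, a)
    rw [inner_smul_left, hc] at this
    exact (mul_eq_zero.1 this).resolve_left (by simp [hpi])
  · intro y hy
    refine RKHS.ext fun z => ext_inner_left ℂ fun b => ?_
    rw [← RKHS.kerFun_inner, hy (z, b), RKHS.coe_zero, Pi.zero_apply, inner_zero_right]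
  · intro i j
    rw [← RKHS.kernel_inner, RKHS.OfKernel.kernel_ofKernel, inner_smul_left, inner_smul_right, hc,
      MatrixMeasure.inner_toL2, hg _ _ j.1.2 i.1.2]
    refine (inner_herglotzKernel_left hV i.1.2 j.1.2 i.2 j.2).trans ?_
    field_simp
  · refine ⟨C, fun f z => ext_inner_left ℂ fun b => ?_⟩
    rw [← RKHS.kerFun_inner, ← hC (z, b), C.inner_map_map, inner_smul_left, hc, inner_smul_right,
      MatrixMeasure.inner_toL2, MatrixMeasure.inner_cauchyVec hμ z.2]

include hg in
-- The unitary map takes `√π Γ(w) a` to the Cauchy kernel at `w`. It respects the orthogonality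
-- relations that characterize the two graphs.
lemma unitarilyEquivalent_mulOperator {T : H →ₗ.[ℂ] H}
    (ht : ∀ y : H, (∀ w : ℂ, w.im ≠ 0 → w ≠ -Complex.I → ∀ a, inner ℂ (Γ w a) y = 0) → y = 0)
    (hT : ∀ p : H × H, p ∈ T.graph ↔
      ∀ w : ℂ, w.im ≠ 0 → ∀ a, inner ℂ (Γ w a) (p.2 - w • p.1) = 0) :
    UnitarilyEquivalent T μ.mulOperator := by
  have hpi : ((√Real.pi : ℝ) : ℂ) ≠ 0 := by exact_mod_cast (Real.sqrt_pos.2 Real.pi_pos).ne'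
  refine Exists.elim (exists_linearIsometryEquiv_of_inner_eq
    (fun i : {z : ℂ // z.im ≠ 0} × EuclideanSpace ℂ (Fin n) =>
      ((√Real.pi : ℝ) : ℂ) • Γ i.1 i.2)
    (fun i => μ.toL2 (MatrixMeasure.cauchyVec hμ i.1 i.2)) ?_ ?_ ?_) fun J hJ => ?_
  · intro y hy
    refine ht y fun w hw _ a => ?_
    have := hy (⟨w, hw⟩, a)
    rw [inner_smul_left, Complex.conj_ofReal] at this
    exact (mul_eq_zero.1 this).resolve_left hpi
  · exact fun y hy => MatrixMeasure.eq_zero_of_inner_cauchyVec_eq_zero hμ y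
      fun w hw a => hy (⟨w, hw⟩, a)
  · intro i j
    rw [MatrixMeasure.inner_toL2, hg _ _ j.1.2 i.1.2, inner_smul_left, inner_smul_right,
      Complex.conj_ofReal, ← mul_assoc, ← Complex.ofReal_mul, Real.mul_self_sqrt Real.pi_pos.le]
  · have key : ∀ w : ℂ, w.im ≠ 0 → ∀ a x,
        inner ℂ (μ.toL2 (MatrixMeasure.cauchyVec hμ w a)) (J x) = 0 ↔ inner ℂ (Γ w a) x = 0 := by
      intro w hw a x
      rw [← hJ (⟨w, hw⟩, a), J.inner_map_map, inner_smul_left, Complex.conj_ofReal, mul_eq_zero]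
      exact or_iff_right hpi
    refine ⟨J, fun x y => ?_⟩
    rw [MatrixMeasure.mulOperator_graph, hT, MatrixMeasure.mem_mulGraph_iff hμ]
    · refine forall_congr' fun w => forall_congr' fun hw => forall_congr' fun a => ?_
      dsimp only
      rw [← map_smul, ← map_sub, key w hw]
    · intro y hy
      rw [← J.apply_symm_apply y, ht (J.symm y), map_zero]
      intro w hw hne a
      rw [← key w hw, J.apply_symm_apply]
      exact hy w hw hne a

end Realization

end

/-! ### Proof of the corollary -/

theorem mainTheorem11 {H : Type*} [NormedAddCommGroup H] [InnerProductSpace ℂ H] [CompleteSpace H]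
    [TopologicalSpace.SeparableSpace H] (n : ℕ) (T : H →ₗ.[ℂ] H) (hT : IsSimpleSymmetric n T) :
    (∃ Γ : ℂ → EuclideanSpace ℂ (Fin n) →L[ℂ] H, IsModel T Γ) ∧
    ∀ Γ : ℂ → EuclideanSpace ℂ (Fin n) →L[ℂ] H, IsModel T Γ →
      ∃ μ : MatrixMeasure n,
        (∀ a, ∫⁻ t : ℝ, ENNReal.ofReal (1 / (1 + t ^ 2)) ∂(μ.scalarMeasure a) < ∞) ∧
        (∀ w z : ℂ, w.im ≠ 0 → z.im ≠ 0 → ∀ a, herglotzKernel (livsic Γ) w z a =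
          (1 / (Real.pi : ℂ) ^ 2) •
            μ.integral (fun t => (((t : ℂ) - conj w) * ((t : ℂ) - z))⁻¹ • a)) ∧
        (∃ _ : Fact (herglotzMatrix (livsic Γ)).PosSemidef,
          ∃ C : μ.L2 ≃ₗᵢ[ℂ] HerglotzSpace (livsic Γ),
            ∀ (f : μ.L2Fun) (z : {z : ℂ // z.im ≠ 0}), (C (μ.toL2 f)) z =
              (1 / (Real.pi * Complex.I)) •
                μ.integral (fun t => ((t : ℂ) - (z : ℂ))⁻¹ • f t)) ∧
        UnitarilyEquivalent T μ.mulOperator := by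
  refine ⟨exists_isModel hT, fun Γ hΓ => ?_⟩
  have hI : Complex.I.im ≠ 0 := by simp
  have hI' : (-Complex.I).im ≠ 0 := by simp
  have hu := hΓ.isUnit_kernel Complex.I Complex.I (Or.inl (by simp))
  have hu' := hΓ.isUnit_kernel (-Complex.I) (-Complex.I) (Or.inr (by simp))
  -- The extension is adapted to the given model through its normalized values at `i` and `-i`; any
  -- other choice of isometries would change `Ω`, and with it `μ`, in general.
  obtain ⟨W, hW⟩ := exists_isCayleyExtension hT.symmetric (adjoint_normalizedModel_comp hu)
    (adjoint_normalizedModel_comp hu') ((range_normalizedModel hu).trans (hΓ.range_eq _ hI))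
    ((range_normalizedModel hu').trans (hΓ.range_eq _ hI'))
  set U := normalizedModel Γ Complex.I with hU
  have hN : IsStarNormal W := isStarNormal_of_mem_unitary hW.mem_unitary
  have h1 : ∀ y, W y = y → y = 0 := fun y hy => hW.eq_zero_of_map_eq hT.dense hy
  have hr : ∀ w : ℂ, w.im ≠ 0 →
      LinearMap.range (Γ w).toLinearMap = LinearMap.range (defectField W U w).toLinearMap :=
    fun w hw => (hΓ.range_eq w hw).trans (hW.range_defectField hw).symm
  have ht : ∀ y, (∀ w : ℂ, w.im ≠ 0 → ∀ a, inner ℂ (defectField W U w a) y = 0) → y = 0 :=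
    hW.defectField_total_of_simple hT.symmetric hT.closed hT.simple
  have hV : ∀ w z : ℂ, w.im ≠ 0 → z.im ≠ 0 → herglotzKernel (livsic Γ) w z
      = (1 / Real.pi : ℂ) • modelKernel (defectField W U) w z := fun w z hw hz =>
    herglotzKernel_eq hW.mem_unitary hW.isometry
      (fun z hz => herglotzFunction_livsic hW.mem_unitary hu hW.map_defect hΓ.injective hr hz) hz hw
  have hg := fun (w z : ℂ) (hw : w.im ≠ 0) (hz : z.im ≠ 0) =>
    inner_cauchyVec_cayleyMeasure hW.mem_unitary hN h1 U hw hz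
  have hK : Fact (herglotzMatrix (livsic Γ)).PosSemidef := ⟨posSemidef_herglotzMatrix hV⟩
  exact ⟨cayleyMeasure hN U, lintegral_cayleyMeasure_lt_top hN U,
    fun w z hw hz a => herglotzKernel_apply_eq_integral hV _ hg hw hz a,
    ⟨hK, exists_cauchyTransform_linearIsometryEquiv hV _ hg⟩,
    unitarilyEquivalent_mulOperator _ hg (fun y hy => hW.defectField_total ht hI' y hy)
      fun p => hW.mem_graph_iff hT.symmetric hT.closed ht p⟩
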